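/- **Setting.** Let $X$ be a separable metric space with a continuous flow $\phi=\{\phi_t\}_{t\in\mathbb R}$, i.e. $(t,x)\mapsto\phi_t(x)$ is continuous, $\phi_0=\mathrm{id}$, $\phi_s\circ\phi_t=\phi_{s+t}$. Let $E^0\subseteq X$ be a Borel set and $$\Gamma^{\pm}=\{z\in\overline{E^0}\setminus E^0:\ z=\phi_{\pm t}(x)\text{ for some }x\in E^0,\ t>0\text{ with }\phi_{\pm s}(x)\in E^0\text{ for all }s\in[0,t)\}.$$ Put $E=(E^0\cup\Gamma^-)\setminus(\Gamma^-\cap\Gamma^+)$ and $$t_\pm(x)=\inf\{t>0:\ \phi_{\pm t}(x)\in\Gamma^\pm\}\qquad(\inf\emptyset=\infty),$$ except that $t_\pm(x)=0$ for $x\in\Gamma^\pm\setminus\Gamma^\mp$. Assume that every $x\in E^0$ satisfies $\phi_t(x)\in E^0$ for all sufficiently small $|t|$ (so that $t_\pm$ are the exit times from $E^0$; this holds if $E^0$ is open) and that $t_\pm$ are Borel functions on $E^0$. **(1)** There are a Borel measurable map $(t,x)\mapsto J_t(x)\in[0,\infty)$ on $\mathbb R\times X$ with $J_0=1$ and $J_{t+s}(x)=J_t(\phi_s(x))J_s(x)$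 for all $s,t,x$, and a $\sigma$-finite Radon (locally finite and inner regular with respect to compact sets) Borel measure $m$ on $X$ with $m(\partial E)=0$ and $m(\phi_t^{-1}(B))=\int_B J_{-t}\,dm$ for all $t\in\mathbb R$ and all Borel $B$. **(2)** $\vartheta:E\to[0,\infty)$ is measurable and, extended by $0$ to $X$, the function $r\mapsto\vartheta(\phi_r(x))$ is integrable on bounded intervals for every $x\in X$ (equivalently, $t\mapsto\int_0^t\vartheta(\phi_r(x))\,dr$ is absolutely continuous). **(3)** Let $E_\pm=\{x\in E:0<t_\pm(x)<\infty\}$, $W_\pm=\{(s,z):z\in\Gamma^\pm,\ 0<s<t_\mp(z)\}$ and $w_\pm(x)=(t_\pm(x),\phi_{\pm t_\pm(x)}(x))$ for $x\in E_\pm$. There are finite Borel measures $m^\pm$ on $\Gamma^\pm$ with $$m(w_\pm^{-1}(B))=\int_{\Gamma^\pm}\int_{\mathbb R}\mathbf 1_B(s,z)J_{\mp s}(z)\,ds\,m^\pm(dz)\qquad\text{for all Borel }B\subseteq W_\pm .$$ **Operators.** Let $\mathfrak N$ be the set of bounded measurable $\psi:E\to\mathbb R$ with compact support in $E^0$ such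 that for every $x\in E$ the function $t\mapsto\psi(\phi_t(x))$ is continuously differentiable on $(-t_-(x),t_+(x))$ and $\psi'(x):=\frac{d}{dt}\psi(\phi_t(x))|_{t=0}$ is bounded and measurable (with $\psi'=0$ off the support of $\psi$). A function $f\in L^1(E,m)$ is in $\mathcal D_{\max}$, with $\mathrm T_{\max}f=g\in L^1(E,m)$, if $\int_E g\psi\,dm=\int_E f\psi'\,dm$ for all $\psi\in\mathfrak N$. The trace $\gamma^-f$ is defined $m^-$-a.e. on $\Gamma^-$ by $\gamma^-f(z)=\lim_{s\to0^+}f(\phi_s(z))J_s(z)$, for a representative of $f$ for which the limit exists for $m^-$-a.e. $z$. Let $$\mathcal D=\{f\in\mathcal D_{\max}:\gamma^-f\in L^1(\Gamma^-,m^-),\ \vartheta f\in L^1(E,m)\},\qquad Af=\mathrm T_{\max}f-\vartheta f\quad(f\in\mathcal D).$$ **Theorem.** The restriction $A_0$ of $A$ to $\mathcal D(A_0)=\{f\in\mathcal D:\gamma^-f=0\}$ is the generator of a substochastic semigroup $\{S(t)\}_{t\ge0}$ on $L^1(E,m)$, i.e. a strongly continuous semigroup of positive linear contractions. For all $t>0$,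 $f\in L^1(E,m)$ and $m$-a.e. $x\in E$, $$S(t)f(x)=\mathbf 1_{[0,t_-(x))}(t)\,f(\phi_{-t}(x))\,J_{-t}(x)\,e^{-\int_0^t\vartheta(\phi_{-r}(x))\,dr}.$$ If no orbit returns to $E^0$ after leaving it (i.e. $x,\phi_{-t}(x)\in E^0$ with $t>0$ implies $\phi_{-r}(x)\in E^0$ for all $r\in[0,t]$), then $\mathbf 1_{[0,t_-(x))}(t)$ can be replaced in this formula by $\mathbf 1_E(\phi_{-t}(x))$. Moreover, $$\int_E\psi(x)\,S(t)f(x)\,m(dx)=\int_E e^{-\int_0^t\vartheta(\phi_r(x))\,dr}\,\mathbf 1_{[0,t_+(x))}(t)\,\psi(\phi_t(x))\,f(x)\,m(dx)$$ for all $t\ge0$, all $f\in L^1(E,m)$ with $f\ge0$, and all nonnegative Borel measurable $\psi$ (both sides may be $+\infty$). -/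

import Mathlib

open Set Filter Topology MeasureTheory
open scoped ENNReal NNReal

noncomputable section

namespace PDMP

section Boundary

variable {X : Type*} [TopologicalSpace X]

/-- The outgoing boundary: points of `closure E0 \ E0` through which the flow leaves `E0`. -/
def outgoing (φ : Flow ℝ X) (E0 : Set X) : Set X :=
  {z | z ∈ closure E0 \ E0 ∧
    ∃ x ∈ E0, ∃ t : ℝ, 0 < t ∧ z = φ t x ∧ ∀ s ∈ Ico (0 : ℝ) t, φ s x ∈ E0}

/-- The incoming boundary: points of `closure E0 \ E0` through which the flow enters `E0`. -/
def incoming (φ : Flow ℝ X) (E0 : Set X) : Set X :=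
  {z | z ∈ closure E0 \ E0 ∧
    ∃ x ∈ E0, ∃ t : ℝ, 0 < t ∧ z = φ (-t) x ∧ ∀ s ∈ Ico (0 : ℝ) t, φ (-s) x ∈ E0}

/-- The state space `E`. -/
def stateSpace (φ : Flow ℝ X) (E0 : Set X) : Set X :=
  (E0 ∪ incoming φ E0) \ (incoming φ E0 ∩ outgoing φ E0)

open Classical in
/-- Hitting time of the outgoing boundary, with `inf ∅ = ∞`. It is `0` at the points of the
outgoing boundary. A point lying on both boundaries gets the value of the infimum, because there
the function is used as the time at which the orbit that starts at an incoming point exits. -/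
def tPlus (φ : Flow ℝ X) (E0 : Set X) (x : X) : EReal :=
  if x ∈ outgoing φ E0 \ incoming φ E0 then 0
  else ⨅ t ∈ {t : ℝ | 0 < t ∧ φ t x ∈ outgoing φ E0}, (t : EReal)

open Classical in
/-- Hitting time, backwards along the flow, of the incoming boundary (same conventions). -/
def tMinus (φ : Flow ℝ X) (E0 : Set X) (x : X) : EReal :=
  if x ∈ incoming φ E0 \ outgoing φ E0 then 0
  else ⨅ t ∈ {t : ℝ | 0 < t ∧ φ (-t) x ∈ incoming φ E0}, (t : EReal)

/-- `E₊ = {x ∈ E : 0 < t₊(x) < ∞}`. -/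
def EPlus (φ : Flow ℝ X) (E0 : Set X) : Set X :=
  {x | x ∈ stateSpace φ E0 ∧ 0 < tPlus φ E0 x ∧ tPlus φ E0 x < ⊤}

/-- `E₋ = {x ∈ E : 0 < t₋(x) < ∞}`. -/
def EMinus (φ : Flow ℝ X) (E0 : Set X) : Set X :=
  {x | x ∈ stateSpace φ E0 ∧ 0 < tMinus φ E0 x ∧ tMinus φ E0 x < ⊤}

/-- `W₊ = {(s, z) : z ∈ Γ⁺, 0 < s < t₋(z)}`. -/
def WPlus (φ : Flow ℝ X) (E0 : Set X) : Set (ℝ × X) :=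
  {p | p.2 ∈ outgoing φ E0 ∧ 0 < p.1 ∧ (p.1 : EReal) < tMinus φ E0 p.2}

/-- `W₋ = {(s, z) : z ∈ Γ⁻, 0 < s < t₊(z)}`. -/
def WMinus (φ : Flow ℝ X) (E0 : Set X) : Set (ℝ × X) :=
  {p | p.2 ∈ incoming φ E0 ∧ 0 < p.1 ∧ (p.1 : EReal) < tPlus φ E0 p.2}

/-- `w₊(x) = (t₊(x), φ_{t₊(x)} x)`, used on `E₊` only. -/
def wPlus (φ : Flow ℝ X) (E0 : Set X) (x : X) : ℝ × X :=
  ((tPlus φ E0 x).toReal, φ (tPlus φ E0 x).toReal x)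

/-- `w₋(x) = (t₋(x), φ_{-t₋(x)} x)`, used on `E₋` only. -/
def wMinus (φ : Flow ℝ X) (E0 : Set X) (x : X) : ℝ × X :=
  ((tMinus φ E0 x).toReal, φ (-(tMinus φ E0 x).toReal) x)

/-- Standing conventions on `E0`: it is Borel, the flow keeps each of its points inside it for all
sufficiently small positive and negative times (so that `t₊` and `t₋` are the exit times of `E0`
forwards and backwards), and these times are Borel functions on `E0`. -/
structure IsAdmissible [MeasurableSpace X] (φ : Flow ℝ X) (E0 : Set X) : Prop where
  measurableSet : MeasurableSet E0
  stays : ∀ x ∈ E0, ∀ᶠ t in 𝓝 (0 : ℝ), φ t x ∈ E0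
  measurable_tPlus : Measurable (fun x : E0 => tPlus φ E0 x)
  measurable_tMinus : Measurable (fun x : E0 => tMinus φ E0 x)

end Boundary

section Assumptions

variable {X : Type*} [TopologicalSpace X] [MeasurableSpace X]

/-- `J` is a measurable nonnegative cocycle of the flow, `m` is a `σ`-finite Radon measure for which
`∂E` is null, and `J_{-t}` is the density of the image of `m` under `φ_t`. -/
structure IsNonsingular (φ : Flow ℝ X) (E0 : Set X) (J : ℝ → X → ℝ≥0) (m : Measure X) : Prop where
  measurable_cocycle : Measurable (fun p : ℝ × X => J p.1 p.2)
  cocycle_zero : ∀ x, J 0 x = 1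
  cocycle_add : ∀ s t x, J (t + s) x = J t (φ s x) * J s x
  sigmaFinite : SigmaFinite m
  locallyFinite : IsLocallyFiniteMeasure m
  innerRegular : m.InnerRegular
  frontier_null : m (frontier (stateSpace φ E0)) = 0
  density : ∀ t : ℝ, ∀ B : Set X, MeasurableSet B →
    m (φ t ⁻¹' B) = ∫⁻ x in B, (J (-t) x : ℝ≥0∞) ∂m

/-- `ϑ` is a jump rate function on `E`, extended by zero to `X`, whose integral
`t ↦ ∫₀ᵗ ϑ(φ_r x) dr` along each orbit is (finite and) absolutely continuous; this says exactly that
`r ↦ ϑ(φ_r x)` is integrable on bounded intervals. -/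
structure IsJumpRate (φ : Flow ℝ X) (E0 : Set X) (ϑ : X → ℝ≥0) : Prop where
  measurable : Measurable ϑ
  zero_off : ∀ x, x ∉ stateSpace φ E0 → ϑ x = 0
  integrable_orbit : ∀ (x : X) (a b : ℝ),
    IntervalIntegrable (fun r => (ϑ (φ r x) : ℝ)) volume a b

/-- `mp` and `mn` are finite Borel measures on the outgoing and on the incoming boundary which
disintegrate `m` along the flow: the image of `m` under `w_±` is `J_{∓s}(z) ds m^±(dz)`. -/
structure IsBoundaryPair (φ : Flow ℝ X) (E0 : Set X) (J : ℝ → X → ℝ≥0) (m mp mn : Measure X) :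
    Prop where
  finite_plus : IsFiniteMeasure mp
  finite_minus : IsFiniteMeasure mn
  carried_plus : mp (outgoing φ E0)ᶜ = 0
  carried_minus : mn (incoming φ E0)ᶜ = 0
  image_plus : ∀ B : Set (ℝ × X), MeasurableSet B → B ⊆ WPlus φ E0 →
    m {x | x ∈ EPlus φ E0 ∧ wPlus φ E0 x ∈ B} =
      ∫⁻ z, (∫⁻ s : ℝ, B.indicator (fun p => (J (-p.1) p.2 : ℝ≥0∞)) (s, z)) ∂mp
  image_minus : ∀ B : Set (ℝ × X), MeasurableSet B → B ⊆ WMinus φ E0 →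
    m {x | x ∈ EMinus φ E0 ∧ wMinus φ E0 x ∈ B} =
      ∫⁻ z, (∫⁻ s : ℝ, B.indicator (fun p => (J p.1 p.2 : ℝ≥0∞)) (s, z)) ∂mn

end Assumptions

section Operators

variable {X : Type*} [TopologicalSpace X] [MeasurableSpace X]

/-- `L¹(E, m)`. -/
abbrev L1E (φ : Flow ℝ X) (E0 : Set X) (m : Measure X) : Type _ :=
  Lp ℝ 1 (m.restrict (stateSpace φ E0))

/-- The derivative of `ψ` along the flow, `d(ψ ∘ φ_t)/dt` at `t = 0`. -/
def flowDeriv (φ : Flow ℝ X) (ψ : X → ℝ) (x : X) : ℝ :=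
  deriv (fun t : ℝ => ψ (φ t x)) 0

/-- The test functions, extended by zero from `E` to `X`. -/
structure IsTestFunction (φ : Flow ℝ X) (E0 : Set X) (ψ : X → ℝ) : Prop where
  measurable : Measurable ψ
  bounded : ∃ C : ℝ, ∀ x, |ψ x| ≤ C
  hasCompactSupport : HasCompactSupport ψ
  support_subset : tsupport ψ ⊆ E0
  contDiffOn : ∀ x ∈ stateSpace φ E0, ContDiffOn ℝ 1 (fun t : ℝ => ψ (φ t x))
    {t : ℝ | -(tMinus φ E0 x) < (t : EReal) ∧ (t : EReal) < tPlus φ E0 x}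
  deriv_bounded : ∃ C : ℝ, ∀ x, |flowDeriv φ ψ x| ≤ C
  deriv_measurable : Measurable (flowDeriv φ ψ)

/-- The graph of the maximal transport operator: `f ∈ D_max` and `T_max f = g`. -/
def MaxTransport (φ : Flow ℝ X) (E0 : Set X) (m : Measure X) (f g : L1E φ E0 m) : Prop :=
  ∀ ψ : X → ℝ, IsTestFunction φ E0 ψ →
    ∫ x in stateSpace φ E0, g x * ψ x ∂m = ∫ x in stateSpace φ E0, f x * flowDeriv φ ψ x ∂m

/-- `γ⁻ f = h`, `mn`-almost everywhere: for some representative `f'` of `f` the limit of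
`f'(φ_s z) J_s(z)` as `s → 0+` exists and equals `h z` for `mn`-almost every `z`. -/
def HasIncomingTrace (φ : Flow ℝ X) (E0 : Set X) (J : ℝ → X → ℝ≥0) (m mn : Measure X)
    (f : L1E φ E0 m) (h : X → ℝ) : Prop :=
  ∃ f' : X → ℝ, f' =ᵐ[m.restrict (stateSpace φ E0)] f ∧
    ∀ᵐ z ∂mn, Tendsto (fun s : ℝ => f' (φ s z) * (J s z : ℝ)) (𝓝[>] 0) (𝓝 (h z))

/-- The domain `𝒟 = {f ∈ D_max : γ⁻ f ∈ L¹(Γ⁻, m⁻), ϑ f ∈ L¹(E, m)}`. -/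
def domA (φ : Flow ℝ X) (E0 : Set X) (J : ℝ → X → ℝ≥0) (m mn : Measure X) (ϑ : X → ℝ≥0) :
    Set (L1E φ E0 m) :=
  {f | (∃ g, MaxTransport φ E0 m f g) ∧
    (∃ h : X → ℝ, Integrable h mn ∧ HasIncomingTrace φ E0 J m mn f h) ∧
    Integrable (fun x => (ϑ x : ℝ) * f x) (m.restrict (stateSpace φ E0))}

/-- The graph of `A`: `f ∈ 𝒟` and `g = T_max f - ϑ f`. -/
def GraphA (φ : Flow ℝ X) (E0 : Set X) (J : ℝ → X → ℝ≥0) (m mn : Measure X) (ϑ : X → ℝ≥0)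
    (f g : L1E φ E0 m) : Prop :=
  f ∈ domA φ E0 J m mn ϑ ∧ ∃ k : L1E φ E0 m, MaxTransport φ E0 m f k ∧
    g =ᵐ[m.restrict (stateSpace φ E0)] fun x => k x - (ϑ x : ℝ) * f x

/-- The graph of `A₀`, the restriction of `A` to `{f ∈ 𝒟 : γ⁻ f = 0}`. -/
def GraphA0 (φ : Flow ℝ X) (E0 : Set X) (J : ℝ → X → ℝ≥0) (m mn : Measure X) (ϑ : X → ℝ≥0)
    (f g : L1E φ E0 m) : Prop :=
  GraphA φ E0 J m mn ϑ f g ∧ HasIncomingTrace φ E0 J m mn f (fun _ => 0)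

end Operators

section Semigroups

variable {X : Type*} [MeasurableSpace X] {μ : Measure X}

/-- A positive contraction on `L¹(μ)`. -/
structure IsSubstochastic (P : Lp ℝ 1 μ →ₗ[ℝ] Lp ℝ 1 μ) : Prop where
  nonneg : ∀ f, 0 ≤ f → 0 ≤ P f
  norm_le : ∀ f, 0 ≤ f → ‖P f‖ ≤ ‖f‖

/-- A strongly continuous semigroup of substochastic operators on `L¹(μ)`. -/
structure IsSubstochasticSemigroup (S : ℝ≥0 → (Lp ℝ 1 μ →ₗ[ℝ] Lp ℝ 1 μ)) : Prop where
  substochastic : ∀ t, IsSubstochastic (S t)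
  map_zero : S 0 = LinearMap.id
  map_add : ∀ s t, S (s + t) = S s ∘ₗ S t
  continuous : ∀ f, Continuous (fun t => S t f)

/-- The graph of the infinitesimal generator: `(S(t) f - f) / t → g` in `L¹(μ)` as `t → 0+`. -/
def GraphGenerator (S : ℝ≥0 → (Lp ℝ 1 μ →ₗ[ℝ] Lp ℝ 1 μ)) (f g : Lp ℝ 1 μ) : Prop :=
  Tendsto (fun t : ℝ≥0 => (t : ℝ)⁻¹ • (S t f - f)) (𝓝[>] 0) (𝓝 g)

end Semigroups

end PDMP

end

/-! The semigroup is written down explicitly as `killedL1`: transport of densities, `f(φ_{-t}x)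
J_{-t}(x)`, multiplied by the survival factor that vanishes once the backward orbit has left `E0`
and otherwise equals the exponential of minus the accumulated jump rate. Transport is an `L¹`
isometry by the change of variables for the cocycle, and the survival factor is multiplicative along
orbits. This gives the semigroup law, positivity, contractivity, the pointwise formulas and the
duality formula. Each orbit meets the incoming boundary at countably many times only, so by Fubini
and quasi-invariance that boundary is `m`-null (`IsNonsingular.incoming_null`), and `L¹(E, m)` may
be treated as `L¹(E0, m)`. Strong continuity comes from continuity of translations in `L¹(ℝ)`,
applied orbit by orbit.

The generator is identified through the resolvent at `1`, `R h = ∫₀^∞ e^{-r} S(r)h dr`. Both graphs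
are shown to consist of the pairs with `f = R(f - g)`. For the generator this is
`graphGenerator_iff_ae_eq_resolvent`, where uniqueness holds because the generator of a contraction
semigroup does not have `1` as an eigenvalue.

If `f = R h` with `h = f - g`, then `(f, g)` is in the graph of `A₀` (`graphA0_of_ae_eq_resolvent`).
The trace vanishes because near an entrance point `z` the quantity `|R h(φ_s z)| J_s(z)` is at most
the integral over `(0, s)` of a function that the disintegration of `m` makes integrable for almost
every `z`. The product `ϑ f` is integrable because `∫ (1 + ϑ) exp(-∫(1 + ϑ)) ≤ 1` along each orbit.
The weak equation follows by duality: for a test function `ψ`, integrating `ψ' - (1 + ϑ)ψ` along the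
forward orbit against the survival weight returns `-ψ`, by parts.

Conversely (`ae_eq_resolvent_of_graphA0`), a weak solution must be recovered along orbits. Averaging
the indicator of a compact set twice along the flow gives admissible test functions. Letting the
second averaging length shrink, and using inner regularity of `m`, yields the integral equation
`ae_transport_eq` for the transported density. An exponential weight turns it into `∫₀^T e^{-r}S(r)h
dr = f - e^{-T}S(T)f` at almost every point. As `T` increases to `t₋(x)`, the last term disappears:
by the zero trace if `t₋(x)` is finite, by integrability in `T` if it is infinite. -/

namespace PDMP

set_option linter.unusedSectionVars false

/-! ### Exit times, entrance points and survival along orbits. -/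

section ExitTimes

variable {X : Type*} [TopologicalSpace X] {φ : Flow ℝ X} {E0 : Set X}

/-- Every point of `E0` stays in `E0` for all sufficiently small times, forwards and backwards. -/
def StaysIn (φ : Flow ℝ X) (E0 : Set X) : Prop :=
  ∀ x ∈ E0, ∀ᶠ t in 𝓝 (0 : ℝ), φ t x ∈ E0

theorem flow_neg_flow (φ : Flow ℝ X) (t : ℝ) (x : X) : φ (-t) (φ t x) = x := by
  rw [← φ.map_add]; simp

theorem flow_flow_neg (φ : Flow ℝ X) (t : ℝ) (x : X) : φ t (φ (-t) x) = x := by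
  rw [← φ.map_add]; simp

/-- Time reversal exchanges the two boundaries and the two exit times, so the backward statements
below are forward statements for `φ.reverse`. -/
theorem StaysIn.reverse (hs : StaysIn φ E0) : StaysIn φ.reverse E0 := fun x hx => by
  have h : Tendsto (fun t : ℝ => -t) (𝓝 0) (𝓝 0) := by
    simpa using (continuous_neg (G := ℝ)).tendsto 0
  exact h.eventually (hs x hx)

theorem outgoing_reverse : outgoing φ.reverse E0 = incoming φ E0 := rfl

theorem incoming_reverse : incoming φ.reverse E0 = outgoing φ E0 := by
  simp [incoming, outgoing]

theorem tPlus_reverse : tPlus φ.reverse E0 = tMinus φ E0 := by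
  ext x
  simp only [tPlus, tMinus]
  rw [incoming_reverse (φ := φ), outgoing_reverse (φ := φ)]
  rfl

theorem StaysIn.exists_forward (hs : StaysIn φ E0) {x : X} {t : ℝ} (hx : φ t x ∈ E0) :
    ∃ δ > 0, ∀ r, |r - t| < δ → φ r x ∈ E0 := by
  obtain ⟨δ, hδ, h⟩ := Metric.eventually_nhds_iff.1 (hs _ hx)
  refine ⟨δ, hδ, fun r hr => ?_⟩
  have := @h (r - t) (by simpa [Real.dist_eq] using hr)
  rwa [← φ.map_add, sub_add_cancel] at this

/-- The exit time is the infimum of the times spent outside `E0`. The times spent inside form an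
open set, so the infimum is itself an exit, and it is a limit of times spent inside. -/
theorem StaysIn.exists_exit (hs : StaysIn φ E0) {x : X} (hx : x ∈ E0) {r : ℝ} (hr : 0 ≤ r)
    (hxr : φ r x ∉ E0) :
    ∃ σ, 0 < σ ∧ σ ≤ r ∧ φ σ x ∈ outgoing φ E0 ∧ ∀ q ∈ Ico 0 σ, φ q x ∈ E0 := by
  set A : Set ℝ := {q | 0 ≤ q ∧ φ q x ∉ E0}
  have hA : BddBelow A := ⟨0, fun q hq => hq.1⟩
  have hne : A.Nonempty := ⟨r, hr, hxr⟩
  set σ := sInf A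
  have hσ0 : 0 ≤ σ := le_csInf hne fun q hq => hq.1
  have hlt : ∀ q ∈ Ico 0 σ, φ q x ∈ E0 := fun q hq => by
    by_contra h
    exact absurd (csInf_le hA (show q ∈ A from ⟨hq.1, h⟩)) (not_le.2 hq.2)
  have hσ : φ σ x ∉ E0 := fun h => by
    obtain ⟨δ, hδ, hd⟩ := hs.exists_forward h
    obtain ⟨q, hq, hqlt⟩ := exists_lt_of_csInf_lt hne (show sInf A < σ + δ by linarith)
    have h1 : σ ≤ q := csInf_le hA hq
    exact hq.2 (hd q (by rw [abs_of_nonneg (by linarith)]; linarith))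
  have hpos : 0 < σ := by
    rcases hσ0.lt_or_eq with h | h
    · exact h
    · rw [← h] at hσ; simp [hx] at hσ
  refine ⟨σ, hpos, csInf_le hA ⟨hr, hxr⟩, ⟨⟨?_, hσ⟩, x, hx, σ, hpos, rfl, hlt⟩, hlt⟩
  -- The exit point is in the closure of `E0` because `σ` is a limit of times in `[0, σ)`.
  have hmem : σ ∈ closure (Ico 0 σ) := by
    rw [closure_Ico hpos.ne]; exact ⟨hpos.le, le_rfl⟩
  have hcont : Continuous fun q : ℝ => φ q x := by fun_prop
  exact map_mem_closure (f := fun q : ℝ => φ q x) hcont hmem fun q hq => hlt q hq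

theorem tPlus_of_mem {x : X} (hx : x ∈ E0) :
    tPlus φ E0 x = ⨅ t ∈ {t : ℝ | 0 < t ∧ φ t x ∈ outgoing φ E0}, (t : EReal) :=
  if_neg fun h => h.1.1.2 hx

theorem tPlus_le {x : X} (hx : x ∈ E0) {t : ℝ} (ht : 0 < t) (h : φ t x ∈ outgoing φ E0) :
    tPlus φ E0 x ≤ t := by
  rw [tPlus_of_mem hx]
  exact iInf₂_le (f := fun (t : ℝ) _ => (t : EReal)) t ⟨ht, h⟩

/-- Along an orbit that is in `E0` during `(0, t]`, the outgoing boundary is not reached before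
some time later than `t`. -/
theorem StaysIn.lt_iInf_outgoing (hs : StaysIn φ E0) {x : X} {t : ℝ} (hx : φ t x ∈ E0)
    (h : ∀ r ∈ Ioc 0 t, φ r x ∈ E0) :
    (t : EReal) < ⨅ r ∈ {r : ℝ | 0 < r ∧ φ r x ∈ outgoing φ E0}, (r : EReal) := by
  obtain ⟨δ, hδ, hd⟩ := hs.exists_forward hx
  refine lt_of_lt_of_le (b := ((t + δ : ℝ) : EReal)) (by exact_mod_cast (by linarith)) ?_
  refine le_iInf₂ fun r hr => ?_
  by_contra! hlt
  have hlt' : r < t + δ := by exact_mod_cast hlt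
  refine hr.2.1.2 ?_
  rcases le_or_gt r t with hrt | hrt
  · exact h r ⟨hr.1, hrt⟩
  · exact hd r (by rw [abs_of_pos (by linarith)]; linarith)

/-- This trades the infimum in `EReal` for a condition on an orbit segment. -/
theorem StaysIn.lt_tPlus_iff (hs : StaysIn φ E0) {x : X} (hx : x ∈ E0) {t : ℝ} (ht : 0 ≤ t) :
    (t : EReal) < tPlus φ E0 x ↔ ∀ r ∈ Icc 0 t, φ r x ∈ E0 := by
  refine ⟨fun h r hr => ?_, fun h => ?_⟩
  · by_contra hxr
    obtain ⟨σ, h0, hle, hout, -⟩ := hs.exists_exit hx hr.1 hxr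
    have : tPlus φ E0 x ≤ t := (tPlus_le hx h0 hout).trans (by exact_mod_cast hle.trans hr.2)
    exact absurd h (not_lt.2 this)
  · rw [tPlus_of_mem hx]
    exact hs.lt_iInf_outgoing (h t ⟨ht, le_rfl⟩) fun r hr => h r ⟨hr.1.le, hr.2⟩

theorem StaysIn.tPlus_pos (hs : StaysIn φ E0) {x : X} (hx : x ∈ E0) : 0 < tPlus φ E0 x := by
  refine (hs.lt_tPlus_iff hx (le_refl (0 : ℝ))).2 fun r hr => ?_
  obtain rfl : r = 0 := le_antisymm hr.2 hr.1
  simpa using hx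

theorem StaysIn.coe_toReal_tPlus (hs : StaysIn φ E0) {x : X} (hx : x ∈ E0)
    (h : tPlus φ E0 x < ⊤) : ((tPlus φ E0 x).toReal : EReal) = tPlus φ E0 x :=
  EReal.coe_toReal h.ne (bot_lt_iff_ne_bot.1 (bot_le.trans_lt (hs.tPlus_pos hx)))

theorem StaysIn.toReal_tPlus_pos (hs : StaysIn φ E0) {x : X} (hx : x ∈ E0)
    (h : tPlus φ E0 x < ⊤) : 0 < (tPlus φ E0 x).toReal := by
  have h0 := hs.tPlus_pos hx
  rw [← hs.coe_toReal_tPlus hx h] at h0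
  exact_mod_cast h0

theorem StaysIn.flow_tPlus_mem (hs : StaysIn φ E0) {x : X} (hx : x ∈ E0)
    (h : tPlus φ E0 x < ⊤) : φ (tPlus φ E0 x).toReal x ∈ outgoing φ E0 := by
  have hτ := hs.coe_toReal_tPlus hx h
  have h0 := hs.toReal_tPlus_pos hx h
  set τ := (tPlus φ E0 x).toReal
  have h1 : ¬ (τ : EReal) < tPlus φ E0 x := by rw [hτ]; exact lt_irrefl _
  rw [hs.lt_tPlus_iff hx h0.le] at h1
  push Not at h1
  obtain ⟨r, hr, hxr⟩ := h1
  obtain ⟨σ, hσ0, hle, hout, -⟩ := hs.exists_exit hx hr.1 hxr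
  have h2 := tPlus_le hx hσ0 hout
  rw [← hτ] at h2
  have h3 : τ ≤ σ := by exact_mod_cast h2
  rwa [← le_antisymm h3 (hle.trans hr.2)] at hout

theorem StaysIn.lt_tMinus_iff (hs : StaysIn φ E0) {x : X} (hx : x ∈ E0) {t : ℝ} (ht : 0 ≤ t) :
    (t : EReal) < tMinus φ E0 x ↔ ∀ r ∈ Icc 0 t, φ (-r) x ∈ E0 := by
  rw [← tPlus_reverse]; exact hs.reverse.lt_tPlus_iff hx ht

theorem StaysIn.tMinus_pos (hs : StaysIn φ E0) {x : X} (hx : x ∈ E0) : 0 < tMinus φ E0 x := by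
  simpa only [tPlus_reverse] using hs.reverse.tPlus_pos hx

theorem StaysIn.coe_toReal_tMinus (hs : StaysIn φ E0) {x : X} (hx : x ∈ E0)
    (h : tMinus φ E0 x < ⊤) : ((tMinus φ E0 x).toReal : EReal) = tMinus φ E0 x := by
  rw [← tPlus_reverse] at h ⊢; exact hs.reverse.coe_toReal_tPlus hx h

theorem StaysIn.toReal_tMinus_pos (hs : StaysIn φ E0) {x : X} (hx : x ∈ E0)
    (h : tMinus φ E0 x < ⊤) : 0 < (tMinus φ E0 x).toReal := by
  rw [← tPlus_reverse] at h ⊢; exact hs.reverse.toReal_tPlus_pos hx h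

theorem StaysIn.flow_tMinus_mem (hs : StaysIn φ E0) {x : X} (hx : x ∈ E0)
    (h : tMinus φ E0 x < ⊤) : φ (-(tMinus φ E0 x).toReal) x ∈ incoming φ E0 := by
  rw [← tPlus_reverse] at h ⊢; exact hs.reverse.flow_tPlus_mem hx h

/-- The orbits through the incoming boundary enter `E0` immediately. -/
theorem exists_forall_mem_of_mem_incoming {z : X} (hz : z ∈ incoming φ E0) :
    ∃ δ > 0, ∀ s ∈ Ioc 0 δ, φ s z ∈ E0 := by
  obtain ⟨-, x, hx, t, ht, rfl, h⟩ := hz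
  refine ⟨t, ht, fun s hs => ?_⟩
  have := h (t - s) ⟨by linarith [hs.2], by linarith [hs.1]⟩
  rwa [← φ.map_add, show s + -t = -(t - s) by ring]

/-- An orbit point has backward exit time `s` exactly when the segment behind it started on the
incoming boundary. This links `entrance`, which is Borel by its definition, to the geometry of the
boundary. -/
theorem StaysIn.tMinus_eq_iff (hs : StaysIn φ E0) {z : X} {s : ℝ} (h0 : 0 < s)
    (hz : φ s z ∈ E0) :
    tMinus φ E0 (φ s z) = s ↔ z ∈ incoming φ E0 ∧ ∀ r ∈ Ioc 0 s, φ r z ∈ E0 := by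
  refine ⟨fun h => ⟨?_, fun r hr => ?_⟩, fun h => le_antisymm ?_ ?_⟩
  · have := hs.flow_tMinus_mem hz (by rw [h]; exact EReal.coe_lt_top s)
    rwa [h, EReal.toReal_coe, flow_neg_flow] at this
  · have h1 : ((s - r : ℝ) : EReal) < tMinus φ E0 (φ s z) := by
      rw [h]; exact_mod_cast (by linarith [hr.1])
    have := (hs.lt_tMinus_iff hz (by linarith [hr.2])).1 h1 (s - r) ⟨by linarith [hr.2], le_rfl⟩
    rwa [← φ.map_add, show -(s - r) + s = r by ring] at this
  · have := tPlus_le (φ := φ.reverse) hz h0 (by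
      rw [outgoing_reverse, Flow.reverse_apply, flow_neg_flow]; exact h.1)
    rwa [tPlus_reverse] at this
  · refine le_of_forall_lt_imp_le_of_dense ?_
    intro a ha
    by_contra! hlt
    obtain ⟨q, hq1, hq2⟩ := EReal.lt_iff_exists_real_btwn.1 hlt
    have hqs : q < s := by exact_mod_cast hq2.trans ha
    have hq0 : 0 ≤ q := by
      have := (hs.tMinus_pos hz).trans hq1
      exact_mod_cast this.le
    refine absurd hq1 (not_lt.2 ((hs.lt_tMinus_iff hz hq0).2 fun r hr => ?_).le)
    rw [← φ.map_add]
    exact h.2 _ ⟨by linarith [hr.2], by linarith [hr.1]⟩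

/-- The part of `ℝ × X` that `w₋` parametrizes, described by the backward exit time from `E0`. -/
def entrance (φ : Flow ℝ X) (E0 : Set X) : Set (ℝ × X) :=
  {p | 0 < p.1 ∧ φ p.1 p.2 ∈ E0 ∧ tMinus φ E0 (φ p.1 p.2) = p.1}

theorem StaysIn.entrance_subset (hs : StaysIn φ E0) : entrance φ E0 ⊆ WMinus φ E0 := by
  rintro ⟨s, z⟩ ⟨h0, hz, h⟩
  rw [hs.tMinus_eq_iff h0 hz] at h
  refine ⟨h.1, h0, ?_⟩
  have : tPlus φ E0 z = ⨅ t ∈ {t : ℝ | 0 < t ∧ φ t z ∈ outgoing φ E0}, (t : EReal) :=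
    if_neg fun hh => hh.2 h.1
  rw [this]
  exact hs.lt_iInf_outgoing hz h.2

theorem StaysIn.exists_entrance (hs : StaysIn φ E0) {z : X} (hz : z ∈ incoming φ E0) :
    ∃ δ > 0, ∀ s ∈ Ioc 0 δ, (s, z) ∈ entrance φ E0 := by
  obtain ⟨δ, hδ, h⟩ := exists_forall_mem_of_mem_incoming hz
  refine ⟨δ, hδ, fun s hs' => ⟨hs'.1, h s hs', ?_⟩⟩
  exact (hs.tMinus_eq_iff hs'.1 (h s hs')).2 ⟨hz, fun r hr => h r ⟨hr.1, hr.2.trans hs'.2⟩⟩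

theorem StaysIn.wMinus_mem_entrance (hs : StaysIn φ E0) {x : X} (hx : x ∈ E0)
    (h : tMinus φ E0 x < ⊤) : wMinus φ E0 x ∈ entrance φ E0 := by
  refine ⟨hs.toReal_tMinus_pos hx h, ?_, ?_⟩ <;> simp only [wMinus, flow_flow_neg]
  · exact hx
  · exact (hs.coe_toReal_tMinus hx h).symm

/-- The definition of the incoming boundary quantifies over uncountably many points and times.
Sections of `entrance` at the times `1/(n+1)` suffice, which makes the boundary Borel. -/
theorem incoming_eq_iUnion (hs : StaysIn φ E0) :
    incoming φ E0 = ⋃ n : ℕ, {z | ((1 / ((n : ℝ) + 1)), z) ∈ entrance φ E0} := by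
  ext z
  simp only [mem_iUnion, mem_ofPred_eq]
  refine ⟨fun hz => ?_, fun ⟨n, h0, hz, h⟩ => ((hs.tMinus_eq_iff h0 hz).1 h).1⟩
  obtain ⟨δ, hδ, h⟩ := hs.exists_entrance hz
  obtain ⟨n, hn⟩ := exists_nat_one_div_lt hδ
  exact ⟨n, h _ ⟨by positivity, hn.le⟩⟩

/-- An orbit meets the incoming boundary at countably many times only. -/
theorem countable_incoming_times (x : X) : {t : ℝ | φ t x ∈ incoming φ E0}.Countable := by
  -- After an entrance the orbit is inside `E0`, hence off the boundary, for a while: entrance times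
  -- are isolated from the right, and a set of reals has only countably many such points.
  refine countable_setOfPred_isolated_right_within (s := {t : ℝ | φ t x ∈ incoming φ E0}) |>.mono ?_
  intro t ht
  refine ⟨ht, ?_⟩
  obtain ⟨δ, hδ, h⟩ := exists_forall_mem_of_mem_incoming ht
  rw [← empty_mem_iff_bot, mem_nhdsWithin]
  refine ⟨Iio (t + δ), isOpen_Iio, by simp [hδ], ?_⟩
  rintro q ⟨hq, hq1, hq2⟩
  have hq2' : t < q := hq2
  have hq' : q < t + δ := hq
  have := h (q - t) ⟨by linarith, by linarith⟩
  rw [← φ.map_add, sub_add_cancel] at this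
  exact hq1.1.2 this

theorem stateSpace_subset : stateSpace φ E0 ⊆ E0 ∪ incoming φ E0 := sdiff_subset

theorem subset_stateSpace : E0 ⊆ stateSpace φ E0 :=
  fun _ hx => ⟨Or.inl hx, fun h => h.1.1.2 hx⟩

/-- The points of `E0` whose backward orbit does not leave `E0` up to time `t`. -/
def alive (φ : Flow ℝ X) (E0 : Set X) (t : ℝ) : Set X :=
  {x | x ∈ E0 ∧ (t : EReal) < tMinus φ E0 x}

theorem StaysIn.mem_alive_iff (hs : StaysIn φ E0) {x : X} {t : ℝ} (ht : 0 ≤ t) :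
    x ∈ alive φ E0 t ↔ ∀ r ∈ Icc 0 t, φ (-r) x ∈ E0 := by
  refine ⟨fun h => (hs.lt_tMinus_iff h.1 ht).1 h.2, fun h => ?_⟩
  have hx : x ∈ E0 := by simpa using h 0 ⟨le_rfl, ht⟩
  exact ⟨hx, (hs.lt_tMinus_iff hx ht).2 h⟩

/-- The same orbit segment read in both directions; this is what turns `t₋` into `t₊` in the duality
formula. -/
theorem StaysIn.flow_mem_alive_iff (hs : StaysIn φ E0) {x : X} {t : ℝ} (ht : 0 ≤ t) :
    φ t x ∈ alive φ E0 t ↔ x ∈ E0 ∧ (t : EReal) < tPlus φ E0 x := by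
  rw [hs.mem_alive_iff ht]
  refine ⟨fun h => ?_, fun h r hr => ?_⟩
  · have hx : x ∈ E0 := by simpa [flow_neg_flow] using h t ⟨ht, le_rfl⟩
    refine ⟨hx, (hs.lt_tPlus_iff hx ht).2 fun r hr => ?_⟩
    have := h (t - r) ⟨by linarith [hr.2], by linarith [hr.1]⟩
    rwa [← φ.map_add, show -(t - r) + t = r by ring] at this
  · rw [← φ.map_add]
    exact (hs.lt_tPlus_iff h.1 ht).1 h.2 _ ⟨by linarith [hr.2], by linarith [hr.1]⟩

theorem StaysIn.mem_alive_add_iff (hs : StaysIn φ E0) {x : X} {s t : ℝ} (h0 : 0 ≤ s)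
    (ht : 0 ≤ t) :
    x ∈ alive φ E0 (s + t) ↔ x ∈ alive φ E0 s ∧ φ (-s) x ∈ alive φ E0 t := by
  rw [hs.mem_alive_iff h0, hs.mem_alive_iff ht, hs.mem_alive_iff (add_nonneg h0 ht)]
  refine ⟨fun h => ⟨fun r hr => h r ⟨hr.1, by linarith [hr.2]⟩, fun r hr => ?_⟩,
    fun h r hr => ?_⟩
  · rw [← φ.map_add, ← neg_add]
    exact h _ ⟨by linarith [hr.1], by linarith [hr.2]⟩
  · rcases le_or_gt r s with hrs | hrs
    · exact h.1 r ⟨hr.1, hrs⟩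
    · have := h.2 (r - s) ⟨by linarith, by linarith [hr.2]⟩
      rwa [← φ.map_add, show -(r - s) + -s = -r by ring] at this

theorem flow_neg_mem_of_mem_alive (hs : StaysIn φ E0) {x : X} {t : ℝ} (ht : 0 ≤ t)
    (hx : x ∈ alive φ E0 t) : φ (-t) x ∈ E0 :=
  (hs.mem_alive_iff ht).1 hx t ⟨ht, le_rfl⟩

end ExitTimes

/-! ### Borel measurability of the sets built from exit times. -/

section Measurability

variable {X : Type*} [TopologicalSpace X] [SecondCountableTopology X] [MeasurableSpace X]
  [BorelSpace X] {φ : Flow ℝ X} {E0 : Set X}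

theorem IsAdmissible.staysIn (hE : IsAdmissible φ E0) : StaysIn φ E0 := hE.stays

theorem measurable_flow_uncurry (φ : Flow ℝ X) : Measurable fun p : ℝ × X => φ p.1 p.2 :=
  φ.cont'.measurable

theorem measurable_flow_apply {β : Type*} [MeasurableSpace β] {t : β → ℝ} {f : β → X}
    (φ : Flow ℝ X) (ht : Measurable t) (hf : Measurable f) :
    Measurable fun b => φ (t b) (f b) :=
  (measurable_flow_uncurry φ).comp (ht.prodMk hf)

theorem measurable_flow (φ : Flow ℝ X) (t : ℝ) : Measurable fun x => φ t x :=
  measurable_flow_apply φ measurable_const measurable_id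

/-- Measurability of `t₋` is assumed on `E0` only, so measurable constructions use its extension by
zero. -/
theorem IsAdmissible.measurable_indicator_tMinus (hE : IsAdmissible φ E0) :
    Measurable (E0.indicator (tMinus φ E0)) := by
  refine measurable_of_restrict_of_restrict_compl hE.measurableSet ?_ ?_
  · convert! hE.measurable_tMinus using 1
    ext x
    simp
  · convert! measurable_const (a := (0 : EReal)) using 1
    ext x
    exact indicator_of_notMem x.2 _

theorem IsAdmissible.measurableSet_alive_prod (hE : IsAdmissible φ E0) :
    MeasurableSet {p : ℝ × X | p.2 ∈ alive φ E0 p.1} := by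
  have : {p : ℝ × X | p.2 ∈ alive φ E0 p.1} = {p : ℝ × X | p.2 ∈ E0} ∩
      {p : ℝ × X | (p.1 : EReal) < E0.indicator (tMinus φ E0) p.2} := by
    ext p
    by_cases h : p.2 ∈ E0 <;> simp [alive, h]
  rw [this]
  refine (measurable_snd hE.measurableSet).inter (measurableSet_lt ?_ ?_)
  · exact measurable_coe_real_ereal.comp measurable_fst
  · exact hE.measurable_indicator_tMinus.comp measurable_snd

theorem IsAdmissible.measurableSet_alive (hE : IsAdmissible φ E0) (t : ℝ) :
    MeasurableSet (alive φ E0 t) :=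
  (measurable_prodMk_left (x := t)) hE.measurableSet_alive_prod

theorem IsAdmissible.measurableSet_entrance (hE : IsAdmissible φ E0) :
    MeasurableSet (entrance φ E0) := by
  have hφ := measurable_flow_uncurry φ
  have : entrance φ E0 = {p : ℝ × X | 0 < p.1} ∩ ((fun p : ℝ × X => φ p.1 p.2) ⁻¹' E0 ∩
      {p : ℝ × X | E0.indicator (tMinus φ E0) (φ p.1 p.2) = (p.1 : EReal)}) := by
    ext p
    by_cases h : φ p.1 p.2 ∈ E0 <;> simp [entrance, h]
  rw [this]
  refine (measurableSet_lt measurable_const measurable_fst).inter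
    ((hφ hE.measurableSet).inter (measurableSet_eq_fun ?_ ?_))
  · exact hE.measurable_indicator_tMinus.comp hφ
  · exact measurable_coe_real_ereal.comp measurable_fst

theorem IsAdmissible.measurableSet_incoming (hE : IsAdmissible φ E0) :
    MeasurableSet (incoming φ E0) := by
  rw [incoming_eq_iUnion hE.staysIn]
  exact MeasurableSet.iUnion fun n => (measurable_prodMk_left) hE.measurableSet_entrance

end Measurability

/-! ### Change of variables along the flow, and null boundaries. -/

section ChangeOfVariables

variable {X : Type*} [TopologicalSpace X] [SecondCountableTopology X] [MeasurableSpace X]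
  [BorelSpace X] {φ : Flow ℝ X} {E0 : Set X} {J : ℝ → X → ℝ≥0} {m : Measure X}

theorem IsNonsingular.measurable_cocycle_apply (hm : IsNonsingular φ E0 J m) (t : ℝ) :
    Measurable (J t) :=
  hm.measurable_cocycle.comp measurable_prodMk_left

theorem IsNonsingular.map_eq (hm : IsNonsingular φ E0 J m) (t : ℝ) :
    m.map (φ t) = m.withDensity fun x => (J (-t) x : ℝ≥0∞) := by
  ext B hB
  rw [Measure.map_apply (measurable_flow φ t) hB, hm.density t B hB, withDensity_apply _ hB]

theorem IsNonsingular.lintegral_comp_flow (hm : IsNonsingular φ E0 J m) (t : ℝ) {g : X → ℝ≥0∞}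
    (hg : Measurable g) : ∫⁻ x, g (φ t x) ∂m = ∫⁻ x, g x * (J (-t) x : ℝ≥0∞) ∂m := by
  rw [← lintegral_map hg (measurable_flow φ t), hm.map_eq,
    lintegral_withDensity_eq_lintegral_mul _ (hm.measurable_cocycle_apply _).coe_nnreal_ennreal hg]
  simp [mul_comm]

theorem IsNonsingular.integral_comp_flow (hm : IsNonsingular φ E0 J m) (t : ℝ) {g : X → ℝ}
    (hg : Measurable g) : ∫ x, g (φ t x) ∂m = ∫ x, g x * (J (-t) x : ℝ) ∂m := by
  rw [← integral_map (measurable_flow φ t).aemeasurable hg.aestronglyMeasurable, hm.map_eq,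
    integral_withDensity_eq_integral_smul (hm.measurable_cocycle_apply _)]
  simp [NNReal.smul_def, mul_comm]

theorem IsNonsingular.quasiMeasurePreserving (hm : IsNonsingular φ E0 J m) (t : ℝ) :
    Measure.QuasiMeasurePreserving (φ t) m m :=
  ⟨measurable_flow φ t, by rw [hm.map_eq]; exact withDensity_absolutelyContinuous _ _⟩

theorem IsNonsingular.null_of_null_preimage (hm : IsNonsingular φ E0 J m) (t : ℝ) {N : Set X}
    (hN : m (φ t ⁻¹' N) = 0) : m N = 0 := by
  have := (hm.quasiMeasurePreserving (-t)).preimage_null hN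
  rwa [← preimage_comp, show φ t ∘ φ (-t) = id from funext (flow_flow_neg φ t)] at this

/-- Fubini on `ℝ × X`: each orbit meets the boundary on a Lebesgue-null set of times, so for some
`t` the preimage under `φ_t` is null, and quasi-invariance removes the `t`. -/
theorem IsNonsingular.incoming_null (hE : IsAdmissible φ E0) (hm : IsNonsingular φ E0 J m) :
    m (incoming φ E0) = 0 := by
  have := hm.sigmaFinite
  have hmeas : MeasurableSet {p : ℝ × X | φ p.1 p.2 ∉ incoming φ E0} :=
    measurable_flow_uncurry φ hE.measurableSet_incoming.compl
  have h1 : ∀ᵐ t : ℝ, ∀ᵐ x ∂m, φ t x ∉ incoming φ E0 := by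
    rw [Measure.ae_ae_comm hmeas]
    exact .of_forall fun x => measure_eq_zero_iff_ae_notMem.1
      ((countable_incoming_times x).measure_zero volume)
  obtain ⟨t, ht⟩ := h1.exists
  exact hm.null_of_null_preimage t (measure_eq_zero_iff_ae_notMem.2 ht)

theorem IsNonsingular.stateSpace_ae_eq (hE : IsAdmissible φ E0) (hm : IsNonsingular φ E0 J m) :
    stateSpace φ E0 =ᵐ[m] E0 := by
  refine EventuallyLE.antisymm ?_ (Eventually.of_forall subset_stateSpace)
  filter_upwards [measure_eq_zero_iff_ae_notMem.1 (hm.incoming_null hE)] with x hx h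
  exact (stateSpace_subset h).resolve_right hx

theorem IsNonsingular.restrict_stateSpace (hE : IsAdmissible φ E0)
    (hm : IsNonsingular φ E0 J m) : m.restrict (stateSpace φ E0) = m.restrict E0 :=
  Measure.restrict_congr_set (hm.stateSpace_ae_eq hE)

/-- The image of the density `f` under `φ_t`. -/
noncomputable def transport (φ : Flow ℝ X) (J : ℝ → X → ℝ≥0) (t : ℝ) (f : X → ℝ) (x : X) : ℝ :=
  f (φ (-t) x) * J (-t) x

theorem transport_zero (hm : IsNonsingular φ E0 J m) (f : X → ℝ) : transport φ J 0 f = f := by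
  ext x; simp [transport, hm.cocycle_zero]

theorem transport_add (hm : IsNonsingular φ E0 J m) (s t : ℝ) (f : X → ℝ) :
    transport φ J (s + t) f = transport φ J s (transport φ J t f) := by
  ext x
  have h : -(s + t) = -t + -s := by ring
  simp only [transport]
  rw [h, φ.map_add, hm.cocycle_add]
  push_cast
  ring

theorem transport_sub (t : ℝ) (f g : X → ℝ) :
    transport φ J t (f - g) = transport φ J t f - transport φ J t g := by
  ext x; simp [transport, sub_mul]

theorem measurable_transport_uncurry (hm : IsNonsingular φ E0 J m) {f : X → ℝ}
    (hf : Measurable f) : Measurable fun p : ℝ × X => transport φ J p.1 f p.2 := by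
  refine (hf.comp (measurable_flow_apply φ measurable_fst.neg measurable_snd)).mul ?_
  exact (hm.measurable_cocycle.comp (measurable_fst.neg.prodMk measurable_snd)).coe_nnreal_real

theorem measurable_transport (hm : IsNonsingular φ E0 J m) {f : X → ℝ}
    (hf : Measurable f) (t : ℝ) : Measurable (transport φ J t f) :=
  (measurable_transport_uncurry hm hf).comp measurable_prodMk_left

/-- The factor `J_{-t}` in the transport is precisely the density of the image of `m`; the change of
variables is applied to `g · |f ∘ φ_{-t}|`. -/
theorem lintegral_mul_enorm_transport (hm : IsNonsingular φ E0 J m) {f : X → ℝ}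
    (hf : Measurable f) {g : X → ℝ≥0∞} (hg : Measurable g) (t : ℝ) :
    ∫⁻ x, g x * ‖transport φ J t f x‖ₑ ∂m = ∫⁻ x, g (φ t x) * ‖f x‖ₑ ∂m := by
  have h := hm.lintegral_comp_flow t (g := fun x => g x * ‖f (φ (-t) x)‖ₑ)
    (hg.mul (hf.comp (measurable_flow φ _)).enorm)
  simp only [flow_neg_flow] at h
  rw [h]
  refine lintegral_congr fun x => ?_
  simp [transport, mul_assoc]

theorem lintegral_enorm_transport (hm : IsNonsingular φ E0 J m) {f : X → ℝ}
    (hf : Measurable f) (t : ℝ) :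
    ∫⁻ x, ‖transport φ J t f x‖ₑ ∂m = ∫⁻ x, ‖f x‖ₑ ∂m := by
  simpa using lintegral_mul_enorm_transport hm hf (measurable_const (a := (1 : ℝ≥0∞))) t

theorem integral_mul_transport (hm : IsNonsingular φ E0 J m) {f g : X → ℝ}
    (hf : Measurable f) (hg : Measurable g) (t : ℝ) :
    ∫ x, g x * transport φ J t f x ∂m = ∫ x, g (φ t x) * f x ∂m := by
  have h := hm.integral_comp_flow t (g := fun x => g x * f (φ (-t) x))
    (hg.mul (hf.comp (measurable_flow φ _)))
  simp only [flow_neg_flow] at h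
  rw [h]
  refine integral_congr_ae (.of_forall fun x => ?_)
  simp [transport, mul_assoc]

theorem integrable_transport (hm : IsNonsingular φ E0 J m) {f : X → ℝ}
    (hf : Measurable f) (hfi : Integrable f m) (t : ℝ) : Integrable (transport φ J t f) m :=
  ⟨(measurable_transport hm hf t).aestronglyMeasurable, by
    rw [HasFiniteIntegral, lintegral_enorm_transport hm hf]; exact hfi.2⟩

end ChangeOfVariables

/-! ### Strong continuity of the transport group. -/

section StrongContinuity

/-- Continuity of translations in `L¹(ℝ)`. -/
theorem tendsto_lintegral_enorm_translate_sub {G : ℝ → ℝ} (hG : Integrable G) :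
    Tendsto (fun h : ℝ => ∫⁻ s, ‖G (s + h) - G s‖ₑ) (𝓝 0) (𝓝 0) := by
  let τ : ℝ → C(ℝ, ℝ) := fun h => ⟨fun s => s + h, by fun_prop⟩
  have hτ : Continuous τ := by
    refine ContinuousMap.continuous_of_continuous_uncurry _ ?_
    exact continuous_snd.add continuous_fst
  have hmp : ∀ h, MeasurePreserving (τ h) (volume : Measure ℝ) volume :=
    fun h => measurePreserving_add_right volume h
  have hG1 : MemLp G 1 := memLp_one_iff_integrable.2 hG
  have hc : Continuous fun h : ℝ => Lp.compMeasurePreserving (τ h) (hmp h) (hG1.toLp G) :=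
    Continuous.compMeasurePreservingLp (p := 1) continuous_const hτ hmp ENNReal.one_ne_top
  have h0 := (hc.tendsto 0).edist (tendsto_const_nhds
    (x := Lp.compMeasurePreserving (τ 0) (hmp 0) (hG1.toLp G)))
  rw [edist_self] at h0
  refine h0.congr fun h => ?_
  rw [Lp.edist_def, eLpNorm_one_eq_lintegral_enorm]
  refine lintegral_congr_ae ?_
  have e1 : ∀ h, Lp.compMeasurePreserving (τ h) (hmp h) (hG1.toLp G)
      =ᵐ[volume] fun s => G (s + h) := fun h =>
    (Lp.coeFn_compMeasurePreserving _ (hmp h)).trans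
      ((hmp h).quasiMeasurePreserving.ae_eq_comp hG1.coeFn_toLp)
  filter_upwards [e1 h, e1 0] with s hs hs'
  rw [Pi.sub_apply, hs, hs', add_zero]

variable {X : Type*} [TopologicalSpace X] [SecondCountableTopology X] [MeasurableSpace X]
  [BorelSpace X] {φ : Flow ℝ X} {E0 : Set X} {J : ℝ → X → ℝ≥0} {m : Measure X}

/-- The group of transport operators is strongly continuous on `L¹(X, m)`. -/
theorem tendsto_lintegral_enorm_transport_sub (hm : IsNonsingular φ E0 J m) {f : X → ℝ}
    (hf : Measurable f) (hfi : Integrable f m) :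
    Tendsto (fun h : ℝ => ∫⁻ x, ‖transport φ J h f x - f x‖ₑ ∂m) (𝓝 0) (𝓝 0) := by
  have := hm.sigmaFinite
  let G : X → ℝ → ℝ := fun x => (Icc (-1 : ℝ) 2).indicator fun s => transport φ J s f x
  have hGm : Measurable fun p : X × ℝ => G p.1 p.2 := by
    have h1 : Measurable fun p : X × ℝ => transport φ J p.2 f p.1 :=
      (measurable_transport_uncurry hm hf).comp measurable_swap
    exact h1.indicator (measurable_snd measurableSet_Icc)
  have hGx : ∀ x, Measurable (G x) := fun x => hGm.comp measurable_prodMk_left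
  have hGfin : ∫⁻ x, (∫⁻ s, ‖G x s‖ₑ) ∂m < ∞ := by
    rw [lintegral_lintegral_swap hGm.enorm.aemeasurable]
    have h1 : ∀ s, ∫⁻ x, ‖G x s‖ₑ ∂m = (Icc (-1 : ℝ) 2).indicator (fun _ => ∫⁻ x, ‖f x‖ₑ ∂m) s := by
      intro s
      by_cases hs : s ∈ Icc (-1 : ℝ) 2
      · simp only [G, indicator_of_mem hs]
        exact lintegral_enorm_transport hm hf s
      · simp [G, indicator_of_notMem hs]
    simp only [h1]
    rw [lintegral_indicator measurableSet_Icc, setLIntegral_const]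
    exact ENNReal.mul_lt_top hfi.2 measure_Icc_lt_top
  have hbound_meas : Measurable fun x => ∫⁻ s, ‖G x s‖ₑ := hGm.enorm.lintegral_prod_right
  have hdiff : ∀ h : ℝ, Measurable fun p : X × ℝ => ‖G p.1 (p.2 + h) - G p.1 p.2‖ₑ := fun h =>
    ((hGm.comp (measurable_fst.prodMk (measurable_snd.add_const h))).sub hGm).enorm
  -- Translations are continuous for each profile; twice the `L¹` norm of the profile dominates.
  have key : Tendsto (fun h : ℝ => ∫⁻ x, (∫⁻ s, ‖G x (s + h) - G x s‖ₑ) ∂m) (𝓝 0) (𝓝 0) := by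
    have := tendsto_lintegral_filter_of_dominated_convergence (μ := m) (l := 𝓝 (0 : ℝ))
      (F := fun h x => ∫⁻ s, ‖G x (s + h) - G x s‖ₑ) (f := fun _ => 0)
      (fun x => (∫⁻ s, ‖G x s‖ₑ) + ∫⁻ s, ‖G x s‖ₑ)
      (.of_forall fun h => (hdiff h).lintegral_prod_right)
      (.of_forall fun h => .of_forall fun x => ?_) ?_ ?_
    · simpa using this
    · calc ∫⁻ s, ‖G x (s + h) - G x s‖ₑ ≤ ∫⁻ s, (‖G x (s + h)‖ₑ + ‖G x s‖ₑ) :=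
            lintegral_mono fun s => enorm_sub_le
        _ = _ := by
          rw [lintegral_add_right _ (hGx x).enorm,
            lintegral_add_right_eq_self (fun s => ‖G x s‖ₑ) h]
    · rw [lintegral_add_left hbound_meas]
      exact ENNReal.add_ne_top.2 ⟨hGfin.ne, hGfin.ne⟩
    · filter_upwards [ae_lt_top hbound_meas hGfin.ne] with x hx
      exact tendsto_lintegral_enorm_translate_sub ⟨(hGx x).aestronglyMeasurable, hx⟩
  refine tendsto_of_tendsto_of_tendsto_of_le_of_le' tendsto_const_nhds key
    (.of_forall fun _ => zero_le) ?_
  filter_upwards [Metric.ball_mem_nhds (0 : ℝ) one_pos] with h hh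
  rw [Metric.mem_ball, Real.dist_eq, sub_zero, abs_lt] at hh
  -- Isometry and the group law make `‖T_{s+h}f - T_s f‖` independent of `s`, so it equals its
  -- average over `[0, 1]`.
  have e : ∀ s ∈ Icc (0 : ℝ) 1, ∫⁻ x, ‖G x (s + h) - G x s‖ₑ ∂m =
      ∫⁻ x, ‖transport φ J h f x - f x‖ₑ ∂m := fun s hs => by
    refine Eq.trans ?_ (lintegral_enorm_transport hm ((measurable_transport hm hf h).sub hf) s)
    refine lintegral_congr fun x => ?_
    have m1 : s + h ∈ Icc (-1 : ℝ) 2 := ⟨by linarith [hs.1], by linarith [hs.2]⟩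
    have m2 : s ∈ Icc (-1 : ℝ) 2 := ⟨by linarith [hs.1], by linarith [hs.2]⟩
    simp only [G, indicator_of_mem m1, indicator_of_mem m2]
    rw [transport_sub, ← transport_add hm, Pi.sub_apply]
  calc ∫⁻ x, ‖transport φ J h f x - f x‖ₑ ∂m
      = ∫⁻ s in Icc (0 : ℝ) 1, ∫⁻ x, ‖transport φ J h f x - f x‖ₑ ∂m := by
        rw [setLIntegral_const]; simp
    _ = ∫⁻ s in Icc (0 : ℝ) 1, ∫⁻ x, ‖G x (s + h) - G x s‖ₑ ∂m :=
        (setLIntegral_congr_fun measurableSet_Icc e).symm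
    _ ≤ ∫⁻ s, ∫⁻ x, ‖G x (s + h) - G x s‖ₑ ∂m := setLIntegral_le_lintegral _ _
    _ = _ := (lintegral_lintegral_swap (hdiff h).aemeasurable).symm

end StrongContinuity

/-! ### Integration by parts for absolutely continuous functions. -/

section Calculus

theorem _root_.LipschitzOnWith.comp_absolutelyContinuousOnInterval {g f : ℝ → ℝ} {a b : ℝ}
    {K : ℝ≥0} {s : Set ℝ} (hg : LipschitzOnWith K g s)
    (hf : AbsolutelyContinuousOnInterval f a b) (hs : MapsTo f (uIcc a b) s) :
    AbsolutelyContinuousOnInterval (fun t => g (f t)) a b := by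
  rw [absolutelyContinuousOnInterval_iff] at hf ⊢
  intro ε hε
  -- `K + 1` instead of `K` avoids dividing by zero.
  obtain ⟨δ, hδ, h⟩ := hf (ε / (K + 1)) (by positivity)
  refine ⟨δ, hδ, fun E hE hlt => ?_⟩
  have hsum := h E hE hlt
  rw [lt_div_iff₀ (by positivity)] at hsum
  calc ∑ i ∈ Finset.range E.1, dist (g (f (E.2 i).1)) (g (f (E.2 i).2))
      ≤ ∑ i ∈ Finset.range E.1, (K + 1) * dist (f (E.2 i).1) (f (E.2 i).2) := by
        refine Finset.sum_le_sum fun i hi => ?_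
        have := hE.1 i hi
        refine (hg.dist_le_mul _ (hs this.1) _ (hs this.2)).trans ?_
        gcongr
        linarith
    _ < ε := by rw [← Finset.mul_sum, mul_comm]; exact hsum

/-- Integration by parts for the product of an exponential weight with an indefinite integral. -/
theorem integral_exp_neg_integral_mul {κ q : ℝ → ℝ} {T : ℝ}
    (hκ : IntervalIntegrable κ volume 0 T) (hq : IntervalIntegrable q volume 0 T) (c : ℝ) :
    ∫ t in (0 : ℝ)..T, Real.exp (-∫ r in (0 : ℝ)..t, κ r) *
        (κ t * (c + ∫ r in (0 : ℝ)..t, q r) - q t) =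
      c - Real.exp (-∫ r in (0 : ℝ)..T, κ r) * (c + ∫ r in (0 : ℝ)..T, q r) := by
  have hK := hκ.absolutelyContinuousOnInterval_intervalIntegral (c := 0) (by simp)
  have hQ := hq.absolutelyContinuousOnInterval_intervalIntegral (c := 0) (by simp)
  have hQ' : AbsolutelyContinuousOnInterval (fun t => c + ∫ r in (0 : ℝ)..t, q r) 0 T :=
    (AbsolutelyContinuousOnInterval.fun_add (f := fun _ => c)
      ((LipschitzWith.const c).lipschitzOnWith.absolutelyContinuousOnInterval) hQ)
  have hexp : AbsolutelyContinuousOnInterval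
      (fun t => Real.exp (-∫ r in (0 : ℝ)..t, κ r)) 0 T := by
    obtain ⟨C, hC⟩ := hK.exists_bound
    -- The exponential is Lipschitz on the bounded range of its argument, which preserves absolute
    -- continuity.
    obtain ⟨L, hL⟩ := (Real.contDiff_exp (n := 1)).contDiffOn.exists_lipschitzOnWith
      (by decide) (convex_Icc (-C) C) isCompact_Icc
    refine hL.comp_absolutelyContinuousOnInterval hK.fun_neg fun t ht => ?_
    have := abs_le.1 (hC t ht)
    exact ⟨by linarith [this.2], by linarith [this.1]⟩
  have h := hexp.integral_deriv_mul_eq_sub hQ'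
  -- The integrand is almost everywhere minus the derivative of the product of the two absolutely
  -- continuous factors.
  have h2 : ∫ t in (0 : ℝ)..T, Real.exp (-∫ r in (0 : ℝ)..t, κ r) *
        (κ t * (c + ∫ r in (0 : ℝ)..t, q r) - q t) =
      ∫ t in (0 : ℝ)..T, -(deriv (fun t => Real.exp (-∫ r in (0 : ℝ)..t, κ r)) t *
        (c + ∫ r in (0 : ℝ)..t, q r) + Real.exp (-∫ r in (0 : ℝ)..t, κ r) *
          deriv (fun t => c + ∫ r in (0 : ℝ)..t, q r) t) := by
    refine intervalIntegral.integral_congr_ae ?_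
    filter_upwards [hκ.ae_hasDerivAt_integral, hq.ae_hasDerivAt_integral] with t h1 h2 ht
    have ht' := uIoc_subset_uIcc ht
    have d1 := (h1 ht' 0 (by simp)).neg.exp
    have d2 := (h2 ht' 0 (by simp)).const_add c
    simp only [Pi.neg_apply] at d1
    rw [HasDerivAt.deriv d2]
    rw [HasDerivAt.deriv (f := fun t => Real.exp (-∫ r in (0 : ℝ)..t, κ r)) d1]
    ring
  rw [h2, intervalIntegral.integral_neg, h]
  simp

end Calculus

/-! ### Transport with killing by jumps and exits. -/

section Killed

variable {X : Type*} [TopologicalSpace X] [SecondCountableTopology X] [MeasurableSpace X]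
  [BorelSpace X] {φ : Flow ℝ X} {E0 : Set X} {J : ℝ → X → ℝ≥0} {m : Measure X} {ϑ : X → ℝ≥0}

/-- The jump rate accumulated along the backward orbit. -/
noncomputable def backRate (φ : Flow ℝ X) (ϑ : X → ℝ≥0) (t : ℝ) (x : X) : ℝ :=
  ∫ r in (0 : ℝ)..t, (ϑ (φ (-r) x) : ℝ)

/-- The probability that neither a jump nor an exit from `E0` occurs along the backward orbit. -/
noncomputable def survival (φ : Flow ℝ X) (E0 : Set X) (ϑ : X → ℝ≥0) (t : ℝ) (x : X) : ℝ :=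
  (alive φ E0 t).indicator (fun x => Real.exp (-backRate φ ϑ t x)) x

/-- Transport along the flow with jumps and exits from `E0` killed. -/
noncomputable def killed (φ : Flow ℝ X) (E0 : Set X) (J : ℝ → X → ℝ≥0) (ϑ : X → ℝ≥0) (t : ℝ)
    (f : X → ℝ) (x : X) : ℝ :=
  survival φ E0 ϑ t x * transport φ J t f x

theorem IsJumpRate.intervalIntegrable_back (hϑ : IsJumpRate φ E0 ϑ) (x : X) (a b : ℝ) :
    IntervalIntegrable (fun r => (ϑ (φ (-r) x) : ℝ)) volume a b := by
  simpa using (IntervalIntegrable.iff_comp_neg (by simp)).1 (hϑ.integrable_orbit x (-a) (-b))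

theorem backRate_nonneg {t : ℝ} (ht : 0 ≤ t) (x : X) : 0 ≤ backRate φ ϑ t x :=
  intervalIntegral.integral_nonneg ht fun _ _ => NNReal.coe_nonneg _

theorem backRate_add (hϑ : IsJumpRate φ E0 ϑ) (s t : ℝ) (x : X) :
    backRate φ ϑ (s + t) x = backRate φ ϑ s x + backRate φ ϑ t (φ (-s) x) := by
  unfold backRate
  rw [← intervalIntegral.integral_add_adjacent_intervals
    (hϑ.intervalIntegrable_back x 0 s) (hϑ.intervalIntegrable_back x s (s + t))]
  congr 1
  have := intervalIntegral.integral_comp_add_left (a := 0) (b := t)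
    (fun r => (ϑ (φ (-r) x) : ℝ)) s
  rw [add_zero] at this
  rw [← this]
  refine intervalIntegral.integral_congr fun r _ => ?_
  simp only [← φ.map_add, neg_add_rev]

theorem backRate_flow (t : ℝ) (x : X) :
    backRate φ ϑ t (φ t x) = ∫ r in (0 : ℝ)..t, (ϑ (φ r x) : ℝ) := by
  unfold backRate
  have := intervalIntegral.integral_comp_sub_left (a := 0) (b := t)
    (fun r => (ϑ (φ r x) : ℝ)) t
  simp only [sub_zero, sub_self] at this
  rw [← this]
  refine intervalIntegral.integral_congr fun r _ => ?_
  simp only [← φ.map_add, neg_add_eq_sub]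

/-- The variable endpoint is moved into an indicator on the product space, where parametric
integrals are measurable. -/
theorem measurable_integral_uncurry {F : ℝ × X → ℝ} (hF : Measurable F) :
    Measurable fun p : ℝ × X => ∫ r in (0 : ℝ)..p.1, F (r, p.2) := by
  have h : Measurable fun q : (ℝ × X) × ℝ => F (q.2, q.1.2) :=
    hF.comp (measurable_snd.prodMk measurable_fst.snd)
  have key : ∀ a b : ℝ × X → ℝ, Measurable a → Measurable b →
      Measurable fun p : ℝ × X => ∫ r in Ioc (a p) (b p), F (r, p.2) := by
    intro a b ha hb
    have hs : MeasurableSet {q : (ℝ × X) × ℝ | q.2 ∈ Ioc (a q.1) (b q.1)} :=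
      (measurableSet_lt (ha.comp measurable_fst) measurable_snd).inter
        (measurableSet_le measurable_snd (hb.comp measurable_fst))
    have := (h.indicator hs).stronglyMeasurable.integral_prod_right' (ν := volume)
    convert! this.measurable using 2 with p
    rw [← integral_indicator measurableSet_Ioc]
    rfl
  unfold intervalIntegral
  exact (key _ _ measurable_const measurable_fst).sub (key _ _ measurable_fst measurable_const)

theorem measurable_backRate_uncurry (hϑ : IsJumpRate φ E0 ϑ) :
    Measurable fun p : ℝ × X => backRate φ ϑ p.1 p.2 :=
  measurable_integral_uncurry (F := fun p : ℝ × X => (ϑ (φ (-p.1) p.2) : ℝ))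
    (hϑ.measurable.comp (measurable_flow_apply φ measurable_fst.neg measurable_snd)).coe_nnreal_real

theorem survival_nonneg (t : ℝ) (x : X) : 0 ≤ survival φ E0 ϑ t x :=
  indicator_nonneg (fun _ _ => (Real.exp_pos _).le) _

theorem survival_le_one {t : ℝ} (ht : 0 ≤ t) (x : X) : survival φ E0 ϑ t x ≤ 1 := by
  refine indicator_apply_le' (fun _ => ?_) fun _ => zero_le_one
  exact Real.exp_le_one_iff.2 (neg_nonpos.2 (backRate_nonneg ht x))

theorem survival_of_mem {t : ℝ} {x : X} (hx : x ∈ alive φ E0 t) :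
    survival φ E0 ϑ t x = Real.exp (-backRate φ ϑ t x) := indicator_of_mem hx _

theorem survival_of_notMem {t : ℝ} {x : X} (hx : x ∉ alive φ E0 t) :
    survival φ E0 ϑ t x = 0 := indicator_of_notMem hx _

theorem measurable_survival_uncurry (hE : IsAdmissible φ E0) (hϑ : IsJumpRate φ E0 ϑ) :
    Measurable fun p : ℝ × X => survival φ E0 ϑ p.1 p.2 := by
  have := (measurable_backRate_uncurry hϑ).neg.exp.indicator hE.measurableSet_alive_prod
  exact this

theorem measurable_survival (hE : IsAdmissible φ E0) (hϑ : IsJumpRate φ E0 ϑ) (t : ℝ) :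
    Measurable (survival φ E0 ϑ t) :=
  (measurable_survival_uncurry hE hϑ).comp measurable_prodMk_left

theorem survival_add (hE : IsAdmissible φ E0) (hϑ : IsJumpRate φ E0 ϑ) {s t : ℝ} (hs : 0 ≤ s)
    (ht : 0 ≤ t) (x : X) :
    survival φ E0 ϑ (s + t) x = survival φ E0 ϑ s x * survival φ E0 ϑ t (φ (-s) x) := by
  have h := hE.staysIn.mem_alive_add_iff (x := x) hs ht
  by_cases h1 : x ∈ alive φ E0 s
  · by_cases h2 : φ (-s) x ∈ alive φ E0 t
    · rw [survival_of_mem (h.2 ⟨h1, h2⟩), survival_of_mem h1, survival_of_mem h2,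
        backRate_add hϑ, neg_add, Real.exp_add]
    · rw [survival_of_notMem h2, survival_of_notMem fun hh => h2 (h.1 hh).2, mul_zero]
  · rw [survival_of_notMem h1, survival_of_notMem fun hh => h1 (h.1 hh).1, zero_mul]

theorem mem_alive_zero_iff (hE : IsAdmissible φ E0) {x : X} : x ∈ alive φ E0 0 ↔ x ∈ E0 :=
  ⟨fun h => h.1, fun h => ⟨h, by simpa using hE.staysIn.tMinus_pos h⟩⟩

open Classical in
theorem survival_flow (hE : IsAdmissible φ E0) {t : ℝ} (ht : 0 ≤ t) (x : X) :
    survival φ E0 ϑ t (φ t x) = if x ∈ E0 ∧ (t : EReal) < tPlus φ E0 x then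
      Real.exp (-∫ r in (0 : ℝ)..t, (ϑ (φ r x) : ℝ)) else 0 := by
  by_cases h : x ∈ E0 ∧ (t : EReal) < tPlus φ E0 x
  · rw [if_pos h, survival_of_mem ((hE.staysIn.flow_mem_alive_iff ht).2 h), backRate_flow]
  · rw [if_neg h, survival_of_notMem fun h' => h ((hE.staysIn.flow_mem_alive_iff ht).1 h')]

theorem survival_flow_of_notMem (hE : IsAdmissible φ E0) {t : ℝ} (ht : 0 ≤ t) {x : X}
    (hx : x ∉ E0) : survival φ E0 ϑ t (φ t x) = 0 := by
  rw [survival_flow hE ht, if_neg fun h => hx h.1]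

theorem survival_mul_indicator (hE : IsAdmissible φ E0) {t : ℝ} (ht : 0 ≤ t) (x : X)
    (f : X → ℝ) : survival φ E0 ϑ t x * E0.indicator f (φ (-t) x) =
      survival φ E0 ϑ t x * f (φ (-t) x) := by
  by_cases h : x ∈ alive φ E0 t
  · rw [indicator_of_mem (flow_neg_mem_of_mem_alive hE.staysIn ht h)]
  · simp [survival_of_notMem h]

/-- A point alive at time `t` has `φ_{-t}x ∈ E0`, so values of `f` off `E0` are never read. -/
theorem killed_indicator (hE : IsAdmissible φ E0) {t : ℝ} (ht : 0 ≤ t) (f : X → ℝ) :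
    killed φ E0 J ϑ t (E0.indicator f) = killed φ E0 J ϑ t f := by
  ext x
  simp only [killed, transport, ← mul_assoc, survival_mul_indicator hE ht]

theorem killed_zero (hE : IsAdmissible φ E0) (hm : IsNonsingular φ E0 J m) {x : X} (hx : x ∈ E0)
    (f : X → ℝ) : killed φ E0 J ϑ 0 f x = f x := by
  rw [killed, transport_zero hm, survival_of_mem ((mem_alive_zero_iff hE).2 hx)]
  simp [backRate]

theorem killed_add (hE : IsAdmissible φ E0) (hm : IsNonsingular φ E0 J m)
    (hϑ : IsJumpRate φ E0 ϑ) {s t : ℝ} (hs : 0 ≤ s) (ht : 0 ≤ t) (f : X → ℝ) :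
    killed φ E0 J ϑ (s + t) f = killed φ E0 J ϑ s (killed φ E0 J ϑ t f) := by
  ext x
  simp only [killed, survival_add hE hϑ hs ht, transport_add hm]
  simp only [transport, killed]
  ring

theorem measurable_killed_uncurry (hE : IsAdmissible φ E0) (hm : IsNonsingular φ E0 J m)
    (hϑ : IsJumpRate φ E0 ϑ) {f : X → ℝ} (hf : Measurable f) :
    Measurable fun p : ℝ × X => killed φ E0 J ϑ p.1 f p.2 :=
  (measurable_survival_uncurry hE hϑ).mul (measurable_transport_uncurry hm hf)

theorem measurable_killed (hE : IsAdmissible φ E0) (hm : IsNonsingular φ E0 J m)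
    (hϑ : IsJumpRate φ E0 ϑ) {f : X → ℝ} (hf : Measurable f) (t : ℝ) :
    Measurable (killed φ E0 J ϑ t f) :=
  (measurable_killed_uncurry hE hm hϑ hf).comp measurable_prodMk_left

/-- Together with quasi-invariance, the fact that only values on `E0` are read makes the operator
well defined on classes in `L¹(E, m)`. -/
theorem killed_congr (hE : IsAdmissible φ E0) (hm : IsNonsingular φ E0 J m) {t : ℝ}
    (ht : 0 ≤ t) {f g : X → ℝ} (h : f =ᵐ[m.restrict E0] g) :
    killed φ E0 J ϑ t f =ᵐ[m] killed φ E0 J ϑ t g := by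
  rw [EventuallyEq, ae_restrict_iff' hE.measurableSet] at h
  filter_upwards [(hm.quasiMeasurePreserving (-t)).ae h] with x hx
  by_cases hxa : x ∈ alive φ E0 t
  · simp only [killed, transport, hx (flow_neg_mem_of_mem_alive hE.staysIn ht hxa)]
  · simp [killed, survival_of_notMem hxa]

theorem lintegral_mul_enorm_killed (hE : IsAdmissible φ E0) (hm : IsNonsingular φ E0 J m)
    (hϑ : IsJumpRate φ E0 ϑ) {f : X → ℝ} (hf : Measurable f) {g : X → ℝ≥0∞}
    (hg : Measurable g) (t : ℝ) :
    ∫⁻ x, g x * ‖killed φ E0 J ϑ t f x‖ₑ ∂m =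
      ∫⁻ x, g (φ t x) * ENNReal.ofReal (survival φ E0 ϑ t (φ t x)) * ‖f x‖ₑ ∂m := by
  have := lintegral_mul_enorm_transport hm hf
    (hg.mul (measurable_survival hE hϑ t).ennreal_ofReal) t
  simp only [Pi.mul_apply] at this
  rw [← this]
  refine lintegral_congr fun x => ?_
  rw [killed, enorm_mul, Real.enorm_of_nonneg (survival_nonneg t x), mul_assoc]

/-- After the change of variables the weight is the survival factor at `φ_t x`, which is at most one
and vanishes when `x` starts outside `E0`. -/
theorem lintegral_enorm_killed_le (hE : IsAdmissible φ E0) (hm : IsNonsingular φ E0 J m)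
    (hϑ : IsJumpRate φ E0 ϑ) {f : X → ℝ} (hf : Measurable f) {t : ℝ} (ht : 0 ≤ t) :
    ∫⁻ x, ‖killed φ E0 J ϑ t f x‖ₑ ∂m ≤ ∫⁻ x in E0, ‖f x‖ₑ ∂m := by
  have := lintegral_mul_enorm_killed hE hm hϑ hf (measurable_const (a := (1 : ℝ≥0∞))) t
  simp only [one_mul] at this
  rw [this, ← lintegral_indicator hE.measurableSet]
  refine lintegral_mono fun x => ?_
  by_cases hx : x ∈ E0
  · rw [indicator_of_mem hx]
    exact mul_le_of_le_one_left' (ENNReal.ofReal_le_one.2 (survival_le_one ht _))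
  · simp [survival_flow_of_notMem hE ht hx]

theorem integrable_killed (hE : IsAdmissible φ E0) (hm : IsNonsingular φ E0 J m)
    (hϑ : IsJumpRate φ E0 ϑ) {f : X → ℝ} (hf : Measurable f) (hfi : IntegrableOn f E0 m) {t : ℝ}
    (ht : 0 ≤ t) : Integrable (killed φ E0 J ϑ t f) m :=
  ⟨(measurable_killed hE hm hϑ hf t).aestronglyMeasurable,
    (lintegral_enorm_killed_le hE hm hϑ hf ht).trans_lt hfi.2⟩

theorem tendsto_survival (hE : IsAdmissible φ E0) (hϑ : IsJumpRate φ E0 ϑ) {x : X}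
    (hx : x ∈ E0) : Tendsto (fun t => survival φ E0 ϑ t x) (𝓝[>] 0) (𝓝 1) := by
  have hc : Continuous fun t => Real.exp (-backRate φ ϑ t x) :=
    (intervalIntegral.continuous_primitive
      (fun a b => hϑ.intervalIntegrable_back x a b) 0).neg.rexp
  have h0 : Tendsto (fun t => Real.exp (-backRate φ ϑ t x)) (𝓝[>] 0) (𝓝 1) := by
    have := (hc.tendsto 0).mono_left (nhdsWithin_le_nhds (s := Ioi 0))
    simpa [backRate] using this
  refine h0.congr' ?_
  obtain ⟨q, hq0, hq⟩ := EReal.lt_iff_exists_real_btwn.1 (hE.staysIn.tMinus_pos hx)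
  have hq0' : (0 : ℝ) < q := by exact_mod_cast hq0
  filter_upwards [Ioo_mem_nhdsGT hq0'] with t ht
  refine (survival_of_mem ⟨hx, lt_trans ?_ hq⟩).symm
  exact_mod_cast ht.2

/-- Strong continuity of the killed transport at time zero. -/
theorem tendsto_lintegral_enorm_killed_sub (hE : IsAdmissible φ E0)
    (hm : IsNonsingular φ E0 J m) (hϑ : IsJumpRate φ E0 ϑ) {f : X → ℝ} (hf : Measurable f)
    (hfi : IntegrableOn f E0 m) :
    Tendsto (fun t => ∫⁻ x in E0, ‖killed φ E0 J ϑ t f x - f x‖ₑ ∂m) (𝓝[>] 0) (𝓝 0) := by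
  set f' := E0.indicator f
  have hf' : Measurable f' := hf.indicator hE.measurableSet
  have hfi' : Integrable f' m := (integrable_indicator_iff hE.measurableSet).2 hfi
  have h1 := (tendsto_lintegral_enorm_transport_sub hm hf' hfi').mono_left
    (nhdsWithin_le_nhds (s := Ioi 0))
  have h2 : Tendsto (fun t => ∫⁻ x in E0, ‖(survival φ E0 ϑ t x - 1) * f' x‖ₑ ∂m)
      (𝓝[>] 0) (𝓝 0) := by
    have := tendsto_lintegral_filter_of_dominated_convergence (μ := m.restrict E0)
      (l := 𝓝[>] (0 : ℝ)) (F := fun t x => ‖(survival φ E0 ϑ t x - 1) * f' x‖ₑ)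
      (f := fun _ => 0) (fun x => ‖f' x‖ₑ)
      (.of_forall fun t => (((measurable_survival hE hϑ t).sub_const 1).mul hf').enorm)
      ?_ (by exact (hfi'.mono_measure Measure.restrict_le_self).2.ne) ?_
    · simpa using this
    · filter_upwards [self_mem_nhdsWithin] with t ht
      refine .of_forall fun x => ?_
      rw [enorm_mul]
      refine mul_le_of_le_one_left' ?_
      rw [Real.enorm_eq_ofReal_abs, ENNReal.ofReal_le_one, abs_le]
      have a := survival_nonneg (φ := φ) (E0 := E0) (ϑ := ϑ) t x
      have b := survival_le_one (φ := φ) (E0 := E0) (ϑ := ϑ) (le_of_lt ht) x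
      constructor <;> linarith
    · refine (ae_restrict_iff' hE.measurableSet).2 (.of_forall fun x hx => ?_)
      have := (((tendsto_survival hE hϑ hx).sub_const 1).mul_const (f' x)).enorm
      simpa using this
  have h3 := h1.add h2
  rw [add_zero] at h3
  refine tendsto_of_tendsto_of_tendsto_of_le_of_le' tendsto_const_nhds h3
    (.of_forall fun _ => zero_le) ?_
  filter_upwards [self_mem_nhdsWithin] with t ht
  have ht' : (0 : ℝ) ≤ t := le_of_lt ht
  calc ∫⁻ x in E0, ‖killed φ E0 J ϑ t f x - f x‖ₑ ∂m
      ≤ ∫⁻ x in E0, (‖transport φ J t f' x - f' x‖ₑ + ‖(survival φ E0 ϑ t x - 1) * f' x‖ₑ) ∂m := by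
        refine setLIntegral_mono' hE.measurableSet fun x hx => ?_
        rw [← killed_indicator hE ht']
        -- The error splits into a transport error, damped by survival, and the loss of survival
        -- acting on a fixed function; the latter is handled by dominated convergence.
        have e : killed φ E0 J ϑ t f' x - f x = survival φ E0 ϑ t x *
            (transport φ J t f' x - f' x) + (survival φ E0 ϑ t x - 1) * f' x := by
          simp only [killed, f', indicator_of_mem hx]; ring
        rw [e]
        refine (enorm_add_le _ _).trans (add_le_add_left ?_ _)
        rw [enorm_mul, Real.enorm_of_nonneg (survival_nonneg t x)]
        exact mul_le_of_le_one_left' (ENNReal.ofReal_le_one.2 (survival_le_one ht' _))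
    _ = (∫⁻ x in E0, ‖transport φ J t f' x - f' x‖ₑ ∂m) +
          ∫⁻ x in E0, ‖(survival φ E0 ϑ t x - 1) * f' x‖ₑ ∂m :=
        lintegral_add_left ((measurable_transport hm hf' t).sub hf').enorm _
    _ ≤ _ := add_le_add_left (setLIntegral_le_lintegral _ _) _

end Killed

/-! ### The substochastic semigroup and its explicit formulas. -/

section Semigroup

variable {X : Type*} [TopologicalSpace X] [SecondCountableTopology X] [MeasurableSpace X]
  [BorelSpace X] {φ : Flow ℝ X} {E0 : Set X} {J : ℝ → X → ℝ≥0} {m : Measure X} {ϑ : X → ℝ≥0}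

theorem measurable_coe_L1E (f : L1E φ E0 m) : Measurable f :=
  (Lp.stronglyMeasurable f).measurable

theorem IsNonsingular.ae_stateSpace_iff (hE : IsAdmissible φ E0) (hm : IsNonsingular φ E0 J m)
    {p : X → Prop} :
    (∀ᵐ x ∂m.restrict (stateSpace φ E0), p x) ↔ ∀ᵐ x ∂m.restrict E0, p x := by
  rw [hm.restrict_stateSpace hE]

theorem IsNonsingular.lintegral_stateSpace (hE : IsAdmissible φ E0)
    (hm : IsNonsingular φ E0 J m) (g : X → ℝ≥0∞) :
    ∫⁻ x in stateSpace φ E0, g x ∂m = ∫⁻ x in E0, g x ∂m := by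
  rw [hm.restrict_stateSpace hE]

theorem IsNonsingular.integral_stateSpace (hE : IsAdmissible φ E0)
    (hm : IsNonsingular φ E0 J m) (g : X → ℝ) :
    ∫ x in stateSpace φ E0, g x ∂m = ∫ x in E0, g x ∂m := by
  rw [hm.restrict_stateSpace hE]

theorem IsNonsingular.integrable_stateSpace_iff (hE : IsAdmissible φ E0)
    (hm : IsNonsingular φ E0 J m) {g : X → ℝ} :
    Integrable g (m.restrict (stateSpace φ E0)) ↔ IntegrableOn g E0 m := by
  rw [IntegrableOn, hm.restrict_stateSpace hE]

theorem integrableOn_coe_L1E (hE : IsAdmissible φ E0) (hm : IsNonsingular φ E0 J m)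
    (f : L1E φ E0 m) : IntegrableOn f E0 m :=
  (hm.integrable_stateSpace_iff hE).1 (L1.integrable_coeFn f)

theorem enorm_L1E (hE : IsAdmissible φ E0) (hm : IsNonsingular φ E0 J m) (f : L1E φ E0 m) :
    ‖f‖ₑ = ∫⁻ x in E0, ‖f x‖ₑ ∂m := by
  rw [Lp.enorm_def, eLpNorm_one_eq_lintegral_enorm, hm.lintegral_stateSpace hE]

theorem memLp_killed (hE : IsAdmissible φ E0) (hm : IsNonsingular φ E0 J m)
    (hϑ : IsJumpRate φ E0 ϑ) (t : ℝ≥0) (f : L1E φ E0 m) :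
    MemLp (killed φ E0 J ϑ t f) 1 (m.restrict (stateSpace φ E0)) :=
  memLp_one_iff_integrable.2 ((integrable_killed hE hm hϑ (measurable_coe_L1E f)
    (integrableOn_coe_L1E hE hm f) t.coe_nonneg).mono_measure Measure.restrict_le_self)

theorem killed_congr_stateSpace (hE : IsAdmissible φ E0) (hm : IsNonsingular φ E0 J m)
    (t : ℝ≥0) {f g : X → ℝ} (h : f =ᵐ[m.restrict (stateSpace φ E0)] g) :
    killed φ E0 J ϑ t f =ᵐ[m.restrict (stateSpace φ E0)] killed φ E0 J ϑ t g := by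
  rw [hm.restrict_stateSpace hE] at h
  exact ae_restrict_of_ae (killed_congr hE hm t.coe_nonneg h)

/-- Killed transport as an operator on `L¹(E, m)`. -/
noncomputable def killedL1 (hE : IsAdmissible φ E0) (hm : IsNonsingular φ E0 J m)
    (hϑ : IsJumpRate φ E0 ϑ) (t : ℝ≥0) : L1E φ E0 m →ₗ[ℝ] L1E φ E0 m where
  toFun f := (memLp_killed hE hm hϑ t f).toLp
  map_add' f g := by
    rw [← MemLp.toLp_add]
    refine MemLp.toLp_congr _ _ ?_
    refine (killed_congr_stateSpace hE hm t (Lp.coeFn_add f g)).trans (.of_forall fun x => ?_)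
    simp [killed, transport]
    ring
  map_smul' c f := by
    rw [RingHom.id_apply, ← MemLp.toLp_const_smul]
    refine MemLp.toLp_congr _ _ ?_
    refine (killed_congr_stateSpace hE hm t (Lp.coeFn_smul c f)).trans (.of_forall fun x => ?_)
    simp [killed, transport]
    ring

theorem coeFn_killedL1 (hE : IsAdmissible φ E0) (hm : IsNonsingular φ E0 J m)
    (hϑ : IsJumpRate φ E0 ϑ) (t : ℝ≥0) (f : L1E φ E0 m) :
    killedL1 hE hm hϑ t f =ᵐ[m.restrict E0] killed φ E0 J ϑ t f :=
  (hm.ae_stateSpace_iff hE).1 (memLp_killed hE hm hϑ t f).coeFn_toLp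

theorem L1E_ext (hE : IsAdmissible φ E0) (hm : IsNonsingular φ E0 J m) {f g : L1E φ E0 m}
    (h : f =ᵐ[m.restrict E0] g) : f = g :=
  Lp.ext ((hm.ae_stateSpace_iff hE).2 h)

theorem coeFn_sub_L1E (hE : IsAdmissible φ E0) (hm : IsNonsingular φ E0 J m)
    (f g : L1E φ E0 m) : (f - g : L1E φ E0 m) =ᵐ[m.restrict E0] f - g :=
  (hm.ae_stateSpace_iff hE).1 (Lp.coeFn_sub f g)

theorem killedL1_zero (hE : IsAdmissible φ E0) (hm : IsNonsingular φ E0 J m)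
    (hϑ : IsJumpRate φ E0 ϑ) (f : L1E φ E0 m) : killedL1 hE hm hϑ 0 f = f := by
  refine L1E_ext hE hm ((coeFn_killedL1 hE hm hϑ 0 f).trans ?_)
  exact (ae_restrict_iff' hE.measurableSet).2 (.of_forall fun x hx => killed_zero hE hm hx f)

theorem killedL1_add (hE : IsAdmissible φ E0) (hm : IsNonsingular φ E0 J m)
    (hϑ : IsJumpRate φ E0 ϑ) (s t : ℝ≥0) (f : L1E φ E0 m) :
    killedL1 hE hm hϑ (s + t) f = killedL1 hE hm hϑ s (killedL1 hE hm hϑ t f) := by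
  refine L1E_ext hE hm ((coeFn_killedL1 hE hm hϑ _ f).trans ?_)
  refine EventuallyEq.trans ?_ (coeFn_killedL1 hE hm hϑ s _).symm
  rw [NNReal.coe_add, killed_add hE hm hϑ s.coe_nonneg t.coe_nonneg]
  exact ae_restrict_of_ae (killed_congr hE hm s.coe_nonneg (coeFn_killedL1 hE hm hϑ t f).symm)

theorem lintegral_enorm_congr_ae {α : Type*} [MeasurableSpace α] {μ : Measure α} {f g : α → ℝ}
    (h : f =ᵐ[μ] g) : ∫⁻ x, ‖f x‖ₑ ∂μ = ∫⁻ x, ‖g x‖ₑ ∂μ :=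
  lintegral_congr_ae (h.mono fun x hx => by simp only [hx])

theorem norm_killedL1_le (hE : IsAdmissible φ E0) (hm : IsNonsingular φ E0 J m)
    (hϑ : IsJumpRate φ E0 ϑ) (t : ℝ≥0) (f : L1E φ E0 m) : ‖killedL1 hE hm hϑ t f‖ ≤ ‖f‖ := by
  rw [← enorm_le_iff_norm_le, enorm_L1E hE hm, enorm_L1E hE hm,
    lintegral_enorm_congr_ae (coeFn_killedL1 hE hm hϑ t f)]
  exact (setLIntegral_le_lintegral _ _).trans
    (lintegral_enorm_killed_le hE hm hϑ (measurable_coe_L1E f) t.coe_nonneg)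

theorem killed_nonneg {f : X → ℝ} (t : ℝ) {x : X} (hf : 0 ≤ f (φ (-t) x)) :
    0 ≤ killed φ E0 J ϑ t f x :=
  mul_nonneg (survival_nonneg t x) (mul_nonneg hf (NNReal.coe_nonneg _))

theorem killedL1_nonneg (hE : IsAdmissible φ E0) (hm : IsNonsingular φ E0 J m)
    (hϑ : IsJumpRate φ E0 ϑ) (t : ℝ≥0) {f : L1E φ E0 m} (hf : 0 ≤ f) :
    0 ≤ killedL1 hE hm hϑ t f := by
  rw [← Lp.coeFn_nonneg] at hf ⊢
  have h1 : (f : X → ℝ) =ᵐ[m.restrict E0] fun x => |f x| := by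
    filter_upwards [(hm.ae_stateSpace_iff hE).1 hf] with x hx using (abs_of_nonneg hx).symm
  refine (hm.ae_stateSpace_iff hE).2 ?_
  filter_upwards [coeFn_killedL1 hE hm hϑ t f,
    ae_restrict_of_ae (s := E0) (killed_congr (ϑ := ϑ) hE hm t.coe_nonneg h1)] with x hx hx'
  rw [hx, hx']
  exact killed_nonneg _ (abs_nonneg _)

theorem tendsto_killedL1_zero (hE : IsAdmissible φ E0) (hm : IsNonsingular φ E0 J m)
    (hϑ : IsJumpRate φ E0 ϑ) (f : L1E φ E0 m) :
    Tendsto (fun t => killedL1 hE hm hϑ t f) (𝓝 0) (𝓝 f) := by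
  suffices h : Tendsto (fun t => killedL1 hE hm hϑ t f) (𝓝[>] 0) (𝓝 f) by
    have h' : ContinuousAt (fun t => killedL1 hE hm hϑ t f) 0 := by
      rw [continuousAt_iff_punctured_nhds, killedL1_zero,
        show ({0}ᶜ : Set ℝ≥0) = Ioi 0 by ext; simp [pos_iff_ne_zero]]
      exact h
    simpa only [killedL1_zero] using h'.tendsto
  rw [tendsto_iff_edist_tendsto_0]
  have hco : Tendsto ((↑) : ℝ≥0 → ℝ) (𝓝[>] 0) (𝓝[>] 0) := by
    refine tendsto_nhdsWithin_iff.2 ⟨?_, ?_⟩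
    · exact (NNReal.continuous_coe.tendsto' 0 0 rfl).mono_left nhdsWithin_le_nhds
    · filter_upwards [self_mem_nhdsWithin] with t ht
      exact NNReal.coe_pos.2 ht
  refine ((tendsto_lintegral_enorm_killed_sub hE hm hϑ (measurable_coe_L1E f)
    (integrableOn_coe_L1E hE hm f)).comp hco).congr fun t => ?_
  rw [edist_eq_enorm_sub, enorm_L1E hE hm]
  refine lintegral_congr_ae ?_
  filter_upwards [coeFn_sub_L1E hE hm (killedL1 hE hm hϑ t f) f, coeFn_killedL1 hE hm hϑ t f]
    with x h1 h2
  rw [h1, Pi.sub_apply, h2]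

/-- The semigroup law and contractivity reduce continuity at every time to continuity at zero. -/
theorem norm_killedL1_sub_le (hE : IsAdmissible φ E0) (hm : IsNonsingular φ E0 J m)
    (hϑ : IsJumpRate φ E0 ϑ) (f : L1E φ E0 m) {s t : ℝ≥0} (hst : s ≤ t) :
    ‖killedL1 hE hm hϑ t f - killedL1 hE hm hϑ s f‖ ≤ ‖killedL1 hE hm hϑ (t - s) f - f‖ := by
  have : killedL1 hE hm hϑ t f = killedL1 hE hm hϑ s (killedL1 hE hm hϑ (t - s) f) := by
    rw [← killedL1_add, add_tsub_cancel_of_le hst]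
  rw [this, ← map_sub]
  exact norm_killedL1_le hE hm hϑ s _

theorem continuous_killedL1 (hE : IsAdmissible φ E0) (hm : IsNonsingular φ E0 J m)
    (hϑ : IsJumpRate φ E0 ϑ) (f : L1E φ E0 m) :
    Continuous fun t => killedL1 hE hm hϑ t f := by
  rw [continuous_iff_continuousAt]
  intro s
  rw [ContinuousAt, tendsto_iff_norm_sub_tendsto_zero]
  -- With truncated subtraction, `(t - s) + (s - t)` is the distance from `s` to `t`.
  have hd : Tendsto (fun t : ℝ≥0 => (t - s) + (s - t)) (𝓝 s) (𝓝 0) := by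
    have : Continuous fun t : ℝ≥0 => (t - s) + (s - t) := by fun_prop
    exact this.tendsto' s 0 (by simp)
  have h0 := tendsto_iff_norm_sub_tendsto_zero.1 ((tendsto_killedL1_zero hE hm hϑ f).comp hd)
  refine squeeze_zero (fun _ => norm_nonneg _) (fun t => ?_) h0
  rcases le_total s t with h | h
  · simpa [tsub_eq_zero_of_le h] using norm_killedL1_sub_le hE hm hϑ f h
  · rw [norm_sub_rev]
    simpa [tsub_eq_zero_of_le h] using norm_killedL1_sub_le hE hm hϑ f h

theorem isSubstochasticSemigroup_killedL1 (hE : IsAdmissible φ E0)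
    (hm : IsNonsingular φ E0 J m) (hϑ : IsJumpRate φ E0 ϑ) :
    IsSubstochasticSemigroup (killedL1 hE hm hϑ) where
  substochastic t :=
    ⟨fun _ hf => killedL1_nonneg hE hm hϑ t hf, fun f _ => norm_killedL1_le hE hm hϑ t f⟩
  map_zero := LinearMap.ext fun f => killedL1_zero hE hm hϑ f
  map_add s t := LinearMap.ext fun f => killedL1_add hE hm hϑ s t f
  continuous f := continuous_killedL1 hE hm hϑ f

open Classical in
theorem killedL1_formula (hE : IsAdmissible φ E0) (hm : IsNonsingular φ E0 J m)
    (hϑ : IsJumpRate φ E0 ϑ) (t : ℝ≥0) (f : L1E φ E0 m) :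
    ∀ᵐ x ∂(m.restrict (stateSpace φ E0)),
      killedL1 hE hm hϑ t f x = if ((t : ℝ) : EReal) < tMinus φ E0 x then
        f (φ (-(t : ℝ)) x) * (J (-(t : ℝ)) x : ℝ) *
          Real.exp (-∫ r in (0 : ℝ)..t, (ϑ (φ (-r) x) : ℝ)) else 0 := by
  refine (hm.ae_stateSpace_iff hE).2 ?_
  filter_upwards [coeFn_killedL1 hE hm hϑ t f, ae_restrict_mem hE.measurableSet] with x hx hx0
  rw [hx, killed]
  split_ifs with h
  · rw [survival_of_mem ⟨hx0, h⟩, mul_comm]; rfl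
  · rw [survival_of_notMem fun h' => h h'.2, zero_mul]

-- For almost every `x` the point `φ_{-t}x` avoids the null incoming boundary, so lying in `E` means
-- lying in `E0`; the absence of returns then keeps the whole segment in `E0`.
open Classical in
theorem killedL1_formula_of_no_return (hE : IsAdmissible φ E0) (hm : IsNonsingular φ E0 J m)
    (hϑ : IsJumpRate φ E0 ϑ)
    (h : ∀ x ∈ E0, ∀ t : ℝ, 0 < t → φ (-t) x ∈ E0 → ∀ r ∈ Icc (0 : ℝ) t, φ (-r) x ∈ E0)
    {t : ℝ≥0} (ht : 0 < t) (f : L1E φ E0 m) :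
    ∀ᵐ x ∂(m.restrict (stateSpace φ E0)),
      killedL1 hE hm hϑ t f x = if φ (-(t : ℝ)) x ∈ stateSpace φ E0 then
        f (φ (-(t : ℝ)) x) * (J (-(t : ℝ)) x : ℝ) *
          Real.exp (-∫ r in (0 : ℝ)..t, (ϑ (φ (-r) x) : ℝ)) else 0 := by
  have hin : ∀ᵐ x ∂m, φ (-(t : ℝ)) x ∉ incoming φ E0 :=
    (hm.quasiMeasurePreserving _).ae (measure_eq_zero_iff_ae_notMem.1 (hm.incoming_null hE))
  filter_upwards [killedL1_formula hE hm hϑ t f, ae_restrict_of_ae hin,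
    (hm.ae_stateSpace_iff hE).2 (ae_restrict_mem hE.measurableSet)] with x hx hxi hx0
  rw [hx]
  have : ((t : ℝ) : EReal) < tMinus φ E0 x ↔ φ (-(t : ℝ)) x ∈ stateSpace φ E0 := by
    rw [hE.staysIn.lt_tMinus_iff hx0 t.coe_nonneg]
    exact ⟨fun hh => subset_stateSpace (hh t ⟨t.coe_nonneg, le_rfl⟩),
      fun hh => h x hx0 t ht ((stateSpace_subset hh).resolve_right hxi)⟩
  simp only [this]

-- Both integrands, written with `killed` and with survival at `φ_t x`, vanish off `E0`. They can
-- therefore be integrated over all of `X`, where the change of variables applies.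
open Classical in
theorem lintegral_mul_killedL1 (hE : IsAdmissible φ E0) (hm : IsNonsingular φ E0 J m)
    (hϑ : IsJumpRate φ E0 ϑ) (t : ℝ≥0) {f : L1E φ E0 m} (hf : 0 ≤ f) {ψ : X → ℝ≥0∞}
    (hψ : Measurable ψ) :
    ∫⁻ x in stateSpace φ E0, ψ x * ENNReal.ofReal (killedL1 hE hm hϑ t f x) ∂m =
      ∫⁻ x in stateSpace φ E0,
        (if ((t : ℝ) : EReal) < tPlus φ E0 x then
          ENNReal.ofReal (Real.exp (-∫ r in (0 : ℝ)..t, (ϑ (φ r x) : ℝ))) *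
            ψ (φ t x) * ENNReal.ofReal (f x) else 0) ∂m := by
  have hf' := (hm.ae_stateSpace_iff hE).1 ((Lp.coeFn_nonneg _).2 hf)
  have hS := (hm.ae_stateSpace_iff hE).1 ((Lp.coeFn_nonneg _).2 (killedL1_nonneg hE hm hϑ t hf))
  rw [hm.lintegral_stateSpace hE, hm.lintegral_stateSpace hE]
  have e1 : ∫⁻ x in E0, ψ x * ENNReal.ofReal (killedL1 hE hm hϑ t f x) ∂m =
      ∫⁻ x, ψ x * ‖killed φ E0 J ϑ t f x‖ₑ ∂m := by
    refine Eq.trans ?_ (setLIntegral_eq_of_support_subset (s := E0) ?_)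
    · refine lintegral_congr_ae ?_
      filter_upwards [coeFn_killedL1 hE hm hϑ t f, hS] with x hx hx'
      rw [← hx, Real.enorm_of_nonneg hx']
    · intro x hx
      by_contra h
      refine hx ?_
      simp [killed, survival_of_notMem fun h' : x ∈ alive φ E0 t => h h'.1]
  rw [e1, lintegral_mul_enorm_killed hE hm hϑ (measurable_coe_L1E f) hψ,
    ← setLIntegral_eq_of_support_subset (s := E0)]
  · refine lintegral_congr_ae ?_
    filter_upwards [hf', ae_restrict_mem hE.measurableSet] with x hx hx0
    rw [survival_flow hE t.coe_nonneg, Real.enorm_of_nonneg hx]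
    simp only [hx0, true_and]
    split_ifs
    · rw [mul_comm (ψ _)]
    · simp
  · intro x hx
    by_contra h
    refine hx ?_
    simp [survival_flow_of_notMem hE t.coe_nonneg h]

end Semigroup

/-! ### The resolvent at `1` and the generator. -/

section Resolvent

variable {X : Type*} [TopologicalSpace X] [SecondCountableTopology X] [MeasurableSpace X]
  [BorelSpace X] {φ : Flow ℝ X} {E0 : Set X} {J : ℝ → X → ℝ≥0} {m : Measure X} {ϑ : X → ℝ≥0}

/-- Killed transport, discounted at rate one. -/
noncomputable def discounted (φ : Flow ℝ X) (E0 : Set X) (J : ℝ → X → ℝ≥0) (ϑ : X → ℝ≥0)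
    (h : X → ℝ) (r : ℝ) (x : X) : ℝ :=
  Real.exp (-r) * killed φ E0 J ϑ r h x

/-- The resolvent at `1` of the killed transport semigroup, defined pointwise. -/
noncomputable def resolvent (φ : Flow ℝ X) (E0 : Set X) (J : ℝ → X → ℝ≥0) (ϑ : X → ℝ≥0)
    (h : X → ℝ) (x : X) : ℝ :=
  ∫ r in Ioi (0 : ℝ), discounted φ E0 J ϑ h r x

theorem measurable_discounted_uncurry (hE : IsAdmissible φ E0) (hm : IsNonsingular φ E0 J m)
    (hϑ : IsJumpRate φ E0 ϑ) {h : X → ℝ} (hh : Measurable h) :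
    Measurable fun p : ℝ × X => discounted φ E0 J ϑ h p.1 p.2 :=
  measurable_fst.neg.exp.mul (measurable_killed_uncurry hE hm hϑ hh)

theorem lintegral_exp_neg : ∫⁻ r in Ioi (0 : ℝ), ENNReal.ofReal (Real.exp (-r)) = 1 := by
  rw [← ofReal_integral_eq_lintegral_ofReal (integrableOn_exp_neg_Ioi 0)
    (.of_forall fun r => (Real.exp_pos _).le), integral_exp_neg_Ioi_zero, ENNReal.ofReal_one]

theorem integrable_discounted (hE : IsAdmissible φ E0) (hm : IsNonsingular φ E0 J m)
    (hϑ : IsJumpRate φ E0 ϑ) {h : X → ℝ} (hh : Measurable h) (hi : IntegrableOn h E0 m) :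
    Integrable (fun p : ℝ × X => discounted φ E0 J ϑ h p.1 p.2)
      ((volume.restrict (Ioi 0)).prod m) := by
  have := hm.sigmaFinite
  have hmeas := measurable_discounted_uncurry hE hm hϑ hh
  refine ⟨hmeas.aestronglyMeasurable, ?_⟩
  rw [HasFiniteIntegral, lintegral_prod _ hmeas.enorm.aemeasurable]
  calc ∫⁻ r in Ioi (0 : ℝ), ∫⁻ x, ‖discounted φ E0 J ϑ h r x‖ₑ ∂m
      ≤ ∫⁻ r in Ioi (0 : ℝ), ENNReal.ofReal (Real.exp (-r)) * ∫⁻ x in E0, ‖h x‖ₑ ∂m := by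
        refine setLIntegral_mono' measurableSet_Ioi fun r hr => ?_
        simp only [discounted, enorm_mul, Real.enorm_of_nonneg (Real.exp_pos _).le]
        rw [lintegral_const_mul _ (measurable_killed hE hm hϑ hh r).enorm]
        exact mul_le_mul' le_rfl (lintegral_enorm_killed_le hE hm hϑ hh (le_of_lt hr))
    _ = ∫⁻ x in E0, ‖h x‖ₑ ∂m := by
        rw [lintegral_mul_const _ (by fun_prop), lintegral_exp_neg, one_mul]
    _ < ∞ := hi.2

theorem ae_integrableOn_discounted (hE : IsAdmissible φ E0) (hm : IsNonsingular φ E0 J m)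
    (hϑ : IsJumpRate φ E0 ϑ) {h : X → ℝ} (hh : Measurable h) (hi : IntegrableOn h E0 m) :
    ∀ᵐ x ∂m, IntegrableOn (fun r => discounted φ E0 J ϑ h r x) (Ioi 0) := by
  have := hm.sigmaFinite
  exact (integrable_discounted hE hm hϑ hh hi).prod_left_ae

theorem integrable_resolvent (hE : IsAdmissible φ E0) (hm : IsNonsingular φ E0 J m)
    (hϑ : IsJumpRate φ E0 ϑ) {h : X → ℝ} (hh : Measurable h) (hi : IntegrableOn h E0 m) :
    Integrable (resolvent φ E0 J ϑ h) m := by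
  have := hm.sigmaFinite
  exact (integrable_discounted hE hm hϑ hh hi).integral_prod_right

/-- This is `S(t)R h = e^t ∫_t^∞ e^{-r}S(r)h dr`. It holds at every point with no integrability
assumption, since only constants are pulled through the integral and the variable is translated. -/
theorem killed_resolvent (hE : IsAdmissible φ E0) (hm : IsNonsingular φ E0 J m)
    (hϑ : IsJumpRate φ E0 ϑ) (h : X → ℝ) {t : ℝ} (ht : 0 ≤ t) (x : X) :
    killed φ E0 J ϑ t (resolvent φ E0 J ϑ h) x =
      Real.exp t * ∫ r in Ioi t, discounted φ E0 J ϑ h r x := by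
  have e1 : killed φ E0 J ϑ t (resolvent φ E0 J ϑ h) x =
      ∫ r in Ioi (0 : ℝ), Real.exp t * discounted φ E0 J ϑ h (t + r) x := by
    simp only [killed, transport, resolvent]
    rw [← integral_mul_const, ← integral_const_mul]
    refine setIntegral_congr_fun measurableSet_Ioi fun r hr => ?_
    simp only [discounted, killed_add hE hm hϑ ht (le_of_lt hr)]
    simp only [killed, transport, neg_add, Real.exp_add]
    have : Real.exp t * Real.exp (-t) = 1 := by rw [← Real.exp_add]; simp
    linear_combination (-(Real.exp (-r)) * survival φ E0 ϑ t x *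
      (survival φ E0 ϑ r (φ (-t) x) * (h (φ (-r) (φ (-t) x)) * (J (-r) (φ (-t) x))) *
        (J (-t) x))) * this
  rw [e1, integral_const_mul]
  congr 1
  have hmp := measurePreserving_add_left (volume : Measure ℝ) t
  rw [← hmp.setIntegral_preimage_emb (measurableEmbedding_addLeft t) _ (Ioi t)]
  simp

theorem tendsto_inv_mul_exp_sub_one :
    Tendsto (fun t : ℝ => t⁻¹ * (Real.exp t - 1) - 1) (𝓝[>] 0) (𝓝 0) := by
  have h := (Real.hasDerivAt_exp 0).tendsto_slope_zero.mono_left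
    (nhdsWithin_mono 0 (s := Ioi 0) (t := {0}ᶜ) fun _ ht => ne_of_gt ht)
  simpa using h.sub_const 1

/-- The supremum over `(0, t]` is what bounds the average over `r` in the difference quotient. -/
theorem tendsto_iSup_lintegral_killed_sub (hE : IsAdmissible φ E0) (hm : IsNonsingular φ E0 J m)
    (hϑ : IsJumpRate φ E0 ϑ) {h : X → ℝ} (hh : Measurable h) (hi : IntegrableOn h E0 m) :
    Tendsto (fun t : ℝ => ⨆ r ∈ Ioc 0 t, ∫⁻ x in E0, ‖killed φ E0 J ϑ r h x - h x‖ₑ ∂m)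
      (𝓝[>] 0) (𝓝 0) := by
  rw [ENNReal.tendsto_nhds_zero]
  intro ε hε
  have h1 := ENNReal.tendsto_nhds_zero.1
    (tendsto_lintegral_enorm_killed_sub hE hm hϑ hh hi) ε hε
  obtain ⟨δ, hδ, hd⟩ := mem_nhdsGT_iff_exists_Ioo_subset.1 h1
  filter_upwards [Ioo_mem_nhdsGT hδ] with t ht
  exact iSup₂_le fun r hr => hd ⟨hr.1, hr.2.trans_lt ht.2⟩

theorem lintegral_enorm_exp_mul_killed_sub_le (hE : IsAdmissible φ E0)
    (hm : IsNonsingular φ E0 J m) (hϑ : IsJumpRate φ E0 ϑ) {h : X → ℝ} (hh : Measurable h)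
    {r t : ℝ} (hr : r ∈ Ioc 0 t) :
    ∫⁻ x in E0, ‖Real.exp t * discounted φ E0 J ϑ h r x - h x‖ₑ ∂m ≤
      ENNReal.ofReal (Real.exp t) *
        (⨆ r ∈ Ioc 0 t, ∫⁻ x in E0, ‖killed φ E0 J ϑ r h x - h x‖ₑ ∂m) +
      ENNReal.ofReal (Real.exp t - 1) * ∫⁻ x in E0, ‖h x‖ₑ ∂m := by
  have hk : Measurable fun x => killed φ E0 J ϑ r h x - h x :=
    (measurable_killed hE hm hϑ hh r).sub hh
  have e1 : Real.exp (t - r) ≤ Real.exp t := Real.exp_le_exp.2 (by linarith [hr.1])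
  have e2 : 1 ≤ Real.exp (t - r) := Real.one_le_exp (by linarith [hr.2])
  calc ∫⁻ x in E0, ‖Real.exp t * discounted φ E0 J ϑ h r x - h x‖ₑ ∂m
      ≤ ∫⁻ x in E0, (ENNReal.ofReal (Real.exp t) * ‖killed φ E0 J ϑ r h x - h x‖ₑ +
          ENNReal.ofReal (Real.exp t - 1) * ‖h x‖ₑ) ∂m := by
        refine lintegral_mono fun x => ?_
        have : Real.exp t * discounted φ E0 J ϑ h r x - h x =
            Real.exp (t - r) * (killed φ E0 J ϑ r h x - h x) + (Real.exp (t - r) - 1) * h x := by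
          rw [discounted, ← mul_assoc, ← Real.exp_add, ← sub_eq_add_neg]; ring
        rw [this]
        refine (enorm_add_le _ _).trans (add_le_add ?_ ?_) <;> rw [enorm_mul]
        · rw [Real.enorm_of_nonneg (Real.exp_pos _).le]
          gcongr
        · rw [Real.enorm_of_nonneg (by linarith)]
          gcongr
    _ = ENNReal.ofReal (Real.exp t) * (∫⁻ x in E0, ‖killed φ E0 J ϑ r h x - h x‖ₑ ∂m) +
          ENNReal.ofReal (Real.exp t - 1) * ∫⁻ x in E0, ‖h x‖ₑ ∂m := by
        rw [lintegral_add_left (hk.enorm.const_mul _),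
          lintegral_const_mul _ hk.enorm, lintegral_const_mul _ hh.enorm]
    _ ≤ _ := by
        gcongr
        exact le_iSup₂ (f := fun r (_ : r ∈ Ioc 0 t) =>
          ∫⁻ x in E0, ‖killed φ E0 J ϑ r h x - h x‖ₑ ∂m) r hr

/-- With `h = f - g` and `f = R h`, the error of the difference quotient is `(t⁻¹(e^t - 1) - 1) f -
t⁻¹ ∫₀^t (e^{t-r}S(r)h - h) dr`; both terms tend to zero in `L¹`. -/
theorem graphGenerator_of_ae_eq_resolvent (hE : IsAdmissible φ E0)
    (hm : IsNonsingular φ E0 J m) (hϑ : IsJumpRate φ E0 ϑ) {f g : L1E φ E0 m}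
    (hf : f =ᵐ[m.restrict E0] resolvent φ E0 J ϑ (f - g : L1E φ E0 m)) :
    GraphGenerator (killedL1 hE hm hϑ) f g := by
  have := hm.sigmaFinite
  set h : L1E φ E0 m := f - g with hh
  have hmeas := measurable_coe_L1E h
  have hint := integrableOn_coe_L1E hE hm h
  set σ : ℝ → ℝ≥0∞ := fun t => ⨆ r ∈ Ioc 0 t, ∫⁻ x in E0, ‖killed φ E0 J ϑ r h x - h x‖ₑ ∂m
  set B : ℝ → ℝ≥0∞ := fun t => ‖t⁻¹ * (Real.exp t - 1) - 1‖ₑ * (∫⁻ x in E0, ‖f x‖ₑ ∂m) +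
    (ENNReal.ofReal (Real.exp t) * σ t + ENNReal.ofReal (Real.exp t - 1) *
      ∫⁻ x in E0, ‖h x‖ₑ ∂m) with hB
  have hB0 : Tendsto B (𝓝[>] 0) (𝓝 0) := by
    have c1 : Tendsto (fun t : ℝ => ‖t⁻¹ * (Real.exp t - 1) - 1‖ₑ) (𝓝[>] 0) (𝓝 0) := by
      simpa using tendsto_inv_mul_exp_sub_one.enorm
    have c2 : Tendsto (fun t : ℝ => ENNReal.ofReal (Real.exp t)) (𝓝[>] 0) (𝓝 1) := by
      have : Continuous fun t : ℝ => ENNReal.ofReal (Real.exp t) :=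
        ENNReal.continuous_ofReal.comp Real.continuous_exp
      exact (this.tendsto' 0 1 (by simp)).mono_left nhdsWithin_le_nhds
    have c3 : Tendsto (fun t : ℝ => ENNReal.ofReal (Real.exp t - 1)) (𝓝[>] 0) (𝓝 0) := by
      have : Continuous fun t : ℝ => ENNReal.ofReal (Real.exp t - 1) :=
        ENNReal.continuous_ofReal.comp (Real.continuous_exp.sub continuous_const)
      exact (this.tendsto' 0 0 (by simp)).mono_left nhdsWithin_le_nhds
    have d1 := ENNReal.Tendsto.mul_const c1
      (Or.inr (integrableOn_coe_L1E hE hm f).2.ne)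
    have d2 := ENNReal.Tendsto.mul c2 (Or.inl one_ne_zero)
      (tendsto_iSup_lintegral_killed_sub hE hm hϑ hmeas hint) (Or.inr ENNReal.one_ne_top)
    have d3 := ENNReal.Tendsto.mul_const c3 (Or.inr hint.2.ne)
    simpa only [zero_mul, mul_zero, add_zero] using d1.add (d2.add d3)
  have hbound : ∀ t : ℝ≥0, 0 < t →
      edist ((t : ℝ)⁻¹ • (killedL1 hE hm hϑ t f - f)) g ≤ B t := by
    intro t ht
    have ht' : (0 : ℝ) < t := NNReal.coe_pos.2 ht
    let G : ℝ → X → ℝ := fun r x => Real.exp t * discounted φ E0 J ϑ h r x - h x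
    have hG : Measurable fun p : X × ℝ => G p.2 p.1 :=
      (((measurable_discounted_uncurry hE hm hϑ hmeas).comp measurable_swap).const_mul _).sub
        (hmeas.comp measurable_fst)
    have key : ((t : ℝ)⁻¹ • (killedL1 hE hm hϑ t f - f) - g : L1E φ E0 m) =ᵐ[m.restrict E0]
        fun x => ((t : ℝ)⁻¹ * (Real.exp t - 1) - 1) * f x -
          (t : ℝ)⁻¹ * ∫ r in Ioc (0 : ℝ) t, G r x := by
      filter_upwards [coeFn_sub_L1E hE hm ((t : ℝ)⁻¹ • (killedL1 hE hm hϑ t f - f)) g,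
        (hm.ae_stateSpace_iff hE).1
          (Lp.coeFn_smul (t : ℝ)⁻¹ (killedL1 hE hm hϑ t f - f : L1E φ E0 m)),
        coeFn_sub_L1E hE hm (killedL1 hE hm hϑ t f) f, coeFn_killedL1 hE hm hϑ t f,
        ae_restrict_of_ae (s := E0) (killed_congr (ϑ := ϑ) hE hm t.coe_nonneg hf),
        ae_restrict_of_ae (s := E0) (ae_integrableOn_discounted hE hm hϑ hmeas hint), hf,
        coeFn_sub_L1E hE hm f g] with x x1 x2 x3 x4 x5 x6 x7 x8
      rw [x1, Pi.sub_apply, x2, Pi.smul_apply, x3, Pi.sub_apply, x4, x5,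
        killed_resolvent hE hm hϑ _ t.coe_nonneg]
      have i1 : IntegrableOn (fun r => discounted φ E0 J ϑ h r x) (Ioc 0 t) :=
        x6.mono_set Ioc_subset_Ioi_self
      have split : resolvent φ E0 J ϑ h x = (∫ r in Ioc (0 : ℝ) t, discounted φ E0 J ϑ h r x) +
          ∫ r in Ioi (t : ℝ), discounted φ E0 J ϑ h r x := by
        rw [resolvent, ← Ioc_union_Ioi_eq_Ioi t.coe_nonneg,
          setIntegral_union (Ioc_disjoint_Ioi le_rfl) measurableSet_Ioi i1
            (x6.mono_set (Ioi_subset_Ioi t.coe_nonneg))]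
      have eG : ∫ r in Ioc (0 : ℝ) t, G r x =
          Real.exp t * (∫ r in Ioc (0 : ℝ) t, discounted φ E0 J ϑ h r x) - t * h x := by
        rw [integral_sub (i1.const_mul _) (by simp), integral_const_mul]
        simp
      rw [eG]
      have x8' : h x = f x - g x := x8
      rw [x8', smul_eq_mul]
      have : ∫ r in Ioi (t : ℝ), discounted φ E0 J ϑ h r x =
          f x - ∫ r in Ioc (0 : ℝ) t, discounted φ E0 J ϑ h r x := by rw [x7]; linarith
      rw [this]
      field_simp
      ring
    rw [edist_eq_enorm_sub, enorm_L1E hE hm, lintegral_enorm_congr_ae key]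
    have hGint : ∫⁻ x in E0, ‖∫ r in Ioc (0 : ℝ) t, G r x‖ₑ ∂m ≤ ENNReal.ofReal t *
        (ENNReal.ofReal (Real.exp t) * σ t + ENNReal.ofReal (Real.exp t - 1) *
          ∫⁻ x in E0, ‖h x‖ₑ ∂m) := by
      calc _ ≤ ∫⁻ x in E0, (∫⁻ r in Ioc (0 : ℝ) t, ‖G r x‖ₑ) ∂m :=
            lintegral_mono fun x => enorm_integral_le_lintegral_enorm _
        _ = ∫⁻ r in Ioc (0 : ℝ) t, ∫⁻ x in E0, ‖G r x‖ₑ ∂m :=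
            lintegral_lintegral_swap hG.enorm.aemeasurable
        _ ≤ ∫⁻ r in Ioc (0 : ℝ) t, (ENNReal.ofReal (Real.exp t) * σ t +
              ENNReal.ofReal (Real.exp t - 1) * ∫⁻ x in E0, ‖h x‖ₑ ∂m) :=
            setLIntegral_mono' measurableSet_Ioc fun r hr =>
              lintegral_enorm_exp_mul_killed_sub_le hE hm hϑ hmeas hr
        _ = _ := by rw [setLIntegral_const, Real.volume_Ioc, sub_zero, mul_comm]
    calc _ ≤ ∫⁻ x in E0, (‖(t : ℝ)⁻¹ * (Real.exp t - 1) - 1‖ₑ * ‖f x‖ₑ +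
            ENNReal.ofReal (t : ℝ)⁻¹ * ‖∫ r in Ioc (0 : ℝ) t, G r x‖ₑ) ∂m := by
          refine lintegral_mono fun x => ?_
          refine enorm_sub_le.trans (le_of_eq ?_)
          rw [enorm_mul, enorm_mul, Real.enorm_of_nonneg (inv_nonneg.2 ht'.le)]
      _ = ‖(t : ℝ)⁻¹ * (Real.exp t - 1) - 1‖ₑ * (∫⁻ x in E0, ‖f x‖ₑ ∂m) +
            ENNReal.ofReal (t : ℝ)⁻¹ * ∫⁻ x in E0, ‖∫ r in Ioc (0 : ℝ) t, G r x‖ₑ ∂m := by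
          have hf' := (measurable_coe_L1E f).enorm
          rw [lintegral_add_left (hf'.const_mul _), lintegral_const_mul _ hf',
            lintegral_const_mul]
          exact hG.stronglyMeasurable.integral_prod_right'.measurable.enorm
      _ ≤ _ := by
          simp only [hB]
          gcongr
          refine (mul_le_mul_right hGint _).trans (le_of_eq ?_)
          rw [← mul_assoc, ← ENNReal.ofReal_mul (inv_nonneg.2 ht'.le),
            inv_mul_cancel₀ ht'.ne', ENNReal.ofReal_one, one_mul]
  rw [GraphGenerator, tendsto_iff_edist_tendsto_0]
  have hco : Tendsto ((↑) : ℝ≥0 → ℝ) (𝓝[>] 0) (𝓝[>] 0) := by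
    refine tendsto_nhdsWithin_iff.2 ⟨?_, ?_⟩
    · exact (NNReal.continuous_coe.tendsto' 0 0 rfl).mono_left nhdsWithin_le_nhds
    · filter_upwards [self_mem_nhdsWithin] with t ht
      exact NNReal.coe_pos.2 ht
  refine tendsto_of_tendsto_of_tendsto_of_le_of_le' tendsto_const_nhds (hB0.comp hco)
    (.of_forall fun _ => zero_le) ?_
  filter_upwards [self_mem_nhdsWithin] with t ht using hbound t ht

/-- The generator of a contraction semigroup does not have `1` as an eigenvalue. -/
theorem eq_zero_of_graphGenerator_self {α : Type*} [MeasurableSpace α] {μ : Measure α}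
    {S : ℝ≥0 → (Lp ℝ 1 μ →ₗ[ℝ] Lp ℝ 1 μ)} (hS : ∀ t f, ‖S t f‖ ≤ ‖f‖) {u : Lp ℝ 1 μ}
    (hu : GraphGenerator S u u) : u = 0 := by
  have h0 := tendsto_iff_norm_sub_tendsto_zero.1 hu
  have hle : ∀ᶠ t : ℝ≥0 in 𝓝[>] 0, ‖u‖ ≤ ‖(t : ℝ)⁻¹ • (S t u - u) - u‖ := by
    filter_upwards [self_mem_nhdsWithin] with t ht
    have ht' : (0 : ℝ) < t := NNReal.coe_pos.2 ht
    -- Moving the error to the other side leaves `(1 + t)‖u‖ ≤ ‖u‖ + t · error`, so `‖u‖` is bounded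
    -- by an error that tends to zero.
    have e : (1 + (t : ℝ)) • u = S t u - (t : ℝ) • ((t : ℝ)⁻¹ • (S t u - u) - u) := by
      rw [smul_sub, smul_smul, mul_inv_cancel₀ ht'.ne', one_smul, add_smul, one_smul]
      abel
    have h1 : (1 + (t : ℝ)) * ‖u‖ ≤ ‖u‖ + t * ‖(t : ℝ)⁻¹ • (S t u - u) - u‖ := by
      calc (1 + (t : ℝ)) * ‖u‖ = ‖(1 + (t : ℝ)) • u‖ := by
            rw [norm_smul, Real.norm_of_nonneg (by positivity)]
        _ ≤ ‖S t u‖ + ‖(t : ℝ) • ((t : ℝ)⁻¹ • (S t u - u) - u)‖ := by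
            rw [e]; exact norm_sub_le _ _
        _ ≤ _ := by
            rw [norm_smul, Real.norm_of_nonneg ht'.le]
            gcongr
            exact hS t u
    have h2 : (t : ℝ) * ‖u‖ ≤ t * ‖(t : ℝ)⁻¹ • (S t u - u) - u‖ := by linarith
    exact le_of_mul_le_mul_left h2 ht'
  have : (𝓝[>] (0 : ℝ≥0)).NeBot := inferInstance
  exact norm_le_zero_iff.1 (ge_of_tendsto h0 hle)

/-- `R h` lies in the domain with image `R h - h`, and `f` has image `f - h`. Their difference is an
eigenvector for `1`, hence zero. -/
theorem graphGenerator_iff_ae_eq_resolvent (hE : IsAdmissible φ E0)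
    (hm : IsNonsingular φ E0 J m) (hϑ : IsJumpRate φ E0 ϑ) {f g : L1E φ E0 m} :
    GraphGenerator (killedL1 hE hm hϑ) f g ↔
      f =ᵐ[m.restrict E0] resolvent φ E0 J ϑ (f - g : L1E φ E0 m) := by
  refine ⟨fun hfg => ?_, graphGenerator_of_ae_eq_resolvent hE hm hϑ⟩
  set h : L1E φ E0 m := f - g with hh
  have hR : MemLp (resolvent φ E0 J ϑ h) 1 (m.restrict (stateSpace φ E0)) :=
    memLp_one_iff_integrable.2 ((integrable_resolvent hE hm hϑ (measurable_coe_L1E h)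
      (integrableOn_coe_L1E hE hm h)).mono_measure Measure.restrict_le_self)
  have h1 : hR.toLp =ᵐ[m.restrict E0] resolvent φ E0 J ϑ h :=
    (hm.ae_stateSpace_iff hE).1 hR.coeFn_toLp
  have h2 : GraphGenerator (killedL1 hE hm hϑ) hR.toLp (hR.toLp - h) :=
    graphGenerator_of_ae_eq_resolvent hE hm hϑ (by rw [sub_sub_cancel]; exact h1)
  have h3 : GraphGenerator (killedL1 hE hm hϑ) (f - hR.toLp) (f - hR.toLp) := by
    have := hfg.sub h2
    have e : g - (hR.toLp - h) = f - hR.toLp := by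
      have e' : g + h = f := add_sub_cancel g f
      rw [← sub_add, sub_add_eq_add_sub, e']
    rw [e] at this
    refine this.congr fun t => ?_
    rw [map_sub, ← smul_sub]
    congr 1
    abel
  have h4 := eq_zero_of_graphGenerator_self (norm_killedL1_le hE hm hϑ) h3
  rw [sub_eq_zero.1 h4]
  exact h1

end Resolvent

/-! ### Disintegration of `m` over the incoming boundary. -/

section Disintegration

variable {X : Type*} [TopologicalSpace X] [SecondCountableTopology X] [MeasurableSpace X]
  [BorelSpace X] {φ : Flow ℝ X} {E0 : Set X} {J : ℝ → X → ℝ≥0} {m mp mn : Measure X}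

/-- The points of `E0` that the flow brought in through the incoming boundary. -/
def entered (φ : Flow ℝ X) (E0 : Set X) : Set X := {x | x ∈ E0 ∧ tMinus φ E0 x < ⊤}

theorem IsAdmissible.measurableSet_entered (hE : IsAdmissible φ E0) :
    MeasurableSet (entered φ E0) := by
  have : entered φ E0 = E0 ∩ {x | E0.indicator (tMinus φ E0) x < ⊤} := by
    ext x
    by_cases h : x ∈ E0 <;> simp [entered, h]
  rw [this]
  exact hE.measurableSet.inter (measurableSet_lt hE.measurable_indicator_tMinus measurable_const)

theorem IsAdmissible.aemeasurable_wMinus (hE : IsAdmissible φ E0) :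
    AEMeasurable (wMinus φ E0) (m.restrict (entered φ E0)) := by
  have hT : Measurable fun x => (E0.indicator (tMinus φ E0) x).toReal :=
    hE.measurable_indicator_tMinus.ereal_toReal
  refine ⟨fun x => ((E0.indicator (tMinus φ E0) x).toReal,
    φ (-(E0.indicator (tMinus φ E0) x).toReal) x),
    hT.prodMk (measurable_flow_apply φ hT.neg measurable_id), ?_⟩
  filter_upwards [ae_restrict_mem hE.measurableSet_entered] with x hx
  simp only [wMinus, indicator_of_mem hx.1]

/-- The hypothesis on `m⁻` as an identity of measures. Restricting to `entrance` keeps everything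
Borel and loses nothing, since `w₋` maps `entered` into it. -/
theorem map_wMinus_eq (hE : IsAdmissible φ E0) (hm : IsNonsingular φ E0 J m)
    (hb : IsBoundaryPair φ E0 J m mp mn) :
    (m.restrict (entered φ E0)).map (wMinus φ E0) =
      ((volume.prod mn).withDensity fun p => (J p.1 p.2 : ℝ≥0∞)).restrict (entrance φ E0) := by
  have := hb.finite_minus
  have hJ : Measurable fun p : ℝ × X => (J p.1 p.2 : ℝ≥0∞) :=
    hm.measurable_cocycle.coe_nnreal_ennreal
  ext B hB
  have hBe := hB.inter hE.measurableSet_entrance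
  rw [Measure.map_apply_of_aemeasurable hE.aemeasurable_wMinus hB, Measure.restrict_apply hB,
    withDensity_apply _ hBe, ← lintegral_indicator hBe,
    lintegral_prod_symm _ (hJ.indicator hBe).aemeasurable,
    Measure.restrict_apply' hE.measurableSet_entered]
  refine Eq.trans (measure_congr ?_) (hb.image_minus (B ∩ entrance φ E0) hBe
    (inter_subset_right.trans hE.staysIn.entrance_subset))
  filter_upwards [measure_eq_zero_iff_ae_notMem.1 (hm.incoming_null hE)] with x hx
  refine propext ⟨fun h => ?_, fun h => ?_⟩
  · exact ⟨⟨subset_stateSpace h.2.1, hE.staysIn.tMinus_pos h.2.1, h.2.2⟩, h.1,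
      hE.staysIn.wMinus_mem_entrance h.2.1 h.2.2⟩
  · exact ⟨h.2.1, (stateSpace_subset h.1.1).resolve_right hx, h.1.2.2⟩

theorem lintegral_comp_wMinus (hE : IsAdmissible φ E0) (hm : IsNonsingular φ E0 J m)
    (hb : IsBoundaryPair φ E0 J m mp mn) {F : ℝ × X → ℝ≥0∞} (hF : Measurable F) :
    ∫⁻ x in entered φ E0, F (wMinus φ E0 x) ∂m =
      ∫⁻ z, (∫⁻ s : ℝ, (entrance φ E0).indicator
        (fun p => (J p.1 p.2 : ℝ≥0∞) * F p) (s, z)) ∂mn := by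
  have := hb.finite_minus
  have hJ : Measurable fun p : ℝ × X => (J p.1 p.2 : ℝ≥0∞) :=
    hm.measurable_cocycle.coe_nnreal_ennreal
  rw [← lintegral_map' hF.aemeasurable hE.aemeasurable_wMinus, map_wMinus_eq hE hm hb,
    restrict_withDensity hE.measurableSet_entrance, lintegral_withDensity_eq_lintegral_mul _ hJ hF,
    ← lintegral_indicator hE.measurableSet_entrance,
    lintegral_prod_symm _ ((hJ.mul hF).indicator hE.measurableSet_entrance).aemeasurable]
  rfl

/-- A property that holds almost everywhere on the incoming boundary holds at the entrance point
of almost every point that was brought in by the flow. -/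
theorem ae_entrance_point (hE : IsAdmissible φ E0) (hm : IsNonsingular φ E0 J m)
    (hb : IsBoundaryPair φ E0 J m mp mn) {p : X → Prop} (hp : ∀ᵐ z ∂mn, p z) :
    ∀ᵐ x ∂m.restrict (entered φ E0), p (wMinus φ E0 x).2 := by
  obtain ⟨N, hN, hNm, hN0⟩ := exists_measurable_superset_of_null (ae_iff.1 hp)
  have hF : Measurable fun q : ℝ × X => N.indicator (1 : X → ℝ≥0∞) q.2 :=
    (measurable_one.indicator hNm).comp measurable_snd
  have h0 : ∫⁻ x in entered φ E0, N.indicator (1 : X → ℝ≥0∞) (wMinus φ E0 x).2 ∂m = 0 := by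
    rw [lintegral_comp_wMinus hE hm hb hF]
    refine (lintegral_congr_ae ?_).trans lintegral_zero
    filter_upwards [measure_eq_zero_iff_ae_notMem.1 hN0] with z hz
    have hz' : z ∉ N := hz
    refine (lintegral_congr fun s => ?_).trans lintegral_zero
    by_cases hs : (s, z) ∈ entrance φ E0 <;> simp [hs, hz']
  have h1 := (lintegral_eq_zero_iff' (hF.comp_aemeasurable hE.aemeasurable_wMinus)).1 h0
  filter_upwards [h1] with x hx
  by_contra h
  have : (wMinus φ E0 x).2 ∈ N := hN h
  simp [this] at hx

/-- Integrated over `m⁻`, this quantity is the integral of `|h|` over the points that entered, which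
is finite. -/
theorem ae_lintegral_entrance_lt_top (hE : IsAdmissible φ E0) (hm : IsNonsingular φ E0 J m)
    (hb : IsBoundaryPair φ E0 J m mp mn) {h : X → ℝ} (hh : Measurable h)
    (hi : IntegrableOn h E0 m) :
    ∀ᵐ z ∂mn, ∫⁻ s : ℝ, (entrance φ E0).indicator
      (fun p => (J p.1 p.2 : ℝ≥0∞) * ‖h (φ p.1 p.2)‖ₑ) (s, z) < ∞ := by
  have hJ : Measurable fun p : ℝ × X => (J p.1 p.2 : ℝ≥0∞) :=
    hm.measurable_cocycle.coe_nnreal_ennreal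
  have hF : Measurable fun p : ℝ × X => ‖h (φ p.1 p.2)‖ₑ :=
    (hh.comp (measurable_flow_uncurry φ)).enorm
  refine ae_lt_top ?_ ?_
  · exact (((hJ.mul hF).indicator hE.measurableSet_entrance).comp
      measurable_swap).lintegral_prod_right'
  · rw [← lintegral_comp_wMinus hE hm hb hF]
    refine ne_of_lt (lt_of_le_of_lt ?_ hi.2)
    refine (lintegral_mono fun x => ?_).trans (lintegral_mono_set fun x hx => hx.1)
    simp only [wMinus, flow_flow_neg, le_refl]

end Disintegration

/-! ### The resolvent has zero incoming trace. -/

section Trace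

variable {X : Type*} [TopologicalSpace X] [SecondCountableTopology X] [MeasurableSpace X]
  [BorelSpace X] {φ : Flow ℝ X} {E0 : Set X} {J : ℝ → X → ℝ≥0} {m mp mn : Measure X}
  {ϑ : X → ℝ≥0}

/-- The cocycle gives `J_{-r}(φ_s z) J_s(z) = J_{s-r}(z)`, and killing removes `r ≥ s` because the
orbit entered at time `s` in the past. -/
theorem enorm_discounted_mul_le (hm : IsNonsingular φ E0 J m)
    (h : X → ℝ) {r s : ℝ} {z : X} (hr : 0 < r) (hs : (s, z) ∈ entrance φ E0) :
    ‖discounted φ E0 J ϑ h r (φ s z) * (J s z : ℝ)‖ₑ ≤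
      (Iio s).indicator (fun r => (J (s - r) z : ℝ≥0∞) * ‖h (φ (s - r) z)‖ₑ) r := by
  by_cases hmem : φ s z ∈ alive φ E0 r
  · have hrs : r < s := by
      have := hmem.2
      rw [hs.2.2] at this
      exact_mod_cast this
    rw [indicator_of_mem (show r ∈ Iio s from hrs)]
    have e : discounted φ E0 J ϑ h r (φ s z) * (J s z : ℝ) =
        (Real.exp (-r) * survival φ E0 ϑ r (φ s z)) * ((J (s - r) z : ℝ) * h (φ (s - r) z)) := by
      simp only [discounted, killed, transport]
      rw [← φ.map_add, show s - r = -r + s by ring, hm.cocycle_add]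
      push_cast
      ring
    have hle : ‖Real.exp (-r) * survival φ E0 ϑ r (φ s z)‖ₑ ≤ 1 := by
      rw [Real.enorm_of_nonneg (mul_nonneg (Real.exp_pos _).le (survival_nonneg _ _)),
        ENNReal.ofReal_le_one]
      exact mul_le_one₀ (Real.exp_le_one_iff.2 (by linarith)) (survival_nonneg _ _)
        (survival_le_one hr.le _)
    rw [e, enorm_mul, enorm_mul (J (s - r) z : ℝ)]
    refine (mul_le_of_le_one_left' hle).trans (le_of_eq ?_)
    simp
  · simp [discounted, killed, survival_of_notMem hmem]

/-- The expression is bounded by the integral of `J_q(z)|h(φ_q z)|` over `0 < q < s`, which shrinks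
to zero by absolute continuity of the integral. -/
theorem tendsto_resolvent_entrance (hE : IsAdmissible φ E0) (hm : IsNonsingular φ E0 J m)
    (h : X → ℝ) {z : X} (hz : z ∈ incoming φ E0)
    (hfin : ∫⁻ s : ℝ, (entrance φ E0).indicator
      (fun p => (J p.1 p.2 : ℝ≥0∞) * ‖h (φ p.1 p.2)‖ₑ) (s, z) < ∞) :
    Tendsto (fun s : ℝ => resolvent φ E0 J ϑ h (φ s z) * (J s z : ℝ)) (𝓝[>] 0) (𝓝 0) := by
  obtain ⟨δ, hδ, hent⟩ := hE.staysIn.exists_entrance hz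
  set G : ℝ → ℝ≥0∞ := fun s => (entrance φ E0).indicator
      (fun p => (J p.1 p.2 : ℝ≥0∞) * ‖h (φ p.1 p.2)‖ₑ) (s, z)
  have hvol : Tendsto (fun s : ℝ => volume (Ioo 0 s)) (𝓝[>] 0) (𝓝 0) := by
    simp only [Real.volume_Ioo, sub_zero]
    exact (ENNReal.continuous_ofReal.tendsto' 0 0 (by simp)).mono_left nhdsWithin_le_nhds
  have hG := tendsto_setLIntegral_zero hfin.ne hvol
  rw [tendsto_zero_iff_enorm_tendsto_zero]
  refine tendsto_of_tendsto_of_tendsto_of_le_of_le' tendsto_const_nhds hG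
    (.of_forall fun _ => zero_le) ?_
  filter_upwards [Ioc_mem_nhdsGT hδ] with s hs
  calc ‖resolvent φ E0 J ϑ h (φ s z) * (J s z : ℝ)‖ₑ
      = ‖∫ r in Ioi (0 : ℝ), discounted φ E0 J ϑ h r (φ s z) * (J s z : ℝ)‖ₑ := by
        rw [resolvent, integral_mul_const]
    _ ≤ ∫⁻ r in Ioi (0 : ℝ), ‖discounted φ E0 J ϑ h r (φ s z) * (J s z : ℝ)‖ₑ :=
        enorm_integral_le_lintegral_enorm _
    _ ≤ ∫⁻ r in Ioi (0 : ℝ),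
          (Iio s).indicator (fun r => (J (s - r) z : ℝ≥0∞) * ‖h (φ (s - r) z)‖ₑ) r :=
        setLIntegral_mono' measurableSet_Ioi fun r hr =>
          enorm_discounted_mul_le hm h hr (hent s hs)
    -- For `s ≤ δ` the whole initial segment lies in `entrance`, so its indicator can be inserted
    -- before reflecting `r ↦ s - r`.
    _ = ∫⁻ r, (Ioo 0 s).indicator G (s - r) := by
        rw [← lintegral_indicator measurableSet_Ioi]
        refine lintegral_congr fun r => ?_
        by_cases h1 : 0 < r <;> by_cases h2 : r < s
        · have h3 : s - r ∈ Ioo 0 s := ⟨by linarith, by linarith⟩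
          have h4 : (s - r, z) ∈ entrance φ E0 := hent _ ⟨h3.1, h3.2.le.trans hs.2⟩
          rw [indicator_of_mem (show r ∈ Ioi 0 from h1), indicator_of_mem (show r ∈ Iio s from h2),
            indicator_of_mem h3]
          simp only [G, indicator_of_mem h4]
        · rw [indicator_of_mem (show r ∈ Ioi 0 from h1),
            indicator_of_notMem (show r ∉ Iio s from h2),
            indicator_of_notMem fun h3 : s - r ∈ Ioo 0 s => h2 (by linarith [h3.1])]
        all_goals
          rw [indicator_of_notMem (show r ∉ Ioi 0 from h1),
            indicator_of_notMem fun h3 : s - r ∈ Ioo 0 s => h1 (by linarith [h3.2])]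
    _ = ∫⁻ r in Ioo 0 s, G r := by
        rw [lintegral_sub_left_eq_self (fun r => (Ioo 0 s).indicator G r) s,
          lintegral_indicator measurableSet_Ioo]

theorem hasIncomingTrace_of_ae_eq_resolvent (hE : IsAdmissible φ E0)
    (hm : IsNonsingular φ E0 J m) (hb : IsBoundaryPair φ E0 J m mp mn) {f : L1E φ E0 m}
    {h : X → ℝ} (hh : Measurable h) (hi : IntegrableOn h E0 m)
    (hf : f =ᵐ[m.restrict E0] resolvent φ E0 J ϑ h) :
    HasIncomingTrace φ E0 J m mn f fun _ => 0 := by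
  refine ⟨resolvent φ E0 J ϑ h, EventuallyEq.symm ((hm.ae_stateSpace_iff hE).2 hf), ?_⟩
  filter_upwards [ae_lintegral_entrance_lt_top hE hm hb hh hi,
    (ae_iff.2 hb.carried_minus : ∀ᵐ z ∂mn, z ∈ incoming φ E0)] with z hz hzi
  exact tendsto_resolvent_entrance hE hm h hzi hz

end Trace

/-! ### Exponential weights on the half-line. -/

section ExponentialWeight

theorem integral_exp_neg_integral_mul_self {κ : ℝ → ℝ} {T : ℝ}
    (hκ : IntervalIntegrable κ volume 0 T) :
    ∫ t in (0 : ℝ)..T, Real.exp (-∫ r in (0 : ℝ)..t, κ r) * κ t =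
      1 - Real.exp (-∫ r in (0 : ℝ)..T, κ r) := by
  simpa using integral_exp_neg_integral_mul hκ (q := 0) IntervalIntegrable.zero 1

/-- The partial integrals are `1 - exp(-∫κ) ≤ 1`, and the integrand is nonnegative. -/
theorem integrableOn_exp_neg_integral_mul_self {κ : ℝ → ℝ}
    (hκ : ∀ a b, IntervalIntegrable κ volume a b) (h0 : ∀ t, 0 ≤ κ t) :
    IntegrableOn (fun t => Real.exp (-∫ r in (0 : ℝ)..t, κ r) * κ t) (Ioi 0) ∧
      ∫⁻ t in Ioi (0 : ℝ), ENNReal.ofReal (Real.exp (-∫ r in (0 : ℝ)..t, κ r) * κ t) ≤ 1 := by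
  have hc : Continuous fun t => Real.exp (-∫ r in (0 : ℝ)..t, κ r) :=
    (intervalIntegral.continuous_primitive hκ 0).neg.rexp
  have hi : IntegrableOn (fun t => Real.exp (-∫ r in (0 : ℝ)..t, κ r) * κ t) (Ioi 0) := by
    refine integrableOn_Ioi_of_intervalIntegral_norm_bounded (b := fun n : ℕ => (n : ℝ)) 1 0
      (fun n => ?_) tendsto_natCast_atTop_atTop (.of_forall fun n => ?_)
    · exact ((hκ 0 n).continuousOn_mul hc.continuousOn).1
    · have : ∀ t, ‖Real.exp (-∫ r in (0 : ℝ)..t, κ r) * κ t‖ =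
          Real.exp (-∫ r in (0 : ℝ)..t, κ r) * κ t := fun t =>
        Real.norm_of_nonneg (mul_nonneg (Real.exp_pos _).le (h0 t))
      simp only [this]
      rw [integral_exp_neg_integral_mul_self (hκ 0 n)]
      linarith [Real.exp_pos (-∫ r in (0 : ℝ)..n, κ r)]
  refine ⟨hi, ?_⟩
  rw [← ofReal_integral_eq_lintegral_ofReal hi
    (.of_forall fun t => mul_nonneg (Real.exp_pos _).le (h0 t)), ENNReal.ofReal_le_one]
  refine le_of_tendsto (intervalIntegral_tendsto_integral_Ioi 0 hi tendsto_id)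
    (.of_forall fun T => ?_)
  rw [integral_exp_neg_integral_mul_self (hκ 0 _)]
  linarith [Real.exp_pos (-∫ r in (0 : ℝ)..(id T), κ r)]

end ExponentialWeight

/-! ### Duality between the resolvent and forward orbits. -/

section ForwardWeight

variable {X : Type*} [TopologicalSpace X] [SecondCountableTopology X] [MeasurableSpace X]
  [BorelSpace X] {φ : Flow ℝ X} {E0 : Set X} {J : ℝ → X → ℝ≥0} {m : Measure X}
  {ϑ : X → ℝ≥0}

/-- The discounted probability that neither a jump nor an exit occurs along the forward orbit. -/
noncomputable def forwardWeight (φ : Flow ℝ X) (E0 : Set X) (ϑ : X → ℝ≥0) (r : ℝ) (x : X) : ℝ :=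
  Real.exp (-r) * survival φ E0 ϑ r (φ r x)

theorem forwardWeight_nonneg (r : ℝ) (x : X) : 0 ≤ forwardWeight φ E0 ϑ r x :=
  mul_nonneg (Real.exp_pos _).le (survival_nonneg _ _)

theorem measurable_forwardWeight_uncurry (hE : IsAdmissible φ E0) (hϑ : IsJumpRate φ E0 ϑ) :
    Measurable fun p : ℝ × X => forwardWeight φ E0 ϑ p.1 p.2 :=
  measurable_fst.neg.exp.mul ((measurable_survival_uncurry hE hϑ).comp
    (measurable_fst.prodMk (measurable_flow_uncurry φ)))

theorem forwardWeight_of_notMem (hE : IsAdmissible φ E0) {r : ℝ} (hr : 0 ≤ r) {x : X}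
    (hx : x ∉ E0) : forwardWeight φ E0 ϑ r x = 0 := by
  rw [forwardWeight, survival_flow_of_notMem hE hr hx, mul_zero]

theorem intervalIntegrable_one_add (hϑ : IsJumpRate φ E0 ϑ) (x : X) (a b : ℝ) :
    IntervalIntegrable (fun r => 1 + (ϑ (φ r x) : ℝ)) volume a b :=
  intervalIntegrable_const.add (hϑ.integrable_orbit x a b)

theorem exp_neg_integral_one_add (hϑ : IsJumpRate φ E0 ϑ) (x : X) (r : ℝ) :
    Real.exp (-∫ q in (0 : ℝ)..r, (1 + (ϑ (φ q x) : ℝ))) =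
      Real.exp (-r) * Real.exp (-∫ q in (0 : ℝ)..r, (ϑ (φ q x) : ℝ)) := by
  rw [intervalIntegral.integral_add intervalIntegrable_const (hϑ.integrable_orbit x 0 r),
    ← Real.exp_add]
  simp [add_comm]

open Classical in
theorem forwardWeight_eq (hE : IsAdmissible φ E0) (hϑ : IsJumpRate φ E0 ϑ) {r : ℝ} (hr : 0 ≤ r)
    {x : X} (hx : x ∈ E0) : forwardWeight φ E0 ϑ r x = if (r : EReal) < tPlus φ E0 x then
      Real.exp (-∫ q in (0 : ℝ)..r, (1 + (ϑ (φ q x) : ℝ))) else 0 := by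
  rw [forwardWeight, survival_flow hE hr, exp_neg_integral_one_add hϑ]
  split_ifs with h1 h2 h2
  · rfl
  · exact absurd h1.2 h2
  · exact absurd ⟨hx, h2⟩ h1
  · exact mul_zero _

theorem forwardWeight_le (hE : IsAdmissible φ E0) (hϑ : IsJumpRate φ E0 ϑ) {r : ℝ} (hr : 0 ≤ r)
    (x : X) : forwardWeight φ E0 ϑ r x ≤
      Real.exp (-∫ q in (0 : ℝ)..r, (1 + (ϑ (φ q x) : ℝ))) := by
  by_cases hx : x ∈ E0
  · rw [forwardWeight_eq hE hϑ hr hx]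
    split_ifs
    · exact le_rfl
    · exact (Real.exp_pos _).le
  · rw [forwardWeight_of_notMem hE hr hx]
    exact (Real.exp_pos _).le

theorem one_add_coe_enorm (a : ℝ≥0) : ENNReal.ofReal (1 + (a : ℝ)) = 1 + (a : ℝ≥0∞) := by
  rw [ENNReal.ofReal_add zero_le_one a.coe_nonneg, ENNReal.ofReal_one, ENNReal.ofReal_coe_nnreal]

theorem lintegral_forwardWeight_mul_le (hE : IsAdmissible φ E0) (hϑ : IsJumpRate φ E0 ϑ)
    (x : X) : ∫⁻ r in Ioi (0 : ℝ), (1 + (ϑ (φ r x) : ℝ≥0∞)) *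
      ENNReal.ofReal (forwardWeight φ E0 ϑ r x) ≤ 1 := by
  refine le_trans (setLIntegral_mono' measurableSet_Ioi fun r hr => ?_)
    (integrableOn_exp_neg_integral_mul_self (intervalIntegrable_one_add hϑ x)
      fun t => by positivity).2
  rw [mul_comm, ENNReal.ofReal_mul (Real.exp_pos _).le, one_add_coe_enorm]
  exact mul_le_mul' (ENNReal.ofReal_le_ofReal (forwardWeight_le hE hϑ (le_of_lt hr) x)) le_rfl

theorem lintegral_mul_enorm_discounted (hE : IsAdmissible φ E0) (hm : IsNonsingular φ E0 J m)
    (hϑ : IsJumpRate φ E0 ϑ) {h : X → ℝ} (hh : Measurable h) {g : X → ℝ≥0∞}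
    (hg : Measurable g) (r : ℝ) :
    ∫⁻ x, g x * ‖discounted φ E0 J ϑ h r x‖ₑ ∂m =
      ∫⁻ x, g (φ r x) * ENNReal.ofReal (forwardWeight φ E0 ϑ r x) * ‖h x‖ₑ ∂m := by
  have := lintegral_mul_enorm_killed hE hm hϑ hh (hg.const_mul (ENNReal.ofReal (Real.exp (-r)))) r
  calc _ = ∫⁻ x, ENNReal.ofReal (Real.exp (-r)) * g x * ‖killed φ E0 J ϑ r h x‖ₑ ∂m := by
        refine lintegral_congr fun x => ?_
        rw [discounted, enorm_mul, Real.enorm_of_nonneg (Real.exp_pos _).le]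
        ring
    _ = _ := by
        rw [this]
        refine lintegral_congr fun x => ?_
        rw [forwardWeight, ENNReal.ofReal_mul (Real.exp_pos _).le]
        ring

/-- The jump rate is integrable against the resolvent. -/
theorem lintegral_one_add_mul_discounted_le (hE : IsAdmissible φ E0)
    (hm : IsNonsingular φ E0 J m) (hϑ : IsJumpRate φ E0 ϑ) {h : X → ℝ} (hh : Measurable h) :
    ∫⁻ r in Ioi (0 : ℝ), ∫⁻ x, (1 + (ϑ x : ℝ≥0∞)) * ‖discounted φ E0 J ϑ h r x‖ₑ ∂m ≤
      ∫⁻ x in E0, ‖h x‖ₑ ∂m := by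
  have := hm.sigmaFinite
  have hϑm : Measurable fun x => 1 + (ϑ x : ℝ≥0∞) :=
    measurable_const.add hϑ.measurable.coe_nnreal_ennreal
  have hw := measurable_forwardWeight_uncurry hE hϑ
  simp only [lintegral_mul_enorm_discounted hE hm hϑ hh hϑm]
  -- With the flow moved onto `1 + ϑ`, the inner integral runs over the forward orbit of `x` and is
  -- at most one.
  rw [lintegral_lintegral_swap]
  · rw [← lintegral_indicator hE.measurableSet]
    refine lintegral_mono fun x => ?_
    have hmx : Measurable fun r => (1 + (ϑ (φ r x) : ℝ≥0∞)) *
        ENNReal.ofReal (forwardWeight φ E0 ϑ r x) :=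
      (hϑm.comp (measurable_flow_apply φ measurable_id measurable_const)).mul
        (hw.comp measurable_prodMk_right).ennreal_ofReal
    rw [lintegral_mul_const _ hmx]
    by_cases hx : x ∈ E0
    · rw [indicator_of_mem hx]
      exact mul_le_of_le_one_left' (lintegral_forwardWeight_mul_le hE hϑ x)
    · have : ∫⁻ r in Ioi (0 : ℝ), (1 + (ϑ (φ r x) : ℝ≥0∞)) *
          ENNReal.ofReal (forwardWeight φ E0 ϑ r x) = 0 := by
        refine (setLIntegral_congr_fun measurableSet_Ioi fun r hr => ?_).trans lintegral_zero
        simp [forwardWeight_of_notMem hE (le_of_lt hr) hx]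
      rw [this, zero_mul]
      exact zero_le
  · exact (((hϑm.comp (measurable_flow_uncurry φ)).mul hw.ennreal_ofReal).mul
      (hh.comp measurable_snd).enorm).aemeasurable

/-- Growth up to `1 + ϑ` is allowed because the dual resolvent equation is tested with `ψ' - (1 +
ϑ)ψ`, which is unbounded when `ϑ` is. -/
theorem integrable_mul_resolvent (hE : IsAdmissible φ E0) (hm : IsNonsingular φ E0 J m)
    (hϑ : IsJumpRate φ E0 ϑ) {h : X → ℝ} (hh : Measurable h) (hi : IntegrableOn h E0 m)
    {χ : X → ℝ} (hχ : Measurable χ) {C : ℝ} (hC : ∀ x, |χ x| ≤ C * (1 + ϑ x)) :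
    Integrable (fun p : ℝ × X => χ p.2 * discounted φ E0 J ϑ h p.1 p.2)
      ((volume.restrict (Ioi 0)).prod m) := by
  have := hm.sigmaFinite
  have hd := measurable_discounted_uncurry hE hm hϑ hh
  have hmeas : Measurable fun p : ℝ × X => χ p.2 * discounted φ E0 J ϑ h p.1 p.2 :=
    (hχ.comp measurable_snd).mul hd
  refine ⟨hmeas.aestronglyMeasurable, ?_⟩
  rw [HasFiniteIntegral, lintegral_prod _ hmeas.enorm.aemeasurable]
  have hle : ∀ x, ‖χ x‖ₑ ≤ ENNReal.ofReal C * (1 + (ϑ x : ℝ≥0∞)) := fun x => by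
    rw [Real.enorm_eq_ofReal_abs, ← one_add_coe_enorm, ← ENNReal.ofReal_mul' (by positivity)]
    exact ENNReal.ofReal_le_ofReal (hC x)
  calc _ ≤ ∫⁻ r in Ioi (0 : ℝ), ∫⁻ x, ENNReal.ofReal C *
          ((1 + (ϑ x : ℝ≥0∞)) * ‖discounted φ E0 J ϑ h r x‖ₑ) ∂m := by
        refine lintegral_mono fun r => lintegral_mono fun x => ?_
        rw [enorm_mul, ← mul_assoc]
        exact mul_le_mul' (hle x) le_rfl
    _ = ENNReal.ofReal C * ∫⁻ r in Ioi (0 : ℝ), ∫⁻ x,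
          (1 + (ϑ x : ℝ≥0∞)) * ‖discounted φ E0 J ϑ h r x‖ₑ ∂m := by
        have e : ∀ r, ∫⁻ x, ENNReal.ofReal C *
            ((1 + (ϑ x : ℝ≥0∞)) * ‖discounted φ E0 J ϑ h r x‖ₑ) ∂m = ENNReal.ofReal C *
            ∫⁻ x, (1 + (ϑ x : ℝ≥0∞)) * ‖discounted φ E0 J ϑ h r x‖ₑ ∂m := fun r =>
          lintegral_const_mul' _ _ ENNReal.ofReal_ne_top
        simp only [e]
        exact lintegral_const_mul' _ _ ENNReal.ofReal_ne_top
    _ < ∞ := ENNReal.mul_lt_top ENNReal.ofReal_lt_top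
        ((lintegral_one_add_mul_discounted_le hE hm hϑ hh).trans_lt hi.2)

theorem integral_mul_discounted (hE : IsAdmissible φ E0) (hm : IsNonsingular φ E0 J m)
    (hϑ : IsJumpRate φ E0 ϑ) {h : X → ℝ} (hh : Measurable h) {χ : X → ℝ} (hχ : Measurable χ)
    (r : ℝ) :
    ∫ x, χ x * discounted φ E0 J ϑ h r x ∂m =
      ∫ x, χ (φ r x) * forwardWeight φ E0 ϑ r x * h x ∂m := by
  have := integral_mul_transport hm hh
    ((hχ.mul (measurable_survival hE hϑ r)).const_mul (Real.exp (-r))) r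
  calc _ = ∫ x, Real.exp (-r) * (χ x * survival φ E0 ϑ r x) * transport φ J r h x ∂m := by
        refine integral_congr_ae (.of_forall fun x => ?_)
        simp only [discounted, killed]; ring
    _ = _ := by
        refine this.trans (integral_congr_ae (.of_forall fun x => ?_))
        simp only [forwardWeight, Pi.mul_apply]; ring

/-- Duality between the resolvent and the integral along the forward orbits. -/
theorem integral_mul_resolvent (hE : IsAdmissible φ E0) (hm : IsNonsingular φ E0 J m)
    (hϑ : IsJumpRate φ E0 ϑ) {h : X → ℝ} (hh : Measurable h) (hi : IntegrableOn h E0 m)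
    {χ : X → ℝ} (hχ : Measurable χ) {C : ℝ} (hC : ∀ x, |χ x| ≤ C * (1 + ϑ x)) :
    ∫ x, χ x * resolvent φ E0 J ϑ h x ∂m =
      ∫ x, (∫ r in Ioi (0 : ℝ), χ (φ r x) * forwardWeight φ E0 ϑ r x) * h x ∂m := by
  have := hm.sigmaFinite
  have hint := integrable_mul_resolvent hE hm hϑ hh hi hχ hC
  have hw := measurable_forwardWeight_uncurry hE hϑ
  have hmeas : Measurable fun p : ℝ × X =>
      χ (φ p.1 p.2) * forwardWeight φ E0 ϑ p.1 p.2 * h p.2 :=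
    ((hχ.comp (measurable_flow_uncurry φ)).mul hw).mul (hh.comp measurable_snd)
  have hint2 : Integrable (fun p : ℝ × X =>
      χ (φ p.1 p.2) * forwardWeight φ E0 ϑ p.1 p.2 * h p.2)
      ((volume.restrict (Ioi 0)).prod m) := by
    refine ⟨hmeas.aestronglyMeasurable, ?_⟩
    have h2 := hint.2
    rw [HasFiniteIntegral, lintegral_prod _ hint.1.enorm] at h2
    rw [HasFiniteIntegral, lintegral_prod _ hmeas.enorm.aemeasurable]
    refine lt_of_le_of_lt (le_of_eq (lintegral_congr fun r => ?_)) h2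
    simp only [enorm_mul]
    rw [lintegral_mul_enorm_discounted hE hm hϑ hh hχ.enorm]
    refine lintegral_congr fun x => ?_
    rw [Real.enorm_of_nonneg (forwardWeight_nonneg r x)]
  calc _ = ∫ x, (∫ r in Ioi (0 : ℝ), χ x * discounted φ E0 J ϑ h r x) ∂m := by
        simp only [resolvent, integral_const_mul]
    _ = ∫ r in Ioi (0 : ℝ), ∫ x, χ x * discounted φ E0 J ϑ h r x ∂m :=
        (integral_integral_swap hint).symm
    _ = ∫ r in Ioi (0 : ℝ), ∫ x, χ (φ r x) * forwardWeight φ E0 ϑ r x * h x ∂m := by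
        simp only [integral_mul_discounted hE hm hϑ hh hχ]
    _ = ∫ x, (∫ r in Ioi (0 : ℝ), χ (φ r x) * forwardWeight φ E0 ϑ r x * h x) ∂m :=
        integral_integral_swap hint2
    _ = _ := by simp only [integral_mul_const]

theorem integrable_mul_resolvent_apply (hE : IsAdmissible φ E0) (hm : IsNonsingular φ E0 J m)
    (hϑ : IsJumpRate φ E0 ϑ) {h : X → ℝ} (hh : Measurable h) (hi : IntegrableOn h E0 m)
    {χ : X → ℝ} (hχ : Measurable χ) {C : ℝ} (hC : ∀ x, |χ x| ≤ C * (1 + ϑ x)) :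
    Integrable (fun x => χ x * resolvent φ E0 J ϑ h x) m := by
  have := hm.sigmaFinite
  have := (integrable_mul_resolvent hE hm hϑ hh hi hχ hC).integral_prod_right
  simpa only [resolvent, integral_const_mul] using this

theorem resolvent_of_notMem {x : X} (hx : x ∉ E0) (h : X → ℝ) :
    resolvent φ E0 J ϑ h x = 0 := by
  have : ∀ r, discounted φ E0 J ϑ h r x = 0 := fun r => by
    rw [discounted, killed, survival_of_notMem fun hh => hx hh.1, zero_mul, mul_zero]
  simp [resolvent, this]

end ForwardWeight

/-! ### Test functions along orbits; the resolvent maps into the domain of `A₀`. -/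

section TestFunctions

variable {X : Type*} [TopologicalSpace X] [SecondCountableTopology X] [MeasurableSpace X]
  [BorelSpace X] {φ : Flow ℝ X} {E0 : Set X} {J : ℝ → X → ℝ≥0} {m mp mn : Measure X}
  {ϑ : X → ℝ≥0} {ψ : X → ℝ}

theorem flowDeriv_flow (φ : Flow ℝ X) (ψ : X → ℝ) (r : ℝ) (x : X) :
    flowDeriv φ ψ (φ r x) = deriv (fun t => ψ (φ t x)) r := by
  have := deriv_comp_add_const (fun t => ψ (φ t x)) r 0
  rw [zero_add] at this
  rw [← this, flowDeriv]
  simp only [φ.map_add]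

theorem flowDeriv_of_notMem_tsupport {x : X} (hx : x ∉ tsupport ψ) : flowDeriv φ ψ x = 0 := by
  have hc : Continuous fun t : ℝ => φ t x := by fun_prop
  have h : ∀ᶠ t in 𝓝 (0 : ℝ), φ t x ∉ tsupport ψ := by
    refine hc.continuousAt.eventually ((isClosed_tsupport ψ).isOpen_compl.mem_nhds ?_)
    simpa using hx
  have h' : (fun t => ψ (φ t x)) =ᶠ[𝓝 0] fun _ => 0 :=
    h.mono fun t ht => image_eq_zero_of_notMem_tsupport ht
  rw [flowDeriv, h'.deriv_eq, deriv_const]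

theorem IsTestFunction.hasDerivAt (hψ : IsTestFunction φ E0 ψ) (hE : IsAdmissible φ E0) {x : X}
    (hx : x ∈ E0) {r : ℝ} (h0 : 0 ≤ r) (hr : (r : EReal) < tPlus φ E0 x) :
    HasDerivAt (fun t => ψ (φ t x)) (flowDeriv φ ψ (φ r x)) r := by
  rw [flowDeriv_flow]
  refine DifferentiableAt.hasDerivAt ?_
  have hopen : IsOpen {t : ℝ | -(tMinus φ E0 x) < (t : EReal) ∧ (t : EReal) < tPlus φ E0 x} :=
    (isOpen_Ioo (a := -(tMinus φ E0 x)) (b := tPlus φ E0 x)).preimage continuous_coe_real_ereal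
  have hneg : -(tMinus φ E0 x) < 0 := by
    simpa using EReal.neg_lt_neg_iff.2 (hE.staysIn.tMinus_pos hx)
  exact ((hψ.contDiffOn x (subset_stateSpace hx)).differentiableOn one_ne_zero).differentiableAt
    (hopen.mem_nhds ⟨hneg.trans_le (by exact_mod_cast h0), hr⟩)

theorem IsTestFunction.intervalIntegrable_flowDeriv (hψ : IsTestFunction φ E0 ψ) (x : X)
    (a b : ℝ) : IntervalIntegrable (fun r => flowDeriv φ ψ (φ r x)) volume a b := by
  obtain ⟨C, hC⟩ := hψ.deriv_bounded
  refine (intervalIntegrable_const (c := C)).mono_fun ?_ (.of_forall fun r => ?_)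
  · exact (hψ.deriv_measurable.comp
      (measurable_flow_apply φ measurable_id measurable_const)).aestronglyMeasurable
  · exact (hC _).trans (le_abs_self C)

theorem IsTestFunction.eq_add_integral (hψ : IsTestFunction φ E0 ψ) (hE : IsAdmissible φ E0)
    {x : X} (hx : x ∈ E0) {T : ℝ} (h0 : 0 ≤ T) (hT : (T : EReal) < tPlus φ E0 x) :
    ψ (φ T x) = ψ x + ∫ r in (0 : ℝ)..T, flowDeriv φ ψ (φ r x) := by
  have h := intervalIntegral.integral_eq_sub_of_hasDerivAt (f := fun t => ψ (φ t x))
    (fun r hr => by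
      rw [uIcc_of_le h0] at hr
      exact hψ.hasDerivAt hE hx hr.1 (lt_of_le_of_lt (by exact_mod_cast hr.2) hT))
    (hψ.intervalIntegrable_flowDeriv x 0 T)
  rw [h]
  simp

open Classical in
/-- A test function along an orbit, cut off at the exit time, is absolutely continuous. -/
theorem IsTestFunction.cutoff_eq (hψ : IsTestFunction φ E0 ψ) (hE : IsAdmissible φ E0)
    {x : X} (hx : x ∈ E0) {T : ℝ} (h0 : 0 ≤ T) :
    (if (T : EReal) < tPlus φ E0 x then ψ (φ T x) else 0) =
      ψ x + ∫ r in (0 : ℝ)..T,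
        (if (r : EReal) < tPlus φ E0 x then flowDeriv φ ψ (φ r x) else 0) := by
  have hcongr : ∀ S : ℝ, 0 ≤ S → (S : EReal) < tPlus φ E0 x →
      ∫ r in (0 : ℝ)..S, (if (r : EReal) < tPlus φ E0 x then flowDeriv φ ψ (φ r x) else 0) =
        ∫ r in (0 : ℝ)..S, flowDeriv φ ψ (φ r x) := fun S hS hSt => by
    refine intervalIntegral.integral_congr fun r hr => if_pos ?_
    rw [uIcc_of_le hS] at hr
    exact lt_of_le_of_lt (by exact_mod_cast hr.2) hSt
  by_cases hT : (T : EReal) < tPlus φ E0 x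
  · rw [if_pos hT, hcongr T h0 hT]
    exact hψ.eq_add_integral hE hx h0 hT
  · rw [if_neg hT]
    have hfin : tPlus φ E0 x < ⊤ := lt_of_le_of_lt (not_lt.1 hT) (EReal.coe_lt_top T)
    have hτ := hE.staysIn.coe_toReal_tPlus hx hfin
    have hτ0 := hE.staysIn.toReal_tPlus_pos hx hfin
    have hout := hE.staysIn.flow_tPlus_mem hx hfin
    set τ := (tPlus φ E0 x).toReal
    have hτT : τ ≤ T := by
      have := not_lt.1 hT
      rw [← hτ] at this
      exact_mod_cast this
    -- The exit point is outside `E0`, hence off the closed support of `ψ`. So `ψ` already vanishes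
    -- shortly before `τ`, and the cut-off creates no jump.
    have hns : φ τ x ∉ tsupport ψ := fun h => hout.1.2 (hψ.support_subset h)
    have hc : Continuous fun t : ℝ => φ t x := by fun_prop
    have hev : ∀ᶠ t in 𝓝 τ, φ t x ∉ tsupport ψ :=
      hc.continuousAt.eventually ((isClosed_tsupport ψ).isOpen_compl.mem_nhds hns)
    obtain ⟨δ, hδ, hd⟩ := Metric.eventually_nhds_iff.1 hev
    obtain ⟨S, hS1, hS2⟩ := exists_between (show max 0 (τ - δ) < τ by simp [hτ0, hδ])
    have hS0 : 0 ≤ S := (le_max_left _ _).trans hS1.le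
    have hSδ : τ - δ < S := (le_max_right _ _).trans_lt hS1
    have hSt : (S : EReal) < tPlus φ E0 x := by rw [← hτ]; exact_mod_cast hS2
    have hnot : ∀ r, S ≤ r → r ≤ τ → φ r x ∉ tsupport ψ := fun r h1 h2 => hd (by
      rw [Real.dist_eq, abs_lt]; constructor <;> linarith)
    have hq : ∀ r, S ≤ r →
        (if (r : EReal) < tPlus φ E0 x then flowDeriv φ ψ (φ r x) else 0) = 0 := fun r hr => by
      split_ifs with h
      · have : r ≤ τ := by rw [← hτ] at h; exact le_of_lt (by exact_mod_cast h)
        exact flowDeriv_of_notMem_tsupport (hnot r hr this)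
      · rfl
    have hi : IntervalIntegrable (fun r : ℝ =>
        if (r : EReal) < tPlus φ E0 x then flowDeriv φ ψ (φ r x) else 0) volume 0 S := by
      refine (hψ.intervalIntegrable_flowDeriv x 0 S).congr fun r hr => (if_pos ?_).symm
      rw [uIoc_of_le hS0] at hr
      exact lt_of_le_of_lt (by exact_mod_cast hr.2) hSt
    have hST : S ≤ T := hS2.le.trans hτT
    have hz : ∫ r in S..T,
        (if (r : EReal) < tPlus φ E0 x then flowDeriv φ ψ (φ r x) else 0) = 0 := by
      refine (intervalIntegral.integral_congr (g := fun _ => 0) fun r hr => ?_).trans (by simp)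
      rw [uIcc_of_le hST] at hr
      exact hq r hr.1
    have hi2 : IntervalIntegrable (fun r : ℝ =>
        if (r : EReal) < tPlus φ E0 x then flowDeriv φ ψ (φ r x) else 0) volume S T := by
      refine (intervalIntegrable_const (c := (0 : ℝ))).congr fun r hr => ?_
      rw [uIoc_of_le hST] at hr
      exact (hq r hr.1.le).symm
    rw [← intervalIntegral.integral_add_adjacent_intervals hi hi2, hz, hcongr S hS0 hSt, add_zero,
      ← hψ.eq_add_integral hE hx hS0 hSt]
    exact (image_eq_zero_of_notMem_tsupport (hnot S le_rfl hS2.le)).symm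

theorem IsTestFunction.exists_bound (hψ : IsTestFunction φ E0 ψ) :
    ∃ C, 0 ≤ C ∧ (∀ x, |ψ x| ≤ C) ∧ ∀ x, |flowDeriv φ ψ x| ≤ C := by
  obtain ⟨A, hA⟩ := hψ.bounded
  obtain ⟨B, hB⟩ := hψ.deriv_bounded
  refine ⟨max 0 (max A B), le_max_left _ _, fun x => (hA x).trans ?_, fun x => (hB x).trans ?_⟩
  · exact (le_max_left _ _).trans (le_max_right _ _)
  · exact (le_max_right _ _).trans (le_max_right _ _)

theorem exp_neg_integral_one_add_le (hϑ : IsJumpRate φ E0 ϑ) (x : X) {T : ℝ} (hT : 0 ≤ T) :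
    Real.exp (-∫ q in (0 : ℝ)..T, (1 + (ϑ (φ q x) : ℝ))) ≤ Real.exp (-T) := by
  rw [exp_neg_integral_one_add hϑ]
  refine mul_le_of_le_one_right (Real.exp_pos _).le (Real.exp_le_one_iff.2 ?_)
  exact neg_nonpos.2 (intervalIntegral.integral_nonneg hT fun _ _ => NNReal.coe_nonneg _)

/-- Test functions are recovered from the image of the dual resolvent equation. -/
theorem IsTestFunction.integral_forwardWeight (hψ : IsTestFunction φ E0 ψ)
    (hE : IsAdmissible φ E0) (hϑ : IsJumpRate φ E0 ϑ) {x : X} (hx : x ∈ E0) :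
    ∫ r in Ioi (0 : ℝ), (flowDeriv φ ψ (φ r x) - (1 + ϑ (φ r x)) * ψ (φ r x)) *
      forwardWeight φ E0 ϑ r x = -ψ x := by
  classical
  obtain ⟨C, hC0, hC, hC'⟩ := hψ.exists_bound
  set κ : ℝ → ℝ := fun r => 1 + (ϑ (φ r x) : ℝ) with hκ
  have hκi := intervalIntegrable_one_add hϑ x
  set e : ℝ → ℝ := fun t => Real.exp (-∫ q in (0 : ℝ)..t, κ q) with he
  set q : ℝ → ℝ := fun r => if (r : EReal) < tPlus φ E0 x then flowDeriv φ ψ (φ r x) else 0 with hq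
  have hset : MeasurableSet {r : ℝ | (r : EReal) < tPlus φ E0 x} :=
    measurableSet_lt measurable_coe_real_ereal measurable_const
  have hφx : Measurable fun r : ℝ => φ r x :=
    measurable_flow_apply φ measurable_id measurable_const
  have hqm : Measurable q := Measurable.ite hset (hψ.deriv_measurable.comp hφx) measurable_const
  have hqb : ∀ r, |q r| ≤ C := fun r => by
    simp only [hq]; split_ifs
    · exact hC' _
    · simpa using hC0
  have hqi : ∀ a b, IntervalIntegrable q volume a b := fun a b =>
    (intervalIntegrable_const (c := C)).mono_fun hqm.aestronglyMeasurable
      (.of_forall fun r => (hqb r).trans (le_abs_self C))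
  -- `p` is the test function along the orbit, cut off at the exit time. Written as an indefinite
  -- integral, it can be integrated by parts against `e`.
  set p : ℝ → ℝ := fun t => ψ x + ∫ r in (0 : ℝ)..t, q r with hp
  have hpt : ∀ t, 0 ≤ t → p t = if (t : EReal) < tPlus φ E0 x then ψ (φ t x) else 0 :=
    fun t ht => (hψ.cutoff_eq hE hx ht).symm
  have hpb : ∀ t, 0 ≤ t → |p t| ≤ C := fun t ht => by
    rw [hpt t ht]; split_ifs
    · exact hC _
    · simpa using hC0
  have hstep : ∀ T : ℝ, ∫ t in (0 : ℝ)..T, e t * (κ t * p t - q t) = ψ x - e T * p T := fun T =>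
    integral_exp_neg_integral_mul (hκi 0 T) (hqi 0 T) (ψ x)
  have hpc : Continuous p := continuous_const.add (intervalIntegral.continuous_primitive hqi 0)
  have hec : Continuous e := (intervalIntegral.continuous_primitive hκi 0).neg.rexp
  have hκm : Measurable κ := measurable_const.add (hϑ.measurable.comp hφx).coe_nnreal_real
  have hint : IntegrableOn (fun t => e t * (κ t * p t - q t)) (Ioi 0) := by
    have h1 := (integrableOn_exp_neg_integral_mul_self hκi fun t => by positivity).1
    -- Since `κ ≥ 1`, the bounded term `q` is absorbed as well, which gives the factor `2 * C`.
    refine (h1.const_mul (2 * C)).mono' ?_ ?_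
    · exact (hec.measurable.mul ((hκm.mul hpc.measurable).sub hqm)).aestronglyMeasurable
    · refine (ae_restrict_iff' measurableSet_Ioi).2 (.of_forall fun t ht => ?_)
      have hκ1 : 1 ≤ κ t := by simp [hκ]
      rw [Real.norm_eq_abs, abs_mul, abs_of_pos (Real.exp_pos _)]
      have h2 : |κ t * p t - q t| ≤ 2 * C * κ t := by
        calc |κ t * p t - q t| ≤ |κ t * p t| + |q t| := abs_sub _ _
          _ ≤ κ t * C + C := by
            rw [abs_mul, abs_of_pos (by linarith)]
            exact add_le_add (mul_le_mul_of_nonneg_left (hpb t (le_of_lt ht)) (by linarith)) (hqb t)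
          _ ≤ _ := by nlinarith
      calc e t * |κ t * p t - q t| ≤ e t * (2 * C * κ t) :=
            mul_le_mul_of_nonneg_left h2 (Real.exp_pos _).le
        _ = _ := by ring
  have hlim := intervalIntegral_tendsto_integral_Ioi 0 hint tendsto_id
  have hlim2 : Tendsto (fun T : ℝ => ∫ t in (0 : ℝ)..(id T), e t * (κ t * p t - q t)) atTop
      (𝓝 (ψ x)) := by
    simp only [hstep, id]
    have h0 : Tendsto (fun T => e T * p T) atTop (𝓝 0) := by
      have hd : Tendsto (fun T : ℝ => Real.exp (-T) * C) atTop (𝓝 0) := by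
        simpa using (Real.tendsto_exp_neg_atTop_nhds_zero).mul_const C
      refine squeeze_zero_norm' ?_ hd
      filter_upwards [eventually_ge_atTop 0] with T hT
      rw [Real.norm_eq_abs, abs_mul, abs_of_pos (Real.exp_pos _)]
      exact mul_le_mul (exp_neg_integral_one_add_le hϑ x hT) (hpb T hT) (abs_nonneg _)
        (Real.exp_pos _).le
    simpa using h0.const_sub (ψ x)
  have hval := tendsto_nhds_unique hlim hlim2
  rw [← hval, ← integral_neg]
  refine setIntegral_congr_fun measurableSet_Ioi fun r hr => ?_
  have hr' : (0 : ℝ) ≤ r := le_of_lt hr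
  simp only [forwardWeight_eq hE hϑ hr' hx, hpt r hr', hq]
  split_ifs
  · simp only [he, hκ]; ring
  · simp

/-- Duality with `χ = ψ' - (1 + ϑ)ψ` gives `∫ χ f = -∫ ψ h`. Inserting `h = f - g` cancels the terms
`ψ f` and leaves `∫ f ψ' = ∫ (g + ϑ f) ψ`. -/
theorem maxTransport_of_ae_eq_resolvent (hE : IsAdmissible φ E0) (hm : IsNonsingular φ E0 J m)
    (hϑ : IsJumpRate φ E0 ϑ) {f g k : L1E φ E0 m}
    (hf : f =ᵐ[m.restrict E0] resolvent φ E0 J ϑ (f - g : L1E φ E0 m))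
    (hk : k =ᵐ[m.restrict E0] fun x => g x + ϑ x * f x) : MaxTransport φ E0 m f k := by
  intro ψ hψ
  rw [hm.integral_stateSpace hE, hm.integral_stateSpace hE]
  obtain ⟨C, hC0, hC, hC'⟩ := hψ.exists_bound
  set h : L1E φ E0 m := f - g
  have hh := measurable_coe_L1E h
  have hi := integrableOn_coe_L1E hE hm h
  set χ : X → ℝ := fun x => flowDeriv φ ψ x - (1 + ϑ x) * ψ x with hχdef
  have hχ : Measurable χ := hψ.deriv_measurable.sub
    ((measurable_const.add hϑ.measurable.coe_nnreal_real).mul hψ.measurable)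
  have hχb : ∀ x, |χ x| ≤ (2 * C) * (1 + ϑ x) := fun x => by
    have h1 : (0 : ℝ) ≤ ϑ x := NNReal.coe_nonneg _
    calc |χ x| ≤ |flowDeriv φ ψ x| + |(1 + ϑ x) * ψ x| := abs_sub _ _
      _ ≤ C + (1 + ϑ x) * C := by
        rw [abs_mul, abs_of_pos (by linarith : (0 : ℝ) < 1 + ϑ x)]
        exact add_le_add (hC' x) (mul_le_mul_of_nonneg_left (hC x) (by linarith))
      _ ≤ _ := by nlinarith
  have hdual := integral_mul_resolvent hE hm hϑ hh hi hχ hχb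
  have hL : ∫ x, χ x * resolvent φ E0 J ϑ h x ∂m = ∫ x in E0, χ x * f x ∂m := by
    rw [← setIntegral_eq_integral_of_forall_compl_eq_zero (s := E0)]
    · refine integral_congr_ae ?_
      filter_upwards [hf] with x hx
      rw [hx]
    · intro x hx
      rw [resolvent_of_notMem hx, mul_zero]
  have hR : ∫ x, (∫ r in Ioi (0 : ℝ), χ (φ r x) * forwardWeight φ E0 ϑ r x) * h x ∂m =
      ∫ x in E0, -ψ x * h x ∂m := by
    rw [← setIntegral_eq_integral_of_forall_compl_eq_zero (s := E0)]
    · refine setIntegral_congr_fun hE.measurableSet fun x hx => ?_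
      simp only [hχdef, hψ.integral_forwardWeight hE hϑ hx]
    · intro x hx
      have : ∫ r in Ioi (0 : ℝ), χ (φ r x) * forwardWeight φ E0 ϑ r x = 0 := by
        refine (setIntegral_congr_fun measurableSet_Ioi fun r hr => ?_).trans (integral_zero _ _)
        simp [forwardWeight_of_notMem hE (le_of_lt hr) hx]
      rw [this, zero_mul]
  rw [hL, hR] at hdual
  have iχ : IntegrableOn (fun x => χ x * f x) E0 m := by
    refine (integrable_mul_resolvent_apply hE hm hϑ hh hi hχ hχb).integrableOn.congr ?_
    filter_upwards [hf] with x hx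
    rw [hx]
  have iψh : IntegrableOn (fun x => -ψ x * h x) E0 m :=
    hi.bdd_mul hψ.measurable.neg.aestronglyMeasurable
      (.of_forall fun x => by simpa using hC x)
  have iψ' : IntegrableOn (fun x => f x * flowDeriv φ ψ x) E0 m :=
    (integrableOn_coe_L1E hE hm f).mul_bdd (c := C) hψ.deriv_measurable.aestronglyMeasurable
      (.of_forall fun x => hC' x)
  have key : ∫ x in E0, k x * ψ x ∂m =
      ∫ x in E0, (f x * flowDeriv φ ψ x - χ x * f x + -ψ x * h x) ∂m := by
    refine integral_congr_ae ?_
    filter_upwards [hk, coeFn_sub_L1E hE hm f g] with x hx hx'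
    have hx'' : h x = f x - g x := hx'
    rw [hx, hx'']
    simp only [hχdef]
    ring
  have i1 : IntegrableOn (fun x => f x * flowDeriv φ ψ x - χ x * f x) E0 m := iψ'.sub iχ
  rw [key, integral_add i1 iψh, integral_sub iψ' iχ, hdual]
  ring

theorem graphA0_of_ae_eq_resolvent (hE : IsAdmissible φ E0) (hm : IsNonsingular φ E0 J m)
    (hϑ : IsJumpRate φ E0 ϑ) (hb : IsBoundaryPair φ E0 J m mp mn) {f g : L1E φ E0 m}
    (hf : f =ᵐ[m.restrict E0] resolvent φ E0 J ϑ (f - g : L1E φ E0 m)) :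
    GraphA0 φ E0 J m mn ϑ f g := by
  have hh := measurable_coe_L1E (f - g)
  have hi := integrableOn_coe_L1E hE hm (f - g)
  have htr := hasIncomingTrace_of_ae_eq_resolvent hE hm hb hh hi hf
  have iϑ : Integrable (fun x => (ϑ x : ℝ) * f x) (m.restrict (stateSpace φ E0)) := by
    rw [hm.integrable_stateSpace_iff hE]
    refine (integrable_mul_resolvent_apply hE hm hϑ hh hi hϑ.measurable.coe_nnreal_real (C := 1)
      fun x => ?_).integrableOn.congr ?_
    · rw [abs_of_nonneg (NNReal.coe_nonneg _)]; linarith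
    · filter_upwards [hf] with x hx
      rw [hx]
  set k : L1E φ E0 m := g + (memLp_one_iff_integrable.2 iϑ).toLp
  have hk : k =ᵐ[m.restrict (stateSpace φ E0)] fun x => g x + ϑ x * f x := by
    filter_upwards [Lp.coeFn_add g (memLp_one_iff_integrable.2 iϑ).toLp,
      (memLp_one_iff_integrable.2 iϑ).coeFn_toLp] with x h1 h2
    rw [h1, Pi.add_apply, h2]
  have hmax := maxTransport_of_ae_eq_resolvent hE hm hϑ hf ((hm.ae_stateSpace_iff hE).1 hk)
  refine ⟨⟨⟨⟨k, hmax⟩, ⟨fun _ => 0, integrable_zero _ _ _, htr⟩, iϑ⟩, k, hmax, ?_⟩, htr⟩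
  filter_upwards [hk] with x hx
  rw [hx]
  ring

end TestFunctions

/-! ### Test functions obtained by averaging along the flow. -/

section OrbitMean

variable {X : Type*} [TopologicalSpace X] [SecondCountableTopology X] [MeasurableSpace X]
  [BorelSpace X] {φ : Flow ℝ X} {E0 : Set X} {J : ℝ → X → ℝ≥0} {m mp mn : Measure X}
  {ϑ : X → ℝ≥0} {χ : X → ℝ} {C : ℝ}

/-- The integral of `χ` along the forward orbit of `x` up to time `T`. -/
noncomputable def orbitMean (φ : Flow ℝ X) (T : ℝ) (χ : X → ℝ) (x : X) : ℝ :=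
  ∫ r in (0 : ℝ)..T, χ (φ r x)

theorem intervalIntegrable_comp_flow (φ : Flow ℝ X) (hχ : Measurable χ) (hC : ∀ x, |χ x| ≤ C)
    (x : X) (a b : ℝ) : IntervalIntegrable (fun r => χ (φ r x)) volume a b :=
  (intervalIntegrable_const (c := C)).mono_fun
    (hχ.comp (measurable_flow_apply φ measurable_id measurable_const)).aestronglyMeasurable
    (.of_forall fun _ => (hC _).trans (le_abs_self C))

theorem orbitMean_flow (φ : Flow ℝ X) (T : ℝ) (χ : X → ℝ) (s : ℝ) (x : X) :
    orbitMean φ T χ (φ s x) = ∫ r in s..(s + T), χ (φ r x) := by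
  have := intervalIntegral.integral_comp_add_right (a := 0) (b := T) (fun r => χ (φ r x)) s
  rw [zero_add, add_comm T s] at this
  rw [← this]
  simp only [orbitMean, φ.map_add]

theorem measurable_orbitMean (φ : Flow ℝ X) {T : ℝ} (hT : 0 ≤ T) (hχ : Measurable χ) :
    Measurable (orbitMean φ T χ) := by
  have h : Measurable fun p : X × ℝ => χ (φ p.2 p.1) :=
    hχ.comp (measurable_flow_apply φ measurable_snd measurable_fst)
  have := (h.stronglyMeasurable.integral_prod_right' (ν := volume.restrict (Ioc 0 T))).measurable
  unfold orbitMean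
  simpa only [intervalIntegral.integral_of_le hT] using this

theorem abs_orbitMean_le {T : ℝ} (hT : 0 ≤ T) (hC : ∀ x, |χ x| ≤ C) (x : X) :
    |orbitMean φ T χ x| ≤ C * T := by
  have := intervalIntegral.norm_integral_le_of_norm_le_const (a := 0) (b := T) (C := C)
    (f := fun r => χ (φ r x)) fun r _ => hC _
  rwa [sub_zero, abs_of_nonneg hT] at this

/-- One averaging makes a bounded Borel function continuous along orbits; a second makes it
continuously differentiable there. -/
theorem continuous_orbitMean_flow (φ : Flow ℝ X) (T : ℝ) (hχ : Measurable χ)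
    (hC : ∀ x, |χ x| ≤ C) (x : X) : Continuous fun s => orbitMean φ T χ (φ s x) := by
  have hi := intervalIntegrable_comp_flow φ hχ hC x
  have hP := intervalIntegral.continuous_primitive hi 0
  have : (fun s => orbitMean φ T χ (φ s x)) =
      fun s => (∫ r in (0 : ℝ)..(s + T), χ (φ r x)) - ∫ r in (0 : ℝ)..s, χ (φ r x) := by
    ext s
    rw [orbitMean_flow, intervalIntegral.integral_interval_sub_left (hi _ _) (hi _ _)]
  rw [this]
  exact (hP.comp (continuous_id.add continuous_const)).sub hP

theorem hasDerivAt_orbitMean_flow (φ : Flow ℝ X) (T : ℝ) {x : X}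
    (hχ : Continuous fun r => χ (φ r x)) (s : ℝ) :
    HasDerivAt (fun s => orbitMean φ T χ (φ s x)) (χ (φ (s + T) x) - χ (φ s x)) s := by
  have : (fun s => orbitMean φ T χ (φ s x)) =
      fun s => (∫ r in (0 : ℝ)..(s + T), χ (φ r x)) - ∫ r in (0 : ℝ)..s, χ (φ r x) := by
    ext s
    rw [orbitMean_flow, intervalIntegral.integral_interval_sub_left
      (hχ.intervalIntegrable _ _) (hχ.intervalIntegrable _ _)]
  rw [this]
  exact ((hχ.integral_hasStrictDerivAt 0 (s + T)).hasDerivAt.comp_add_const s T).sub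
    (hχ.integral_hasStrictDerivAt 0 s).hasDerivAt

theorem flowDeriv_orbitMean (φ : Flow ℝ X) (T : ℝ)
    (hχ : ∀ x, Continuous fun r => χ (φ r x)) (x : X) :
    flowDeriv φ (orbitMean φ T χ) x = χ (φ T x) - χ x := by
  have := (hasDerivAt_orbitMean_flow φ T (hχ x) 0).deriv
  simpa [flowDeriv] using this

theorem contDiff_orbitMean (φ : Flow ℝ X) (T : ℝ) (hχ : ∀ x, Continuous fun r => χ (φ r x))
    (x : X) : ContDiff ℝ 1 fun s => orbitMean φ T χ (φ s x) := by
  rw [contDiff_one_iff_deriv]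
  refine ⟨fun s => (hasDerivAt_orbitMean_flow φ T (hχ x) s).differentiableAt, ?_⟩
  have : deriv (fun s => orbitMean φ T χ (φ s x)) =
      fun s => χ (φ (s + T) x) - χ (φ s x) :=
    funext fun s => (hasDerivAt_orbitMean_flow φ T (hχ x) s).deriv
  rw [this]
  exact ((hχ x).comp (continuous_id.add continuous_const)).sub (hχ x)

theorem exists_of_orbitMean_ne_zero {T : ℝ} (hT : 0 ≤ T) {x : X}
    (h : orbitMean φ T χ x ≠ 0) : ∃ r ∈ Icc 0 T, χ (φ r x) ≠ 0 := by
  contrapose! h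
  refine (intervalIntegral.integral_congr (g := fun _ => (0 : ℝ)) fun r hr => ?_).trans (by simp)
  rw [uIcc_of_le hT] at hr
  exact h r hr

/-- Averaging twice along the flow turns the indicator of a compact set that stays alive into a
test function. -/
theorem isTestFunction_orbitMean_orbitMean [T2Space X] (hE : IsAdmissible φ E0) {K : Set X}
    (hK : IsCompact K) {t ε : ℝ} (ht : 0 ≤ t) (hε : 0 ≤ ε) (hKa : K ⊆ alive φ E0 (t + ε)) :
    IsTestFunction φ E0 (orbitMean φ ε (orbitMean φ t (K.indicator 1))) := by
  have hχ : Measurable (K.indicator (1 : X → ℝ)) := measurable_one.indicator hK.measurableSet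
  have hC : ∀ x, |K.indicator (1 : X → ℝ) x| ≤ 1 := fun x => by
    by_cases h : x ∈ K <;> simp [h]
  have h1 := measurable_orbitMean φ ht hχ
  have hC1 := fun x => abs_orbitMean_le (φ := φ) ht hC x
  have hc := continuous_orbitMean_flow φ t hχ hC
  have hd := flowDeriv_orbitMean φ ε hc
  -- The double mean at `x` sees the forward orbit for time `t + ε`, so it is supported in the
  -- backward sweep of `K`, which is compact and stays in `E0`.
  set S : Set X := (fun p : ℝ × X => φ (-p.1) p.2) '' (Icc 0 (t + ε) ×ˢ K)
  have hS : IsCompact S := (isCompact_Icc.prod hK).image (by fun_prop)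
  have hSE : S ⊆ E0 := by
    rintro _ ⟨⟨r, y⟩, ⟨hr, hy⟩, rfl⟩
    exact (hE.staysIn.mem_alive_iff (add_nonneg ht hε)).1 (hKa hy) r hr
  have hsupp : Function.support (orbitMean φ ε (orbitMean φ t (K.indicator 1))) ⊆ S := by
    intro x hx
    obtain ⟨q, hq, hq'⟩ := exists_of_orbitMean_ne_zero hε hx
    obtain ⟨r, hr, hr'⟩ := exists_of_orbitMean_ne_zero ht hq'
    rw [← φ.map_add] at hr'
    refine ⟨(r + q, φ (r + q) x), ⟨⟨add_nonneg hr.1 hq.1, add_le_add hr.2 hq.2⟩, ?_⟩,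
      flow_neg_flow φ _ x⟩
    by_contra h
    exact hr' (indicator_of_notMem h _)
  exact
    { measurable := measurable_orbitMean φ hε h1
      bounded := ⟨_, fun x => abs_orbitMean_le hε hC1 x⟩
      hasCompactSupport := HasCompactSupport.of_support_subset_isCompact hS hsupp
      support_subset := (closure_minimal hsupp hS.isClosed).trans hSE
      contDiffOn := fun x _ => (contDiff_orbitMean φ ε hc x).contDiffOn
      deriv_bounded := ⟨1 * t + 1 * t, fun x => by
        rw [hd]
        exact (abs_sub _ _).trans (add_le_add (hC1 _) (hC1 _))⟩
      deriv_measurable := by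
        rw [funext hd]
        exact (h1.comp (measurable_flow φ ε)).sub h1 }

end OrbitMean

/-! ### Pairing densities with functions moved by the flow. -/

section Pairing

variable {X : Type*} [TopologicalSpace X] [SecondCountableTopology X] [MeasurableSpace X]
  [BorelSpace X] {φ : Flow ℝ X} {E0 : Set X} {J : ℝ → X → ℝ≥0} {m mp mn : Measure X}
  {ϑ : X → ℝ≥0} {χ k : X → ℝ} {C : ℝ}

theorem integrable_comp_flow_mul (φ : Flow ℝ X) (hχ : Measurable χ) (hC : ∀ x, |χ x| ≤ C)
    (hki : Integrable k m) (q : ℝ) : Integrable (fun x => χ (φ q x) * k x) m :=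
  hki.bdd_mul (hχ.comp (measurable_flow φ q)).aestronglyMeasurable (.of_forall fun _ => hC _)

/-- `χ` is only bounded and Borel, so the increment of time is moved onto `k`, where transport is
strongly continuous. -/
theorem continuous_integral_comp_flow_mul (hm : IsNonsingular φ E0 J m) (hχ : Measurable χ)
    (hC : ∀ x, |χ x| ≤ C) (hk : Measurable k) (hki : Integrable k m) :
    Continuous fun q => ∫ x, χ (φ q x) * k x ∂m := by
  rw [continuous_iff_continuousAt]
  intro q
  have hshift : Tendsto (fun q' => q' - q) (𝓝 q) (𝓝 0) := by
    simpa using ((continuous_sub_right q).tendsto q)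
  have h0 := (ENNReal.tendsto_toReal ENNReal.zero_ne_top).comp
    ((tendsto_lintegral_enorm_transport_sub hm hk hki).comp hshift)
  have h1 := h0.const_mul |C|
  rw [ENNReal.toReal_zero, mul_zero] at h1
  refine tendsto_iff_norm_sub_tendsto_zero.2 (squeeze_zero (fun _ => norm_nonneg _) (fun q' => ?_) h1)
  have hT := integrable_transport hm hk hki (q' - q)
  have e : ∫ x, χ (φ q' x) * k x ∂m = ∫ x, χ (φ q x) * transport φ J (q' - q) k x ∂m := by
    rw [integral_mul_transport (g := fun x => χ (φ q x)) hm hk (hχ.comp (measurable_flow φ q))]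
    simp only [← φ.map_add, add_sub_cancel]
  rw [e, ← integral_sub (integrable_comp_flow_mul φ hχ hC hT q)
    (integrable_comp_flow_mul φ hχ hC hki q)]
  have hb : ∀ x, ‖χ (φ q x) * transport φ J (q' - q) k x - χ (φ q x) * k x‖ ≤
      |C| * ‖transport φ J (q' - q) k x - k x‖ := fun x => by
    rw [← mul_sub, norm_mul]
    exact mul_le_mul_of_nonneg_right ((hC _).trans (le_abs_self C)) (norm_nonneg _)
  refine (norm_integral_le_of_norm_le ((hT.sub hki).norm.const_mul |C|) (.of_forall hb)).trans ?_
  rw [integral_const_mul]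
  refine mul_le_mul_of_nonneg_left (le_of_eq ?_) (abs_nonneg _)
  exact integral_norm_eq_lintegral_enorm (hT.sub hki).aestronglyMeasurable

theorem integral_orbitMean_flow_mul (hm : IsNonsingular φ E0 J m) (hχ : Measurable χ)
    (hC : ∀ x, |χ x| ≤ C) (hki : Integrable k m) {T : ℝ} (hT : 0 ≤ T) (s : ℝ) :
    ∫ x, orbitMean φ T χ (φ s x) * k x ∂m =
      ∫ r in (0 : ℝ)..T, ∫ x, χ (φ (r + s) x) * k x ∂m := by
  have := hm.sigmaFinite
  have hi : Integrable (fun p : ℝ × X => χ (φ (p.1 + s) p.2) * k p.2)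
      ((volume.restrict (Ioc 0 T)).prod m) := by
    refine (hki.comp_snd (volume.restrict (Ioc (0 : ℝ) T))).bdd_mul (c := C)
      (hχ.comp (measurable_flow_apply φ (measurable_fst.add_const s)
        measurable_snd)).aestronglyMeasurable (.of_forall fun p => hC _)
  rw [intervalIntegral.integral_of_le hT, integral_integral_swap hi]
  refine integral_congr_ae (.of_forall fun x => ?_)
  simp only [orbitMean, intervalIntegral.integral_of_le hT, φ.map_add]
  rw [integral_mul_const]

theorem integrable_transport_prod (hm : IsNonsingular φ E0 J m) (hk : Measurable k)
    (hki : Integrable k m) (T : ℝ) :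
    Integrable (fun p : ℝ × X => transport φ J p.1 k p.2)
      ((volume.restrict (Ioc 0 T)).prod m) := by
  have := hm.sigmaFinite
  have hmeas := measurable_transport_uncurry hm hk
  refine ⟨hmeas.aestronglyMeasurable, ?_⟩
  rw [HasFiniteIntegral, lintegral_prod _ hmeas.enorm.aemeasurable]
  simp only [lintegral_enorm_transport hm hk, lintegral_const]
  exact ENNReal.mul_lt_top hki.2 (by simp)

theorem integral_mul_integral_transport (hm : IsNonsingular φ E0 J m) (hχ : Measurable χ)
    (hC : ∀ x, |χ x| ≤ C) (hk : Measurable k) (hki : Integrable k m) {T : ℝ} (hT : 0 ≤ T) :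
    ∫ x, χ x * (∫ r in (0 : ℝ)..T, transport φ J r k x) ∂m =
      ∫ r in (0 : ℝ)..T, ∫ x, χ (φ r x) * k x ∂m := by
  have := hm.sigmaFinite
  have hi : Integrable (fun p : ℝ × X => χ p.2 * transport φ J p.1 k p.2)
      ((volume.restrict (Ioc 0 T)).prod m) :=
    (integrable_transport_prod hm hk hki T).bdd_mul (c := C)
      (hχ.comp measurable_snd).aestronglyMeasurable (.of_forall fun p => hC _)
  simp only [intervalIntegral.integral_of_le hT, ← integral_const_mul,
    ← integral_mul_transport hm hk hχ]
  exact (integral_integral_swap hi).symm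

theorem integrable_integral_transport (hm : IsNonsingular φ E0 J m) (hk : Measurable k)
    (hki : Integrable k m) {T : ℝ} (hT : 0 ≤ T) :
    Integrable (fun x => ∫ r in (0 : ℝ)..T, transport φ J r k x) m := by
  have := hm.sigmaFinite
  simpa only [intervalIntegral.integral_of_le hT] using
    (integrable_transport_prod hm hk hki T).integral_prod_right

theorem ae_intervalIntegrable_transport (hm : IsNonsingular φ E0 J m) (hk : Measurable k)
    (hki : Integrable k m) :
    ∀ᵐ x ∂m, ∀ T, 0 ≤ T → IntervalIntegrable (fun r => transport φ J r k x) volume 0 T := by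
  have := hm.sigmaFinite
  have h : ∀ n : ℕ, ∀ᵐ x ∂m, IntegrableOn (fun r => transport φ J r k x) (Ioc 0 (n : ℝ)) :=
    fun n => (integrable_transport_prod hm hk hki n).prod_left_ae
  filter_upwards [ae_all_iff.2 h] with x hx T hT
  obtain ⟨n, hn⟩ := exists_nat_ge T
  rw [intervalIntegrable_iff_integrableOn_Ioc_of_le hT]
  exact (hx n).mono_set (Ioc_subset_Ioc_right hn)

end Pairing

/-! ### From the weak equation to an integral equation along orbits. -/

section MildSolution

variable {X : Type*} [TopologicalSpace X] [SecondCountableTopology X] [MeasurableSpace X]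
  [BorelSpace X] {φ : Flow ℝ X} {E0 : Set X} {J : ℝ → X → ℝ≥0} {m mp mn : Measure X}
  {ϑ : X → ℝ≥0}

/-- Both sides of the hypothesis are differentiated from the right at `ε = 0`. -/
theorem eq_of_integral_eq_sub {c d : ℝ → ℝ} (hc : Continuous c) (hd : Continuous d) {t δ : ℝ}
    (hδ : 0 < δ)
    (h : ∀ ε ∈ Ioo 0 δ, ∫ q in (0 : ℝ)..ε, (∫ r in (0 : ℝ)..t, c (r + q)) =
      (∫ r in (0 : ℝ)..t, d (r + ε)) - ∫ r in (0 : ℝ)..t, d r) :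
    ∫ r in (0 : ℝ)..t, c r = d t - d 0 := by
  have hu : Continuous fun q => ∫ r in (0 : ℝ)..t, c (r + q) := by fun_prop
  have hU := (hu.integral_hasStrictDerivAt 0 0).hasDerivAt
  have hV : HasDerivAt (fun ε => (∫ r in (0 : ℝ)..t, d (r + ε)) - ∫ r in (0 : ℝ)..t, d r)
      (d t - d 0) 0 := by
    have e : (fun ε => (∫ r in (0 : ℝ)..t, d (r + ε)) - ∫ r in (0 : ℝ)..t, d r) =
        fun ε => ((∫ r in (0 : ℝ)..(ε + t), d r) - ∫ r in (0 : ℝ)..ε, d r) -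
          ∫ r in (0 : ℝ)..t, d r := by
      ext ε
      rw [intervalIntegral.integral_comp_add_right, zero_add, add_comm t ε,
        intervalIntegral.integral_interval_sub_left (hd.intervalIntegrable _ _)
          (hd.intervalIntegrable _ _)]
    rw [e]
    have h1 := (hd.integral_hasStrictDerivAt 0 (0 + t)).hasDerivAt.comp_add_const 0 t
    rw [zero_add] at h1
    exact (h1.sub (hd.integral_hasStrictDerivAt 0 0).hasDerivAt).sub_const _
  have heq : (fun ε => ∫ q in (0 : ℝ)..ε, (∫ r in (0 : ℝ)..t, c (r + q))) =ᶠ[𝓝[>] 0]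
      fun ε => (∫ r in (0 : ℝ)..t, d (r + ε)) - ∫ r in (0 : ℝ)..t, d r := by
    filter_upwards [Ioo_mem_nhdsGT hδ] with ε hε using h ε hε
  have h1 := hV.hasDerivWithinAt (s := Ioi 0) |>.congr_of_eventuallyEq heq (by simp)
  simpa using (uniqueDiffWithinAt_Ioi (0 : ℝ)).eq_deriv _ hU.hasDerivWithinAt h1

/-- The weak equation is tested with the double mean of the indicator of `K` over lengths `t` and
`ε`. Its flow derivative is an increment of the single mean, and `ε → 0` removes the auxiliary
average. -/
theorem setIntegral_transport_eq [T2Space X] (hE : IsAdmissible φ E0)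
    (hm : IsNonsingular φ E0 J m) {f k : L1E φ E0 m} (h : MaxTransport φ E0 m f k) {t δ : ℝ}
    (ht : 0 ≤ t) (hδ : 0 < δ) {K : Set X} (hK : IsCompact K) (hKa : K ⊆ alive φ E0 (t + δ)) :
    ∫ x in K, ((∫ r in (0 : ℝ)..t, transport φ J r (E0.indicator k) x) -
      transport φ J t (E0.indicator f) x + E0.indicator f x) ∂m = 0 := by
  have hχ : Measurable (K.indicator (1 : X → ℝ)) := measurable_one.indicator hK.measurableSet
  have hC : ∀ x, |K.indicator (1 : X → ℝ) x| ≤ 1 := fun x => by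
    by_cases h : x ∈ K <;> simp [h]
  set χ : X → ℝ := K.indicator 1 with hχdef
  have hkm := (measurable_coe_L1E k).indicator hE.measurableSet
  have hfm := (measurable_coe_L1E f).indicator hE.measurableSet
  have hki := (integrable_indicator_iff hE.measurableSet).2 (integrableOn_coe_L1E hE hm k)
  have hfi := (integrable_indicator_iff hE.measurableSet).2 (integrableOn_coe_L1E hE hm f)
  have hc := continuous_integral_comp_flow_mul hm hχ hC hkm hki
  have hd := continuous_integral_comp_flow_mul hm hχ hC hfm hfi
  have h1 := measurable_orbitMean φ ht hχ
  have hC1 := fun x => abs_orbitMean_le (φ := φ) ht hC x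
  have key := eq_of_integral_eq_sub hc hd (t := t) hδ fun ε hε => by
    have hψ := h _ (isTestFunction_orbitMean_orbitMean hE hK ht hε.1.le (hKa.trans
      fun x hx => ⟨hx.1, lt_of_le_of_lt (by exact_mod_cast (by linarith [hε.2])) hx.2⟩))
    rw [hm.integral_stateSpace hE, hm.integral_stateSpace hE, ← integral_indicator hE.measurableSet,
      ← integral_indicator hE.measurableSet] at hψ
    have e1 := integral_orbitMean_flow_mul hm h1 hC1 hki hε.1.le 0
    have e2 := integral_orbitMean_flow_mul hm hχ hC hfi ht ε
    have e3 := integral_orbitMean_flow_mul hm hχ hC hfi ht 0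
    simp only [add_zero, φ.map_zero_apply, integral_orbitMean_flow_mul hm hχ hC hki ht] at e1 e3
    rw [← e1, ← e2, ← e3, ← integral_sub (integrable_comp_flow_mul φ h1 hC1 hfi ε)
      (by simpa using integrable_comp_flow_mul φ h1 hC1 hfi 0)]
    refine Eq.trans (integral_congr_ae (.of_forall fun x => ?_))
      (hψ.trans (integral_congr_ae (.of_forall fun x => ?_)))
    · by_cases hx : x ∈ E0
      · simp only [indicator_of_mem hx, mul_comm, hχdef]
      · simp [hx]
    · by_cases hx : x ∈ E0
      · simp only [indicator_of_mem hx]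
        rw [flowDeriv_orbitMean φ ε (continuous_orbitMean_flow φ t hχ hC)]
        ring
      · simp [hx]
  have hGi := integrable_integral_transport hm hkm hki ht
  have hTi := integrable_transport hm hfm hfi t
  have hsub : IntegrableOn (fun x => (∫ r in (0 : ℝ)..t, transport φ J r (E0.indicator k) x) -
      transport φ J t (E0.indicator f) x) K m := (hGi.sub hTi).integrableOn
  rw [integral_add hsub hfi.integrableOn,
    integral_sub hGi.integrableOn hTi.integrableOn]
  have hset : ∀ u : X → ℝ, ∫ x in K, u x ∂m = ∫ x, χ x * u x ∂m := fun u => by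
    rw [← integral_indicator hK.measurableSet]
    refine integral_congr_ae (.of_forall fun x => ?_)
    by_cases hx : x ∈ K <;> simp [hχdef, hx]
  rw [hset, hset, hset, integral_mul_integral_transport hm hχ hC hkm hki ht, key,
    integral_mul_transport hm hfm hχ]
  simp

/-- If `G` were positive on a nonnull part of `A`, inner regularity would give a compact set of
positive measure there, on which the integral could not vanish. The same applies to `-G`. -/
theorem ae_eq_zero_of_forall_setIntegral_isCompact [T2Space X] [m.InnerRegular] {A : Set X}
    (hA : MeasurableSet A) {G : X → ℝ} (hG : Measurable G) (hGi : Integrable G m)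
    (h : ∀ K ⊆ A, IsCompact K → ∫ x in K, G x ∂m = 0) : ∀ᵐ x ∂m, x ∈ A → G x = 0 := by
  have main : ∀ u : X → ℝ, Measurable u → Integrable u m →
      (∀ K ⊆ A, IsCompact K → ∫ x in K, u x ∂m = 0) → ∀ᵐ x ∂m, x ∈ A → ¬ 0 < u x := by
    intro u hu hui hK0
    have hB : MeasurableSet (A ∩ {x | 0 < u x}) := hA.inter (measurableSet_lt measurable_const hu)
    have hnull : m (A ∩ {x | 0 < u x}) = 0 := by
      by_contra hne
      obtain ⟨K, hKB, hK, hpos⟩ := hB.exists_lt_isCompact (pos_iff_ne_zero.2 hne)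
      have h0 := hK0 K (hKB.trans inter_subset_left) hK
      have hnn : 0 ≤ᵐ[m.restrict K] u :=
        (ae_restrict_iff' hK.measurableSet).2 (.of_forall fun x hx => (hKB hx).2.le)
      have hz := (setIntegral_eq_zero_iff_of_nonneg_ae hnn hui.integrableOn).1 h0
      have hz' := (ae_restrict_iff' hK.measurableSet).1 hz
      refine hpos.ne' (measure_eq_zero_iff_ae_notMem.2 ?_)
      filter_upwards [hz'] with x hx hxK
      exact (hKB hxK).2.ne' (hx hxK)
    filter_upwards [measure_eq_zero_iff_ae_notMem.1 hnull] with x hx hxA hpos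
    exact hx ⟨hxA, hpos⟩
  filter_upwards [main G hG hGi h, main (fun x => -G x) hG.neg hGi.neg fun K hK hc => by
    rw [integral_neg, h K hK hc, neg_zero]] with x h1 h2 hxA
  have := h1 hxA
  have := h2 hxA
  linarith

/-- The compact sets need some survival time beyond `t`; the points alive at `t` are exhausted by
those alive at `t + 1/(n+1)`. -/
theorem ae_transport_eq [T2Space X] (hE : IsAdmissible φ E0)
    (hm : IsNonsingular φ E0 J m) {f k : L1E φ E0 m} (h : MaxTransport φ E0 m f k) {t : ℝ}
    (ht : 0 ≤ t) :
    ∀ᵐ x ∂m, x ∈ alive φ E0 t → transport φ J t (E0.indicator f) x =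
      E0.indicator f x + ∫ r in (0 : ℝ)..t, transport φ J r (E0.indicator k) x := by
  have := hm.sigmaFinite
  have := hm.innerRegular
  have hkm := (measurable_coe_L1E k).indicator hE.measurableSet
  have hfm := (measurable_coe_L1E f).indicator hE.measurableSet
  have hki := (integrable_indicator_iff hE.measurableSet).2 (integrableOn_coe_L1E hE hm k)
  have hfi := (integrable_indicator_iff hE.measurableSet).2 (integrableOn_coe_L1E hE hm f)
  have hGi := integrable_integral_transport hm hkm hki ht
  have hTi := integrable_transport hm hfm hfi t
  have hGm : Measurable fun x => ∫ r in (0 : ℝ)..t, transport φ J r (E0.indicator k) x := by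
    simp only [intervalIntegral.integral_of_le ht]
    exact (((measurable_transport_uncurry hm hkm).comp
      measurable_swap).stronglyMeasurable.integral_prod_right'
        (ν := volume.restrict (Ioc (0 : ℝ) t))).measurable
  have hn : ∀ n : ℕ, ∀ᵐ x ∂m, x ∈ alive φ E0 (t + 1 / ((n : ℝ) + 1)) →
      (∫ r in (0 : ℝ)..t, transport φ J r (E0.indicator k) x) -
        transport φ J t (E0.indicator f) x + E0.indicator f x = 0 := fun n =>
    ae_eq_zero_of_forall_setIntegral_isCompact (hE.measurableSet_alive _)
      ((hGm.sub (measurable_transport hm hfm t)).add hfm) ((hGi.sub hTi).add hfi)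
      fun K hK hc => setIntegral_transport_eq hE hm h ht Nat.one_div_pos_of_nat hc hK
  filter_upwards [ae_all_iff.2 hn] with x hx hxa
  obtain ⟨s, hs1, hs2⟩ := EReal.lt_iff_exists_real_btwn.1 hxa.2
  have hs1' : t < s := by exact_mod_cast hs1
  obtain ⟨n, hn'⟩ := exists_nat_one_div_lt (sub_pos.2 hs1')
  have hlt : t + 1 / ((n : ℝ) + 1) < s := by linarith
  have := hx n ⟨hxa.1, lt_trans (EReal.coe_lt_coe_iff.2 hlt) hs2⟩
  linarith

end MildSolution

/-! ### Elements of the graph of `A₀` solve the resolvent equation. -/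

section Uniqueness

variable {X : Type*} [TopologicalSpace X] [SecondCountableTopology X] [MeasurableSpace X]
  [BorelSpace X] {φ : Flow ℝ X} {E0 : Set X} {J : ℝ → X → ℝ≥0} {m mp mn : Measure X}
  {ϑ : X → ℝ≥0}

/-- Almost every backward orbit meets `E0` only in points of a given conull subset, for almost
every time. -/
theorem ae_ae_flow_neg (hE : IsAdmissible φ E0) (hm : IsNonsingular φ E0 J m) {p : X → Prop}
    (hp : ∀ᵐ y ∂m.restrict E0, p y) : ∀ᵐ x ∂m, ∀ᵐ r : ℝ, φ (-r) x ∈ E0 → p (φ (-r) x) := by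
  have := hm.sigmaFinite
  obtain ⟨N, hN, hNm, hN0⟩ :=
    exists_measurable_superset_of_null (ae_iff.1 ((ae_restrict_iff' hE.measurableSet).1 hp))
  have h1 : ∀ᵐ r : ℝ, ∀ᵐ x ∂m, φ (-r) x ∉ N := .of_forall fun r =>
    measure_eq_zero_iff_ae_notMem.1 ((hm.quasiMeasurePreserving (-r)).preimage_null hN0)
  have hmeas : MeasurableSet {q : ℝ × X | φ (-q.1) q.2 ∉ N} :=
    measurable_flow_apply φ measurable_fst.neg measurable_snd hNm.compl
  rw [Measure.ae_ae_comm hmeas] at h1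
  filter_upwards [h1] with x hx
  filter_upwards [hx] with r hr hrE
  by_contra h
  exact hr (hN fun hh => h (hh hrE))

/-- Fubini exchanges the quantifiers, giving one null set of points outside which the equation holds
at almost every time, as integration along a single orbit requires. -/
theorem ae_ae_transport_eq [T2Space X] (hE : IsAdmissible φ E0)
    (hm : IsNonsingular φ E0 J m) {f k : L1E φ E0 m} (h : MaxTransport φ E0 m f k) :
    ∀ᵐ x ∂m, ∀ᵐ t : ℝ, 0 ≤ t → x ∈ alive φ E0 t → transport φ J t (E0.indicator f) x =
      E0.indicator f x + ∫ r in (0 : ℝ)..t, transport φ J r (E0.indicator k) x := by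
  have := hm.sigmaFinite
  have hkm := (measurable_coe_L1E k).indicator hE.measurableSet
  have hfm := (measurable_coe_L1E f).indicator hE.measurableSet
  have h1 : ∀ᵐ t : ℝ, ∀ᵐ x ∂m, 0 ≤ t → x ∈ alive φ E0 t → transport φ J t (E0.indicator f) x =
      E0.indicator f x + ∫ r in (0 : ℝ)..t, transport φ J r (E0.indicator k) x := by
    refine .of_forall fun t => ?_
    by_cases ht : 0 ≤ t
    · filter_upwards [ae_transport_eq hE hm h ht] with x hx _ using hx
    · exact .of_forall fun x h0 => absurd h0 ht
  refine (Measure.ae_ae_comm ?_).1 h1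
  have e1 : MeasurableSet {p : ℝ × X | 0 ≤ p.1} := measurableSet_le measurable_const measurable_fst
  have e2 : MeasurableSet {p : ℝ × X | transport φ J p.1 (E0.indicator f) p.2 =
      E0.indicator f p.2 + ∫ r in (0 : ℝ)..p.1, transport φ J r (E0.indicator k) p.2} :=
    measurableSet_eq_fun (measurable_transport_uncurry hm hfm)
      ((hfm.comp measurable_snd).add (measurable_integral_uncurry
        (F := fun p : ℝ × X => transport φ J p.1 (E0.indicator k) p.2)
        (measurable_transport_uncurry hm hkm)))
  exact e1.imp (hE.measurableSet_alive_prod.imp e2)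

theorem discounted_of_mem {u : X → ℝ} {r : ℝ} {x : X} (hϑ : IsJumpRate φ E0 ϑ)
    (hx : x ∈ alive φ E0 r) : discounted φ E0 J ϑ u r x =
      Real.exp (-∫ q in (0 : ℝ)..r, (1 + (ϑ (φ (-q) x) : ℝ))) * transport φ J r u x := by
  rw [discounted, killed, survival_of_mem hx, backRate,
    intervalIntegral.integral_add intervalIntegrable_const (hϑ.intervalIntegrable_back x 0 r),
    neg_add, Real.exp_add, mul_assoc]
  simp

theorem transport_indicator_of_mem (u : X → ℝ) {r : ℝ} {x : X} (hx : φ (-r) x ∈ E0) :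
    transport φ J r (E0.indicator u) x = transport φ J r u x := by
  rw [transport, transport, indicator_of_mem hx]

/-- A solution of the resolvent equation, integrated backwards along almost every orbit. -/
theorem ae_integral_discounted_eq [T2Space X] (hE : IsAdmissible φ E0)
    (hm : IsNonsingular φ E0 J m) (hϑ : IsJumpRate φ E0 ϑ) {f k : L1E φ E0 m}
    (hfk : MaxTransport φ E0 m f k) {h : X → ℝ}
    (hh : h =ᵐ[m.restrict E0] fun x => f x - k x + ϑ x * f x) :
    ∀ᵐ x ∂m.restrict E0, ∀ᵐ T : ℝ, 0 ≤ T → x ∈ alive φ E0 T →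
      ∫ r in (0 : ℝ)..T, discounted φ E0 J ϑ h r x = f x - discounted φ E0 J ϑ f T x := by
  have hkm := (measurable_coe_L1E k).indicator hE.measurableSet
  have hki := (integrable_indicator_iff hE.measurableSet).2 (integrableOn_coe_L1E hE hm k)
  filter_upwards [ae_restrict_mem hE.measurableSet,
    ae_restrict_of_ae (ae_ae_transport_eq hE hm hfk),
    ae_restrict_of_ae (ae_ae_flow_neg hE hm hh),
    ae_restrict_of_ae (ae_intervalIntegrable_transport hm hkm hki)] with x hx hF hH hK
  filter_upwards [hF] with T hFT h0 hT
  have hback := (hE.staysIn.mem_alive_iff h0).1 hT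
  have hκ : IntervalIntegrable (fun r => 1 + (ϑ (φ (-r) x) : ℝ)) volume 0 T :=
    intervalIntegrable_const.add (hϑ.intervalIntegrable_back x 0 T)
  have key := integral_exp_neg_integral_mul hκ (hK T h0) (f x)
  have hFT' := hFT h0 hT
  rw [transport_indicator_of_mem _ (hback T ⟨h0, le_rfl⟩), indicator_of_mem hx] at hFT'
  rw [discounted_of_mem hϑ hT, hFT', ← key]
  refine intervalIntegral.integral_congr_ae ?_
  filter_upwards [hF, hH] with r hFr hHr hr
  rw [uIoc_of_le h0] at hr
  have hr0 : r ∈ Icc 0 T := ⟨hr.1.le, hr.2⟩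
  have hra : x ∈ alive φ E0 r := ⟨hx, lt_of_le_of_lt (by exact_mod_cast hr.2) hT.2⟩
  have hFr' := hFr hr.1.le hra
  rw [indicator_of_mem hx] at hFr'
  rw [discounted_of_mem hϑ hra, ← hFr', transport_indicator_of_mem _ (hback r hr0),
    transport_indicator_of_mem _ (hback r hr0)]
  simp only [transport, hHr (hback r hr0)]
  ring

theorem neBot_nhdsWithin_Iio_inter {p : ℝ → Prop} (hp : ∀ᵐ t : ℝ, p t) (τ : ℝ) :
    (𝓝[Iio τ ∩ {t | p t}] τ).NeBot := by
  rw [← mem_closure_iff_nhdsWithin_neBot]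
  have h := (Measure.dense_of_ae hp).open_subset_closure_inter (isOpen_Iio (a := τ))
  refine closure_minimal h isClosed_closure ?_
  rw [closure_Iio]
  exact self_mem_Iic

theorem ae_eq_resolvent_of_graphA0 [T2Space X] (hE : IsAdmissible φ E0)
    (hm : IsNonsingular φ E0 J m) (hϑ : IsJumpRate φ E0 ϑ) (hb : IsBoundaryPair φ E0 J m mp mn)
    {f g : L1E φ E0 m} (hfg : GraphA0 φ E0 J m mn ϑ f g) :
    f =ᵐ[m.restrict E0] resolvent φ E0 J ϑ (f - g : L1E φ E0 m) := by
  obtain ⟨⟨-, k, hk, hgk⟩, f', hf', htr⟩ := hfg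
  set h : L1E φ E0 m := f - g
  have hh : h =ᵐ[m.restrict E0] fun x => f x - k x + ϑ x * f x := by
    filter_upwards [coeFn_sub_L1E hE hm f g, (hm.ae_stateSpace_iff hE).1 hgk] with x h1 h2
    have h1' : h x = f x - g x := h1
    rw [h1', h2]
    ring
  have hent := (ae_restrict_iff' hE.measurableSet_entered).1 (ae_entrance_point hE hm hb htr)
  filter_upwards [ae_restrict_mem hE.measurableSet, ae_integral_discounted_eq hE hm hϑ hk hh,
    ae_restrict_of_ae (ae_ae_flow_neg hE hm ((hm.ae_stateSpace_iff hE).1 hf')),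
    ae_restrict_of_ae hent,
    ae_restrict_of_ae (ae_integrableOn_discounted hE hm hϑ (measurable_coe_L1E h)
      (integrableOn_coe_L1E hE hm h)),
    ae_restrict_of_ae (ae_integrableOn_discounted hE hm hϑ (measurable_coe_L1E f)
      (integrableOn_coe_L1E hE hm f))] with x hx hT hff htrx hhi hfi
  rcases eq_or_lt_of_le (le_top : tMinus φ E0 x ≤ ⊤) with htop | hfin
  -- Infinite backward time: `e^{-T}S(T)f(x)` agrees for almost every `T` with a function converging
  -- to `f x - R h(x)`. Being integrable on the half-line, it can only have limit zero.
  · have hlim := (intervalIntegral_tendsto_integral_Ioi 0 hhi tendsto_id).const_sub (f x)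
    have hae : (fun T => discounted φ E0 J ϑ f T x) =ᵐ[volume.restrict (Ioi 0)]
        fun T => f x - ∫ r in (0 : ℝ)..id T, discounted φ E0 J ϑ h r x := by
      rw [EventuallyEq, ae_restrict_iff' measurableSet_Ioi]
      filter_upwards [hT] with T hT hT0
      rw [id, hT (le_of_lt hT0) ⟨hx, by rw [htop]; exact EReal.coe_lt_top T⟩]
      ring
    have hint := hfi.congr hae
    refine sub_eq_zero.1 (IntegrableAtFilter.eq_zero_of_tendsto
      ⟨Ioi 0, Ioi_mem_atTop 0, hint⟩ (fun s hs => ?_) hlim)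
    obtain ⟨b, hb⟩ := mem_atTop_sets.1 hs
    rw [← top_le_iff, ← Real.volume_Ici (a := b)]
    exact measure_mono hb
  · have hτ := hE.staysIn.coe_toReal_tMinus hx hfin
    have hτ0 := hE.staysIn.toReal_tMinus_pos hx hfin
    have htrx' := htrx ⟨hx, hfin⟩
    simp only [wMinus] at htrx'
    set τ := (tMinus φ E0 x).toReal
    have halive : ∀ T, T < τ → x ∈ alive φ E0 T := fun T hTτ =>
      ⟨hx, by rw [← hτ]; exact_mod_cast hTτ⟩
    -- Killing at the entrance time truncates the resolvent integral at `τ`.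
    have hres : resolvent φ E0 J ϑ h x = ∫ r in (0 : ℝ)..τ, discounted φ E0 J ϑ h r x := by
      rw [intervalIntegral.integral_of_le hτ0.le]
      refine setIntegral_eq_of_subset_of_forall_sdiff_eq_zero measurableSet_Ioi
        (fun r hr => hr.1) fun r hr => ?_
      have hτr : τ < r := by
        by_contra hle
        exact hr.2 ⟨hr.1, not_lt.1 hle⟩
      rw [discounted, killed, survival_of_notMem, zero_mul, mul_zero]
      intro hmem
      have := hmem.2
      rw [← hτ] at this
      exact absurd (EReal.coe_lt_coe_iff.1 this) hτr.not_gt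
    have hcont : ContinuousWithinAt (fun T => ∫ r in (0 : ℝ)..T, discounted φ E0 J ϑ h r x)
        (Icc 0 τ) τ := by
      have := intervalIntegral.continuousOn_primitive_interval (a := 0) (b := τ)
        (f := fun r => discounted φ E0 J ϑ h r x) (μ := volume) (by
          rw [uIcc_of_le hτ0.le, integrableOn_Icc_iff_integrableOn_Ioc]
          exact hhi.mono_set fun r hr => hr.1)
      rw [uIcc_of_le hτ0.le] at this
      exact this τ ⟨hτ0.le, le_rfl⟩
    -- With `z = φ_{-τ}x`, the cocycle writes the transported value as `f'(φ_{τ-T}z) J_{τ-T}(z)`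
    -- times the constant `J_{-τ}(x)`; the zero trace at `z` applies.
    have hu : Tendsto (fun T => transport φ J T f' x) (𝓝[<] τ) (𝓝 0) := by
      have hs : Tendsto (fun T => τ - T) (𝓝[<] τ) (𝓝[>] 0) := by
        refine tendsto_nhdsWithin_iff.2 ⟨?_, ?_⟩
        · have := (continuous_sub_left τ).tendsto τ
          rw [sub_self] at this
          exact this.mono_left nhdsWithin_le_nhds
        · filter_upwards [self_mem_nhdsWithin] with T hT
          exact sub_pos.2 (mem_Iio.1 hT)
      have h1 := (htrx'.comp hs).mul_const (J (-τ) x : ℝ)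
      rw [zero_mul] at h1
      refine h1.congr fun T => ?_
      have e : -T = (τ - T) + -τ := by ring
      simp only [Function.comp, transport]
      rw [e, φ.map_add, hm.cocycle_add]
      push_cast
      ring
    have hmain : ∀ᵐ T : ℝ, T < τ → 0 ≤ T →
        |f x - ∫ r in (0 : ℝ)..T, discounted φ E0 J ϑ h r x| ≤ |transport φ J T f' x| := by
      filter_upwards [hT, hff] with T h1 h2 h3 h4
      have hmem := flow_neg_mem_of_mem_alive hE.staysIn h4 (halive T h3)
      rw [h1 h4 (halive T h3), sub_sub_cancel, discounted, killed, ← mul_assoc, abs_mul,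
        transport, transport, h2 hmem]
      refine mul_le_of_le_one_left (abs_nonneg _) ?_
      rw [abs_of_nonneg (mul_nonneg (Real.exp_pos _).le (survival_nonneg _ _))]
      exact mul_le_one₀ (Real.exp_le_one_iff.2 (neg_nonpos.2 h4)) (survival_nonneg _ _)
        (survival_le_one h4 x)
    -- The estimate holds only for almost every `T`, but such times accumulate at `τ` from the left,
    -- so limits can be compared along them.
    have hne := neBot_nhdsWithin_Iio_inter hmain τ
    have hle : 𝓝[Iio τ ∩ {T | T < τ → 0 ≤ T →
        |f x - ∫ r in (0 : ℝ)..T, discounted φ E0 J ϑ h r x| ≤ |transport φ J T f' x|}] τ ≤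
          𝓝[<] τ := nhdsWithin_mono _ inter_subset_left
    have hL : Tendsto (fun T => ∫ r in (0 : ℝ)..T, discounted φ E0 J ϑ h r x) (𝓝[<] τ)
        (𝓝 (∫ r in (0 : ℝ)..τ, discounted φ E0 J ϑ h r x)) := by
      refine hcont.mono_left ?_
      rw [← nhdsWithin_Ico_eq_nhdsLT hτ0]
      exact nhdsWithin_mono _ Ico_subset_Icc_self
    have h0 : Tendsto (fun T => f x - ∫ r in (0 : ℝ)..T, discounted φ E0 J ϑ h r x)
        (𝓝[Iio τ ∩ {T | T < τ → 0 ≤ T →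
        |f x - ∫ r in (0 : ℝ)..T, discounted φ E0 J ϑ h r x| ≤ |transport φ J T f' x|}] τ)
        (𝓝 0) := by
      refine squeeze_zero_norm' ?_ ((hu.mono_left hle).abs.trans (by simp))
      filter_upwards [self_mem_nhdsWithin, hle (Ico_mem_nhdsLT hτ0)] with T h1 h2
      exact h1.2 h2.2 h2.1
    rw [hres]
    exact sub_eq_zero.1 (tendsto_nhds_unique ((hL.mono_left hle).const_sub (f x)) h0)

theorem graphA0_iff_graphGenerator [T2Space X] (hE : IsAdmissible φ E0)
    (hm : IsNonsingular φ E0 J m) (hϑ : IsJumpRate φ E0 ϑ) (hb : IsBoundaryPair φ E0 J m mp mn)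
    {f g : L1E φ E0 m} :
    GraphA0 φ E0 J m mn ϑ f g ↔ GraphGenerator (killedL1 hE hm hϑ) f g := by
  rw [graphGenerator_iff_ae_eq_resolvent]
  exact ⟨ae_eq_resolvent_of_graphA0 hE hm hϑ hb, graphA0_of_ae_eq_resolvent hE hm hϑ hb⟩

end Uniqueness

end PDMP

/-! ### The theorem. -/

open Classical in
theorem theorem2p3 {X : Type*} [MetricSpace X] [TopologicalSpace.SeparableSpace X]
    [MeasurableSpace X] [BorelSpace X]
    (φ : Flow ℝ X) (E0 : Set X) (hE0 : PDMP.IsAdmissible φ E0)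
    (J : ℝ → X → ℝ≥0) (m : Measure X) (hm : PDMP.IsNonsingular φ E0 J m)
    (ϑ : X → ℝ≥0) (hϑ : PDMP.IsJumpRate φ E0 ϑ)
    (mp mn : Measure X) (hb : PDMP.IsBoundaryPair φ E0 J m mp mn) :
    ∃ S : ℝ≥0 → (PDMP.L1E φ E0 m →ₗ[ℝ] PDMP.L1E φ E0 m),
      PDMP.IsSubstochasticSemigroup S ∧
      -- the generator of the semigroup is the operator `A₀`, with equal domains
      (∀ f g : PDMP.L1E φ E0 m,
        PDMP.GraphA0 φ E0 J m mn ϑ f g ↔ PDMP.GraphGenerator S f g) ∧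
      -- the explicit formula, with killing at the first exit backwards along the flow
      (∀ t : ℝ≥0, 0 < t → ∀ f : PDMP.L1E φ E0 m,
        ∀ᵐ x ∂(m.restrict (PDMP.stateSpace φ E0)),
          S t f x = if ((t : ℝ) : EReal) < PDMP.tMinus φ E0 x then
            f (φ (-(t : ℝ)) x) * (J (-(t : ℝ)) x : ℝ) *
              Real.exp (-∫ r in (0 : ℝ)..t, (ϑ (φ (-r) x) : ℝ)) else 0) ∧
      -- if no orbit returns to `E0` after leaving it, the indicator is that of `φ_{-t} x ∈ E`
      ((∀ x ∈ E0, ∀ t : ℝ, 0 < t → φ (-t) x ∈ E0 → ∀ r ∈ Icc (0 : ℝ) t, φ (-r) x ∈ E0) →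
        ∀ t : ℝ≥0, 0 < t → ∀ f : PDMP.L1E φ E0 m,
          ∀ᵐ x ∂(m.restrict (PDMP.stateSpace φ E0)),
            S t f x = if φ (-(t : ℝ)) x ∈ PDMP.stateSpace φ E0 then
              f (φ (-(t : ℝ)) x) * (J (-(t : ℝ)) x : ℝ) *
                Real.exp (-∫ r in (0 : ℝ)..t, (ϑ (φ (-r) x) : ℝ)) else 0) ∧
      -- the duality formula, for every nonnegative Borel function `ψ`
      (∀ t : ℝ≥0, ∀ f : PDMP.L1E φ E0 m, 0 ≤ f → ∀ ψ : X → ℝ≥0∞, Measurable ψ →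
        ∫⁻ x in PDMP.stateSpace φ E0, ψ x * ENNReal.ofReal (S t f x) ∂m =
          ∫⁻ x in PDMP.stateSpace φ E0,
            (if ((t : ℝ) : EReal) < PDMP.tPlus φ E0 x then
              ENNReal.ofReal (Real.exp (-∫ r in (0 : ℝ)..t, (ϑ (φ r x) : ℝ))) *
                ψ (φ t x) * ENNReal.ofReal (f x) else 0) ∂m) := by
  have : SecondCountableTopology X := UniformSpace.secondCountable_of_separable X
  exact ⟨PDMP.killedL1 hE0 hm hϑ, PDMP.isSubstochasticSemigroup_killedL1 hE0 hm hϑ,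
    fun f g => PDMP.graphA0_iff_graphGenerator hE0 hm hϑ hb,
    fun t _ f => PDMP.killedL1_formula hE0 hm hϑ t f,
    fun h t ht f => PDMP.killedL1_formula_of_no_return hE0 hm hϑ h ht f,
    fun t f hf ψ hψ => PDMP.lintegral_mul_killedL1 hE0 hm hϑ t hf hψ⟩
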